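/- **Setting.** Let $\mathbb{R}^3_+=\{x^3>0\}$ carry the hyperbolic metric $\bar g=(x^3)^{-2}\delta$ with Levi-Civita connection $\bar\nabla$, let $r$ be the $\bar g$-distance to $o=(0,0,1)$ and let $V=1/x^3$. Let $g$ be a Riemannian metric of class $C^2$ on $\mathbb{R}^3_+$ that is asymptotically hyperbolic with decay rate $\tau>\tfrac32$: for $e=g-\bar g$, $$|e|_{\bar g}+|\bar\nabla e|_{\bar g}+|\bar\nabla\bar\nabla e|_{\bar g}=O(e^{-\tau r})\quad (r\to\infty).$$ Let $\mathbb{U}=V\,\mathrm{div}_{\bar g}\,e-V\,d(\mathrm{tr}_{\bar g}e)+\mathrm{tr}_{\bar g}e\,dV-e(\bar\nabla V,\cdot)$ be the mass integrand. A polyhedron is a non-empty compact set $\Delta\subset\mathbb{R}^3_+$ which is the closure of its interior, whose boundary lies in finitely many Euclidean planes, and which, near every boundary point except finitely many vertices, is a Euclidean half space (face points) or a wedge bounded by two half planes and with interior angle in $(0,\pi)\cup(\pi,2\pi)$ (edge points). On the faces let $\bar\nu$ be the outward $\bar g$-unit normal and let $H,\bar H$ be the mean curvatures with respect to $g,\bar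 g$ and the corresponding outward unit normals (the trace of $X\mapsto\nabla_X\nu$ on the tangent plane). On the edges let $\alpha,\bar\alpha$ be the interior dihedral angles with respect to $g,\bar g$. Let $d\bar\sigma,d\bar\lambda$ be the $\bar g$-area and $\bar g$-length elements. Let $(\Delta_q)$ be a family of polyhedra, $E_q$ the union of the edges of $\Delta_q$, and suppose that the flux of $\mathbb{U}$ converges along the family to the mass $\mathbf M(V)\in\mathbb{R}$: $$\mathbf M(V)=\int_{\partial\Delta_q}\mathbb{U}^i\bar\nu_i\,d\bar\sigma+o(1).$$ **Theorem.** Suppose that for some $c>0$ every dihedral angle of every $\Delta_q$ satisfies $\sin\bar\alpha\ge c$. Then all the integrals below exist and $$\mathbf M(V)=-\int_{\partial\Delta_q}2V(H-\bar H)\,d\bar\sigma+2\int_{E_q}V(\alpha-\bar\alpha)\,d\bar\lambda+\int_{\partial\Delta_q}O(\cosh^{-2\tau+1}r)\,d\bar\sigma+\int_{E_q}O(\cosh^{-2\tau+1}r)\,d\bar\lambda+o(1),$$ where the two $O(\cosh^{-2\tau+1}r)$ stand for integrable functions on $\partial\Delta_q$ and on $E_q$ bounded in absolute value by $C\cosh^{-2\tau+1}r$,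 with a constant $C$ that depends only on $g,\tau,c$ (not on $q$ or on the family), and $o(1)$ tends to $0$ along the family. -/

import Mathlib

open MeasureTheory Filter Topology

noncomputable section

namespace AHMass

/-- Euclidean three-space. The coordinates `x^1, x^2, x^3` are `x 0`, `x 1`, `x 2`. -/
abbrev E3 : Type := EuclideanSpace ℝ (Fin 3)

/-- The upper half space `{x^3 > 0}`. -/
def upperHalfSpace : Set E3 := {x | 0 < x 2}

/-- Coordinate components `g_{ij}(x)` of a symmetric 2-tensor field. -/
abbrev MetricField : Type := E3 → Matrix (Fin 3) (Fin 3) ℝ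

/-- The hyperbolic metric `(x^3)^{-2} δ_{ij}`. -/
def hypMetric : MetricField := fun x => ((x 2 ^ 2)⁻¹ : ℝ) • (1 : Matrix (Fin 3) (Fin 3) ℝ)

/-- The base point `o = (0, 0, 1)`. -/
def basePoint : E3 := EuclideanSpace.single 2 1

/-- Hyperbolic distance in the upper half space model. -/
def hypDist (x y : E3) : ℝ := Real.arcosh (1 + ‖x - y‖ ^ 2 / (2 * x 2 * y 2))

/-- Hyperbolic distance `r` to the base point. -/
def rad (x : E3) : ℝ := hypDist x basePoint

/-- The static potential `V = 1 / x^3`. -/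
def potential (x : E3) : ℝ := 1 / x 2

/-! ### Tensor calculus in the coordinates of the half space -/

/-- The partial derivative `∂_i f (x)`. -/
def pd (i : Fin 3) (f : E3 → ℝ) (x : E3) : ℝ := fderiv ℝ f x (EuclideanSpace.single i 1)

/-- Christoffel symbols `Γ^k_{ij}` of the Levi-Civita connection of `g`. -/
def christoffel (g : MetricField) (x : E3) (k i j : Fin 3) : ℝ :=
  (1 / 2) * ∑ l, (g x)⁻¹ k l *
    (pd i (fun y => g y j l) x + pd j (fun y => g y i l) x - pd l (fun y => g y i j) x)

/-- Components of a covariant `k`-tensor field. -/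
abbrev TensorField (k : ℕ) : Type := E3 → (Fin k → Fin 3) → ℝ

/-- The covariant derivative with respect to the Levi-Civita connection of `g`;
the direction of differentiation is the first index. -/
def covDeriv (g : MetricField) {k : ℕ} (T : TensorField k) : TensorField (k + 1) :=
  fun x I => pd (I 0) (fun y => T y (Fin.tail I)) x
    - ∑ s : Fin k, ∑ m : Fin 3,
        christoffel g x m (I 0) (I s.succ) * T x (Function.update (Fin.tail I) s m)

/-- The norm of a covariant `k`-tensor with respect to the metric `g`. -/
def tensorNorm (g : MetricField) {k : ℕ} (x : E3) (T : (Fin k → Fin 3) → ℝ) : ℝ :=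
  Real.sqrt (∑ I : Fin k → Fin 3, ∑ J : Fin k → Fin 3,
    (∏ s, (g x)⁻¹ (I s) (J s)) * T I * T J)

/-- The deviation `e = g - ḡ`, as a covariant 2-tensor field. -/
def deviation (g : MetricField) : TensorField 2 :=
  fun x I => g x (I 0) (I 1) - hypMetric x (I 0) (I 1)

/-- `g` is (in upper half space coordinates) an asymptotically hyperbolic Riemannian metric with
decay rate `τ`: a `C²` field of positive definite symmetric matrices on the upper half space with
`|e| + |∇̄e| + |∇̄∇̄e| = O(e^{-τ r})` as `r → ∞`. -/
structure IsAsymptoticallyHyperbolic (τ : ℝ) (g : MetricField) : Prop where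
  contDiffOn : ∀ i j, ContDiffOn ℝ 2 (fun x => g x i j) upperHalfSpace
  posDef : ∀ x ∈ upperHalfSpace, (g x).PosDef
  decay : ∃ K R : ℝ, ∀ x ∈ upperHalfSpace, R ≤ rad x →
    tensorNorm hypMetric x (deviation g x)
      + tensorNorm hypMetric x (covDeriv hypMetric (deviation g) x)
      + tensorNorm hypMetric x (covDeriv hypMetric (covDeriv hypMetric (deviation g)) x)
      ≤ K * Real.exp (-τ * rad x)

/-! ### The mass integrand -/

/-- The trace `tr_ḡ e`. -/
def trDev (g : MetricField) (x : E3) : ℝ :=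
  ∑ i, ∑ j, (hypMetric x)⁻¹ i j * deviation g x ![i, j]

/-- The divergence `(div_ḡ e)_i = ḡ^{jk} ∇̄_j e_{ki}`. -/
def divDev (g : MetricField) (x : E3) (i : Fin 3) : ℝ :=
  ∑ j, ∑ k, (hypMetric x)⁻¹ j k * covDeriv hypMetric (deviation g) x ![j, k, i]

/-- The gradient of the potential with respect to `ḡ`. -/
def gradPotential (x : E3) (j : Fin 3) : ℝ := ∑ k, (hypMetric x)⁻¹ j k * pd k potential x

/-- The mass integrand `𝕌 = V div e - V d(tr e) + tr e dV - e(∇̄V, ·)`, a 1-form. -/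
def massIntegrand (g : MetricField) (x : E3) (i : Fin 3) : ℝ :=
  potential x * divDev g x i - potential x * pd i (trDev g) x + trDev g x * pd i potential x
    - ∑ j, gradPotential x j * deviation g x ![j, i]

/-! ### Geometry of Euclidean planes with respect to a metric -/

/-- The `g`-inner product of two vectors at `x`. -/
def gInner (g : MetricField) (x : E3) (u v : Fin 3 → ℝ) : ℝ := ∑ i, ∑ j, g x i j * u i * v j

/-- The unit normal, with respect to `g`, of the Euclidean planes `{y | ∑ a_j y^j = const}`,
pointing to the side towards which the Euclidean normal vector `a` points:
`ν^i = g^{ij} a_j / √(g^{kl} a_k a_l)`. -/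
def unitNormal (g : MetricField) (a : E3) (x : E3) (i : Fin 3) : ℝ :=
  (∑ j, (g x)⁻¹ i j * a j) / Real.sqrt (∑ k, ∑ l, (g x)⁻¹ k l * a k * a l)

/-- The component `(∇_i W)^k` of the covariant derivative of a vector field `W`. -/
def covDerivVec (g : MetricField) (W : E3 → Fin 3 → ℝ) (x : E3) (i k : Fin 3) : ℝ :=
  pd i (fun y => W y k) x + ∑ l, christoffel g x k i l * W x l

/-- The bilinear form `A_{ij} = g(∇_i ν, ∂_j)`; on vectors tangent to the plane with Euclidean
normal `a` through `x` it is the second fundamental form with respect to `ν`. -/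
def secondFF (g : MetricField) (a : E3) (x : E3) (i j : Fin 3) : ℝ :=
  ∑ k, g x j k * covDerivVec g (unitNormal g a) x i k

/-- The mean curvature with respect to `g`, at `x`, of the Euclidean plane with Euclidean normal `a`
through `x`: the trace of the second fundamental form over the tangent plane. -/
def meanCurvature (g : MetricField) (a : E3) (x : E3) : ℝ :=
  ∑ i, ∑ j, ((g x)⁻¹ i j - unitNormal g a x i * unitNormal g a x j) * secondFF g a x i j

/-- The angle, with respect to `g`, between the unit normals determined by `a` and `b`. -/
def normalAngle (g : MetricField) (a b : E3) (x : E3) : ℝ :=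
  Real.arccos (gInner g x (unitNormal g a x) (unitNormal g b x))

/-! ### Polyhedra -/

/-- Near `p`, the set `Δ` is the half space with Euclidean outward unit normal `a`: `p` is an
interior point of a face. -/
def IsFacePoint (Δ : Set E3) (p a : E3) : Prop :=
  ‖a‖ = 1 ∧ ∀ᶠ x in 𝓝 p, (x ∈ Δ ↔ inner ℝ a (x - p) ≤ 0)

/-- Near `p`, the set `Δ` is a wedge with interior angle in `(0, π)`, whose two sides have Euclidean
outward unit normals `a` and `b`. -/
def IsConvexEdgePoint (Δ : Set E3) (p a b : E3) : Prop :=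
  ‖a‖ = 1 ∧ ‖b‖ = 1 ∧ LinearIndependent ℝ ![a, b] ∧
    ∀ᶠ x in 𝓝 p, (x ∈ Δ ↔ inner ℝ a (x - p) ≤ 0 ∧ inner ℝ b (x - p) ≤ 0)

/-- Near `p`, the set `Δ` is a wedge with interior angle in `(π, 2π)`, whose two sides have Euclidean
outward unit normals `a` and `b`. -/
def IsReflexEdgePoint (Δ : Set E3) (p a b : E3) : Prop :=
  ‖a‖ = 1 ∧ ‖b‖ = 1 ∧ LinearIndependent ℝ ![a, b] ∧
    ∀ᶠ x in 𝓝 p, (x ∈ Δ ↔ inner ℝ a (x - p) ≤ 0 ∨ inner ℝ b (x - p) ≤ 0)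

/-- The union of the (open) faces of `Δ`. -/
def faceSet (Δ : Set E3) : Set E3 := {p | ∃ a, IsFacePoint Δ p a}

/-- The union of the (open) edges of `Δ`. -/
def edgeSet (Δ : Set E3) : Set E3 :=
  {p | ∃ a b, IsConvexEdgePoint Δ p a b ∨ IsReflexEdgePoint Δ p a b}

/-- A compact solid polyhedron, convex or not, in the upper half space: its boundary lies in
finitely many Euclidean planes, and consists of face points, edge points and finitely many
vertices. -/
structure IsPolyhedron (Δ : Set E3) : Prop where
  subset : Δ ⊆ upperHalfSpace
  isCompact : IsCompact Δ
  nonempty : Δ.Nonempty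
  regular : closure (interior Δ) = Δ
  planes : ∃ P : Set (E3 × ℝ), P.Finite ∧ (∀ P' ∈ P, ‖P'.1‖ = 1) ∧
    ∀ x ∈ frontier Δ, ∃ P' ∈ P, inner ℝ P'.1 x = P'.2
  vertices : (frontier Δ \ (faceSet Δ ∪ edgeSet Δ)).Finite

open Classical in
/-- The Euclidean outward unit normal of `Δ` at points of the faces (unique there; `0` elsewhere,
a set of area zero in the boundary of a polyhedron). -/
def outwardNormal (Δ : Set E3) (p : E3) : E3 :=
  if h : ∃ a, IsFacePoint Δ p a then h.choose else 0

open Classical in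
/-- The interior dihedral angle of `Δ`, with respect to `g`, at an edge point: `π - θ` at a convex
edge and `π + θ` at a reflex one, where `θ` is the `g`-angle between the outward unit normals of the
two faces. The unordered pair of normals is unique. -/
def dihedralAngle (g : MetricField) (Δ : Set E3) (p : E3) : ℝ :=
  if h : ∃ ab : E3 × E3, IsConvexEdgePoint Δ p ab.1 ab.2 then
    Real.pi - normalAngle g h.choose.1 h.choose.2 p
  else if h : ∃ ab : E3 × E3, IsReflexEdgePoint Δ p ab.1 ab.2 then
    Real.pi + normalAngle g h.choose.1 h.choose.2 p
  else 0

/-- The hyperbolic area measure `dσ̄` on surfaces. -/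
def hypArea : Measure E3 := (μHE[2] : Measure E3).withDensity fun x => ENNReal.ofReal (1 / x 2 ^ 2)

/-- The hyperbolic length measure `dλ̄` on curves. -/
def hypLength : Measure E3 := (μHE[1] : Measure E3).withDensity fun x => ENNReal.ofReal (1 / x 2)

/-- The flux `∫_{∂Δ} 𝕌^i ν̄_i dσ̄` of the mass integrand. -/
def massFlux (g : MetricField) (Δ : Set E3) : ℝ :=
  ∫ x in frontier Δ,
    (∑ i, massIntegrand g x i * unitNormal hypMetric (outwardNormal Δ x) x i) ∂hypArea

/-- The face integrand `2 V (H - H̄)`, with mean curvatures with respect to the outward normal. -/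
def faceTerm (g : MetricField) (Δ : Set E3) (x : E3) : ℝ :=
  2 * potential x *
    (meanCurvature g (outwardNormal Δ x) x - meanCurvature hypMetric (outwardNormal Δ x) x)

/-- The edge integrand `V (α - ᾱ)`. -/
def edgeTerm (g : MetricField) (Δ : Set E3) (x : E3) : ℝ :=
  potential x * (dihedralAngle g Δ x - dihedralAngle hypMetric Δ x)

end AHMass

end

/-!
Work in the `ḡ`-orthonormal frame `x³ ∂_i`, in which `g` has components `G = 1 + E`. Both `E` and
its first frame derivatives are `O(w)` with `w = cosh^{-τ} r`, uniformly on the half space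
(`isBigO_frameDev`, `isBigO_frameDer`), and the potential is at most `2 cosh r` (`potential_le`).
So every quantity that is `V` times a product of two small factors is `O(cosh^{-2τ+1} r)`, and
only terms of first order in `E` have to be matched.

*Faces.* For a plane with Euclidean unit normal `a` let `Y_a` be the vector field with components
`Y_a^i = g_{ij} a_j` (`normalField`). The mean curvature of a plane is an algebraic expression in
the first derivatives of `g` (`IsMetric.meanCurvature_eq`), and its first order expansion shows
that `𝕌(ν̄) + 2 V (H - H̄)` is, up to an error that is quadratic in `E`, minus `(x³)²` times the
Euclidean divergence of `Y_a` along the plane; the algebra is `face_identity`, the estimate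
`isBigO_faceError`. The factor `(x³)²` cancels the density of the hyperbolic area.

*Divergence theorem.* Integrated over all faces with respect to the Euclidean area, the
divergences become fluxes of the fields `Y_a` through the edges
(`integral_tangentialDiv_frontier`). The faces are only described by their germs at face points
and edge points, so the theorem is proved by a partition of unity from the divergence theorem on
planes and half planes. The finitely many vertices, at which nothing is known, are removed with
cutoffs at scale `ε`: the gradient of the cutoff is `O(1/ε)` on a set of area `O(ε²)`.

*Edges.* At an edge with outward unit normals `a` and `b` the flux of `Y_a` and `Y_b` is, up to
the factor `-2 (x³)^{-2}`, the first variation of the cosine of the `g`-angle between the unit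
normals, divided by `sin ᾱ`. The condition `sin ᾱ ≥ c` makes the second order Taylor expansion of
the inverse cosine uniform (`abs_arccos_sub_add_le`), so that the flux per hyperbolic length is
`-2 V (α - ᾱ)` up to a quadratic error (`isBigO_edgeError`). The same condition excludes reflex
edges, where `sin ᾱ < 0`.

Together this is an identity for every single polyhedron (`massFlux_eq`), in which the error
densities are explicit.
-/

noncomputable section

namespace AHMass

open scoped RealInnerProductSpace ContDiff
open Asymptotics

/-! ### Planes and lines in Euclidean three-space -/

section Param

/-- The parametrization of the plane through `p` spanned by the first two vectors of `B`. -/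
def planeMap (B : OrthonormalBasis (Fin 3) ℝ E3) (p : E3) (y : ℝ × ℝ) : E3 :=
  p + (y.1 • B 0 + y.2 • B 1)

/-- The parametrization of the line through `p` spanned by the first vector of `B`. -/
def lineMap (B : OrthonormalBasis (Fin 3) ℝ E3) (p : E3) (s : ℝ) : E3 := p + s • B 0

variable (B : OrthonormalBasis (Fin 3) ℝ E3) (p : E3)

lemma inner_basis (i j : Fin 3) : ⟪B i, B j⟫ = if i = j then 1 else 0 :=
  orthonormal_iff_ite.1 B.orthonormal i j

lemma sub_eq_sum_basis (x : E3) :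
    x - p = ⟪B 0, x - p⟫ • B 0 + ⟪B 1, x - p⟫ • B 1 + ⟪B 2, x - p⟫ • B 2 := by
  have := B.sum_repr (x - p)
  simp only [Fin.sum_univ_three, B.repr_apply_apply] at this
  exact this.symm

lemma inner_planeMap (y : ℝ × ℝ) : ⟪B 0, planeMap B p y - p⟫ = y.1 ∧
    ⟪B 1, planeMap B p y - p⟫ = y.2 ∧ ⟪B 2, planeMap B p y - p⟫ = 0 := by
  simp [planeMap, inner_add_right, inner_smul_right]

lemma inner_lineMap (s : ℝ) : ⟪B 0, lineMap B p s - p⟫ = s ∧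
    ⟪B 1, lineMap B p s - p⟫ = 0 ∧ ⟪B 2, lineMap B p s - p⟫ = 0 := by
  simp [lineMap, inner_smul_right]

lemma range_planeMap : Set.range (planeMap B p) = {x | ⟪B 2, x - p⟫ = 0} := by
  ext x
  constructor
  · rintro ⟨y, rfl⟩
    exact (inner_planeMap B p y).2.2
  · intro hx
    refine ⟨(⟪B 0, x - p⟫, ⟪B 1, x - p⟫), ?_⟩
    have h := sub_eq_sum_basis B p x
    have hx' : ⟪B 2, x - p⟫ = 0 := hx
    rw [hx', zero_smul, add_zero] at h
    simp only [planeMap]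
    rw [← h]; abel

lemma range_lineMap : Set.range (lineMap B p) = {x | ⟪B 1, x - p⟫ = 0 ∧ ⟪B 2, x - p⟫ = 0} := by
  ext x
  constructor
  · rintro ⟨y, rfl⟩
    exact (inner_lineMap B p y).2
  · intro hx
    refine ⟨⟪B 0, x - p⟫, ?_⟩
    have h := sub_eq_sum_basis B p x
    have hx' : ⟪B 1, x - p⟫ = 0 ∧ ⟪B 2, x - p⟫ = 0 := hx
    rw [hx'.1, hx'.2, zero_smul, zero_smul, add_zero, add_zero] at h
    simp only [lineMap]
    rw [← h]; abel

lemma contDiff_planeMap : ContDiff ℝ ∞ (planeMap B p) := by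
  unfold planeMap; fun_prop

lemma contDiff_lineMap : ContDiff ℝ ∞ (lineMap B p) := by
  unfold lineMap; fun_prop

lemma isometry_planeMap :
    Isometry (fun y : WithLp 2 (ℝ × ℝ) => planeMap B p (WithLp.ofLp y)) := by
  refine Isometry.of_dist_eq fun x y => ?_
  have key : planeMap B p (WithLp.ofLp x) - planeMap B p (WithLp.ofLp y)
      = (x.fst - y.fst) • B 0 + (x.snd - y.snd) • B 1 := by
    simp only [planeMap, sub_smul]; simp; abel
  rw [dist_eq_norm, dist_eq_norm, key, ← sq_eq_sq₀ (norm_nonneg _) (norm_nonneg _),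
    WithLp.prod_norm_sq_eq_of_L2, ← real_inner_self_eq_norm_sq (_ + _)]
  simp only [inner_add_left, inner_add_right, inner_smul_left, inner_smul_right, inner_basis]
  simp
  ring

lemma isometry_lineMap : Isometry (lineMap B p) := by
  refine Isometry.of_dist_eq fun x y => ?_
  simp [lineMap, dist_eq_norm, ← sub_smul, norm_smul]

/-- Plane Lebesgue measure parametrizes the area measure of a plane. -/
lemma map_planeMap : Measure.map (planeMap B p) volume
    = (μHE[2] : Measure E3).restrict {x | ⟪B 2, x - p⟫ = 0} := by
  have h := (isometry_planeMap B p).map_euclideanHausdorffMeasure (d := 2)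
  have h2 : (μHE[2] : Measure (WithLp 2 (ℝ × ℝ))) = volume := by
    have := InnerProductSpace.euclideanHausdorffMeasure_eq_volume (V := WithLp 2 (ℝ × ℝ))
    have hd : Module.finrank ℝ (WithLp 2 (ℝ × ℝ)) = 2 := by
      rw [(WithLp.linearEquiv 2 ℝ (ℝ × ℝ)).finrank_eq]; simp
    rwa [hd] at this
  rw [h2, ← (WithLp.volume_preserving_toLp ℝ ℝ).map_eq, Measure.map_map] at h
  · have h3 : ((fun y : WithLp 2 (ℝ × ℝ) => planeMap B p (WithLp.ofLp y)) ∘ WithLp.toLp 2)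
        = planeMap B p := rfl
    rw [h3] at h
    rw [h, ← range_planeMap]
    congr 1
    ext x
    constructor
    · rintro ⟨y, rfl⟩; exact ⟨_, rfl⟩
    · rintro ⟨y, rfl⟩; exact ⟨WithLp.toLp 2 y, rfl⟩
  · exact (isometry_planeMap B p).continuous.measurable
  · exact (WithLp.volume_preserving_toLp ℝ ℝ).measurable

lemma map_lineMap : Measure.map (lineMap B p) volume
    = (μHE[1] : Measure E3).restrict {x | ⟪B 1, x - p⟫ = 0 ∧ ⟪B 2, x - p⟫ = 0} := by
  have h := (isometry_lineMap B p).map_euclideanHausdorffMeasure (d := 1)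
  have h2 : (μHE[1] : Measure ℝ) = volume := by
    have := InnerProductSpace.euclideanHausdorffMeasure_eq_volume (V := ℝ)
    rwa [Module.finrank_self] at this
  rw [h2, range_lineMap] at h
  exact h

lemma isClosedEmbedding_planeMap : IsClosedEmbedding (planeMap B p) := by
  have h := (isometry_planeMap B p).isClosedEmbedding
  exact h.comp (WithLp.homeomorphProd 2 ℝ ℝ).symm.isClosedEmbedding

lemma measurableEmbedding_planeMap : MeasurableEmbedding (planeMap B p) :=
  (isClosedEmbedding_planeMap B p).measurableEmbedding

lemma measurableEmbedding_lineMap : MeasurableEmbedding (lineMap B p) :=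
  (isometry_lineMap B p).isClosedEmbedding.measurableEmbedding

lemma setIntegral_plane_inter {f : E3 → ℝ} {s : Set E3} (hs : MeasurableSet s) :
    ∫ x in {x | ⟪B 2, x - p⟫ = 0} ∩ s, f x ∂μHE[2]
      = ∫ y in planeMap B p ⁻¹' s, f (planeMap B p y) := by
  rw [Set.inter_comm, ← Measure.restrict_restrict hs, ← map_planeMap,
    (measurableEmbedding_planeMap B p).setIntegral_map]

lemma integral_line {f : E3 → ℝ} :
    ∫ x in {x | ⟪B 1, x - p⟫ = 0 ∧ ⟪B 2, x - p⟫ = 0}, f x ∂μHE[1]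
      = ∫ s, f (lineMap B p s) := by
  rw [← map_lineMap, (measurableEmbedding_lineMap B p).integral_map]

/-- The area of a plane inside a ball of radius `ρ` is at most `4ρ²`. -/
lemma measure_plane_inter_ball_le (v : E3) {ρ : ℝ} (hρ : 0 ≤ ρ) :
    (μHE[2] : Measure E3) ({x | ⟪B 2, x - p⟫ = 0} ∩ Metric.closedBall v ρ)
      ≤ ENNReal.ofReal (4 * ρ ^ 2) := by
  rw [Set.inter_comm, ← Measure.restrict_apply Metric.isClosed_closedBall.measurableSet,
    ← map_planeMap, Measure.map_apply (contDiff_planeMap B p).continuous.measurable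
      Metric.isClosed_closedBall.measurableSet]
  set c : ℝ × ℝ := (⟪B 0, v - p⟫, ⟪B 1, v - p⟫)
  have hsub : planeMap B p ⁻¹' Metric.closedBall v ρ ⊆
      Set.Icc (c.1 - ρ) (c.1 + ρ) ×ˢ Set.Icc (c.2 - ρ) (c.2 + ρ) := by
    intro y hy
    have hy' : ‖planeMap B p y - v‖ ≤ ρ := by simpa [dist_eq_norm] using hy
    have e : ∀ i, |⟪B i, planeMap B p y - v⟫| ≤ ρ := fun i =>
      (abs_real_inner_le_norm _ _).trans (by simpa using hy')
    have e2 : ∀ i, ⟪B i, planeMap B p y - v⟫ = ⟪B i, planeMap B p y - p⟫ - ⟪B i, v - p⟫ := by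
      intro i; rw [← inner_sub_right]; congr 1; abel
    have h0 := e 0
    have h1 := e 1
    rw [e2, (inner_planeMap B p y).1] at h0
    rw [e2, (inner_planeMap B p y).2.1] at h1
    rw [abs_le] at h0 h1
    simp only [Set.mem_prod, Set.mem_Icc, c]
    constructor <;> constructor <;> linarith
  refine (measure_mono hsub).trans ?_
  rw [Measure.volume_eq_prod, Measure.prod_prod, Real.volume_Icc, Real.volume_Icc,
    ← ENNReal.ofReal_mul (by linarith)]
  exact ENNReal.ofReal_le_ofReal (by nlinarith)

lemma measure_line_inter_ball_lt_top (v : E3) (ρ : ℝ) :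
    (μHE[1] : Measure E3) ({x | ⟪B 1, x - p⟫ = 0 ∧ ⟪B 2, x - p⟫ = 0} ∩ Metric.closedBall v ρ)
      < ⊤ := by
  rw [Set.inter_comm, ← Measure.restrict_apply Metric.isClosed_closedBall.measurableSet,
    ← map_lineMap, Measure.map_apply (contDiff_lineMap B p).continuous.measurable
      Metric.isClosed_closedBall.measurableSet]
  exact ((isometry_lineMap B p).isClosedEmbedding.isCompact_preimage
    (isCompact_closedBall v ρ)).measure_lt_top

/-- Lines have zero area. -/
lemma measure_line_eq_zero :
    (μHE[2] : Measure E3) {x | ⟪B 1, x - p⟫ = 0 ∧ ⟪B 2, x - p⟫ = 0} = 0 := by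
  have hm : MeasurableSet {x : E3 | ⟪B 1, x - p⟫ = 0} :=
    (isClosed_eq (by fun_prop) continuous_const).measurableSet
  have : {x : E3 | ⟪B 1, x - p⟫ = 0 ∧ ⟪B 2, x - p⟫ = 0}
      = {x | ⟪B 1, x - p⟫ = 0} ∩ {x | ⟪B 2, x - p⟫ = 0} := rfl
  rw [this, ← Measure.restrict_apply hm,
    ← map_planeMap, Measure.map_apply (contDiff_planeMap B p).continuous.measurable hm]
  have : planeMap B p ⁻¹' {x : E3 | ⟪B 1, x - p⟫ = 0} = Set.univ ×ˢ {(0 : ℝ)} := by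
    ext y
    simp [(inner_planeMap B p y).2.1]
  rw [this, Measure.volume_eq_prod, Measure.prod_prod]
  simp

/-- Relatively open nonempty pieces of planes have positive area. -/
lemma measure_plane_inter_pos {s : Set E3} (hs : IsOpen s)
    (hne : ({x | ⟪B 2, x - p⟫ = 0} ∩ s).Nonempty) :
    0 < (μHE[2] : Measure E3) ({x | ⟪B 2, x - p⟫ = 0} ∩ s) := by
  rw [Set.inter_comm, ← Measure.restrict_apply hs.measurableSet,
    ← map_planeMap, Measure.map_apply (contDiff_planeMap B p).continuous.measurable
      hs.measurableSet]
  refine (hs.preimage (contDiff_planeMap B p).continuous).measure_pos _ ?_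
  obtain ⟨x, hx, hxs⟩ := hne
  rw [← range_planeMap] at hx
  obtain ⟨y, rfl⟩ := hx
  exact ⟨y, hxs⟩

end Param

/-! ### The divergence theorem for half planes -/

/-- The Euclidean divergence of `Z` along the plane with unit normal `a`: the trace of the
derivative minus its normal part. -/
def tangentialDiv (a : E3) (Z : E3 → E3) (x : E3) : ℝ :=
  ∑ i, fderiv ℝ Z x (EuclideanSpace.single i 1) i - ⟪fderiv ℝ Z x a, a⟫

section HalfPlane

variable (B : OrthonormalBasis (Fin 3) ℝ E3) (p : E3)

lemma tangentialDiv_eq (Z : E3 → E3) (x : E3) :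
    tangentialDiv (B 2) Z x = ⟪fderiv ℝ Z x (B 0), B 0⟫ + ⟪fderiv ℝ Z x (B 1), B 1⟫ := by
  have h1 := LinearMap.trace_eq_sum_inner (fderiv ℝ Z x : E3 →ₗ[ℝ] E3) B
  have h2 := LinearMap.trace_eq_sum_inner (fderiv ℝ Z x : E3 →ₗ[ℝ] E3)
    (EuclideanSpace.basisFun (Fin 3) ℝ)
  rw [h1] at h2
  have h3 : ∑ i, fderiv ℝ Z x (EuclideanSpace.single i 1) i
      = ∑ i, ⟪B i, fderiv ℝ Z x (B i)⟫ := by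
    simp only [ContinuousLinearMap.coe_coe] at h2
    rw [h2]
    refine Finset.sum_congr rfl fun i _ => ?_
    simp [EuclideanSpace.inner_single_left]
  rw [tangentialDiv, h3, Fin.sum_univ_three]
  simp only [real_inner_comm]
  ring

lemma integral_deriv_eq_zero {f : ℝ → ℝ} (hf : ContDiff ℝ 1 f) (hc : HasCompactSupport f) :
    ∫ s, deriv f s = 0 := by
  refine integral_eq_zero_of_hasDerivAt_of_integrable
    (fun x => (hf.differentiable one_ne_zero x).hasDerivAt) ?_ ?_
  · exact (hf.continuous_deriv le_rfl).integrable_of_hasCompactSupport hc.deriv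
  · exact hf.continuous.integrable_of_hasCompactSupport hc

/-- A compactly supported `s`-derivative has integral zero over every horizontal strip. -/
lemma setIntegral_fderiv_fst {F : ℝ × ℝ → ℝ} (hF : ContDiff ℝ 1 F) (hc : HasCompactSupport F)
    {T : Set ℝ} :
    ∫ y in Set.univ ×ˢ T, fderiv ℝ F y (1, 0) = 0 := by
  have hint : Integrable (fun y => fderiv ℝ F y (1, 0)) :=
    ((hF.continuous_fderiv one_ne_zero).clm_apply continuous_const).integrable_of_hasCompactSupport
      (hc.fderiv_apply ℝ (1, 0))
  rw [Measure.volume_eq_prod, ← Measure.prod_restrict, integral_prod_symm]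
  · refine integral_eq_zero_of_ae (Eventually.of_forall fun t => ?_)
    have hg : ContDiff ℝ 1 (fun s => F (s, t)) := by fun_prop
    have hgc : HasCompactSupport (fun s => F (s, t)) :=
      hc.comp_isClosedEmbedding (Isometry.isClosedEmbedding
        (Isometry.of_dist_eq fun a b => by simp [Prod.dist_eq]))
    have := integral_deriv_eq_zero hg hgc
    simp only [Measure.restrict_univ, Pi.zero_apply]
    refine Eq.trans ?_ this
    refine integral_congr_ae (Eventually.of_forall fun s => ?_)
    have h1 : HasDerivAt (fun s => (s, t)) ((1 : ℝ), (0 : ℝ)) s :=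
      (hasDerivAt_id s).prodMk (hasDerivAt_const s t)
    exact (((hF.differentiable one_ne_zero _).hasFDerivAt).comp_hasDerivAt s h1).deriv.symm
  · rw [Measure.prod_restrict, ← Measure.volume_eq_prod]
    exact hint.integrableOn

lemma setIntegral_fderiv_snd {F : ℝ × ℝ → ℝ} (hF : ContDiff ℝ 1 F) (hc : HasCompactSupport F) :
    (∫ y in Set.univ ×ˢ Set.Iic 0, fderiv ℝ F y (0, 1) = ∫ s, F (s, 0)) ∧
      ∫ y in Set.univ ×ˢ Set.univ, fderiv ℝ F y (0, 1) = 0 := by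
  have hint : Integrable (fun y => fderiv ℝ F y (0, 1)) :=
    ((hF.continuous_fderiv one_ne_zero).clm_apply continuous_const).integrable_of_hasCompactSupport
      (hc.fderiv_apply ℝ (0, 1))
  have hg : ∀ s, ContDiff ℝ 1 (fun t => F (s, t)) := fun s => by fun_prop
  have hgc : ∀ s, HasCompactSupport (fun t => F (s, t)) := fun s =>
    hc.comp_isClosedEmbedding (Isometry.isClosedEmbedding
      (Isometry.of_dist_eq fun a b => by simp [Prod.dist_eq]))
  have hd : ∀ s t, fderiv ℝ F (s, t) (0, 1) = deriv (fun t => F (s, t)) t := fun s t => by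
    have h1 : HasDerivAt (fun t => (s, t)) ((0 : ℝ), (1 : ℝ)) t :=
      (hasDerivAt_const t s).prodMk (hasDerivAt_id t)
    exact (((hF.differentiable one_ne_zero _).hasFDerivAt).comp_hasDerivAt t h1).deriv.symm
  constructor
  · rw [Measure.volume_eq_prod, ← Measure.prod_restrict, integral_prod]
    · simp only [Measure.restrict_univ, hd]
      refine integral_congr_ae (Eventually.of_forall fun s => ?_)
      exact (hgc s).integral_Iic_deriv_eq (hg s) 0
    · rw [Measure.prod_restrict, ← Measure.volume_eq_prod]
      exact hint.integrableOn
  · rw [Measure.volume_eq_prod, ← Measure.prod_restrict, integral_prod]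
    · simp only [Measure.restrict_univ, hd]
      exact integral_eq_zero_of_ae (Eventually.of_forall fun s =>
        integral_deriv_eq_zero (hg s) (hgc s))
    · rw [Measure.prod_restrict, ← Measure.volume_eq_prod]
      exact hint.integrableOn

lemma fderiv_inner_planeMap {Z : E3 → E3} (hZ : ContDiff ℝ 1 Z) (w : E3) (y v : ℝ × ℝ) :
    fderiv ℝ (fun y => ⟪Z (planeMap B p y), w⟫) y v
      = ⟪fderiv ℝ Z (planeMap B p y) (v.1 • B 0 + v.2 • B 1), w⟫ := by
  have h1 : HasFDerivAt (planeMap B p)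
      ((ContinuousLinearMap.fst ℝ ℝ ℝ).smulRight (B 0)
        + (ContinuousLinearMap.snd ℝ ℝ ℝ).smulRight (B 1)) y := by
    unfold planeMap
    refine HasFDerivAt.const_add p ?_
    exact (((ContinuousLinearMap.fst ℝ ℝ ℝ).hasFDerivAt (x := y)).smul_const (B 0)).add
      (((ContinuousLinearMap.snd ℝ ℝ ℝ).hasFDerivAt (x := y)).smul_const (B 1))
  have h2 := (hZ.differentiable one_ne_zero (planeMap B p y)).hasFDerivAt.comp y h1
  have h3 := (h2.inner ℝ (hasFDerivAt_const w y)).fderiv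
  simp only [Function.comp_def] at h3
  rw [h3]
  simp

lemma tangentialDiv_planeMap {Z : E3 → E3} (hZ : ContDiff ℝ 1 Z) (y : ℝ × ℝ) :
    tangentialDiv (B 2) Z (planeMap B p y)
      = fderiv ℝ (fun y => ⟪Z (planeMap B p y), B 0⟫) y (1, 0)
        + fderiv ℝ (fun y => ⟪Z (planeMap B p y), B 1⟫) y (0, 1) := by
  rw [tangentialDiv_eq, fderiv_inner_planeMap B p hZ, fderiv_inner_planeMap B p hZ]
  simp

lemma contDiff_inner_planeMap {Z : E3 → E3} (hZ : ContDiff ℝ 1 Z) (w : E3) :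
    ContDiff ℝ 1 (fun y => ⟪Z (planeMap B p y), w⟫) :=
  (hZ.comp ((contDiff_planeMap B p).of_le (by simp))).inner ℝ contDiff_const

lemma hasCompactSupport_inner_planeMap {Z : E3 → E3} (hc : HasCompactSupport Z) (w : E3) :
    HasCompactSupport (fun y => ⟪Z (planeMap B p y), w⟫) :=
  (hc.comp_isClosedEmbedding (isClosedEmbedding_planeMap B p)).comp_left
    (g := fun z => ⟪z, w⟫) (inner_zero_left w)

lemma integrable_fderiv_inner_planeMap {Z : E3 → E3} (hZ : ContDiff ℝ 1 Z)
    (hc : HasCompactSupport Z) (w : E3) (v : ℝ × ℝ) :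
    Integrable (fun y => fderiv ℝ (fun y => ⟪Z (planeMap B p y), w⟫) y v) :=
  (((contDiff_inner_planeMap B p hZ w).continuous_fderiv one_ne_zero).clm_apply
    continuous_const).integrable_of_hasCompactSupport
    ((hasCompactSupport_inner_planeMap B p hc w).fderiv_apply ℝ v)

/-- The divergence theorem on a half plane: the flux through the boundary line. -/
theorem integral_tangentialDiv_halfPlane {Z : E3 → E3} (hZ : ContDiff ℝ 1 Z)
    (hc : HasCompactSupport Z) :
    ∫ x in {x | ⟪B 2, x - p⟫ = 0} ∩ {x | ⟪B 1, x - p⟫ ≤ 0}, tangentialDiv (B 2) Z x ∂μHE[2]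
      = ∫ x in {x | ⟪B 1, x - p⟫ = 0 ∧ ⟪B 2, x - p⟫ = 0}, ⟪Z x, B 1⟫ ∂μHE[1] := by
  have hm : MeasurableSet {x : E3 | ⟪B 1, x - p⟫ ≤ 0} :=
    (isClosed_le (by fun_prop) continuous_const).measurableSet
  have hpre : planeMap B p ⁻¹' {x : E3 | ⟪B 1, x - p⟫ ≤ 0} = Set.univ ×ˢ Set.Iic 0 := by
    ext y
    simp [(inner_planeMap B p y).2.1]
  rw [setIntegral_plane_inter B p hm, integral_line, hpre]
  simp_rw [tangentialDiv_planeMap B p hZ]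
  rw [integral_add (integrable_fderiv_inner_planeMap B p hZ hc _ _).integrableOn
    (integrable_fderiv_inner_planeMap B p hZ hc _ _).integrableOn,
    setIntegral_fderiv_fst (contDiff_inner_planeMap B p hZ _)
      (hasCompactSupport_inner_planeMap B p hc _),
    (setIntegral_fderiv_snd (contDiff_inner_planeMap B p hZ _)
      (hasCompactSupport_inner_planeMap B p hc _)).1, zero_add]
  simp [planeMap, lineMap]

/-- The divergence theorem on a plane: there is no boundary contribution. -/
theorem integral_tangentialDiv_plane {Z : E3 → E3} (hZ : ContDiff ℝ 1 Z)
    (hc : HasCompactSupport Z) :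
    ∫ x in {x | ⟪B 2, x - p⟫ = 0}, tangentialDiv (B 2) Z x ∂μHE[2] = 0 := by
  have h := setIntegral_plane_inter B p (f := tangentialDiv (B 2) Z) MeasurableSet.univ
  rw [Set.inter_univ, Set.preimage_univ, ← Set.univ_prod_univ] at h
  rw [h]
  simp_rw [tangentialDiv_planeMap B p hZ]
  rw [integral_add (integrable_fderiv_inner_planeMap B p hZ hc _ _).integrableOn
    (integrable_fderiv_inner_planeMap B p hZ hc _ _).integrableOn,
    setIntegral_fderiv_fst (contDiff_inner_planeMap B p hZ _)
      (hasCompactSupport_inner_planeMap B p hc _),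
    (setIntegral_fderiv_snd (contDiff_inner_planeMap B p hZ _)
      (hasCompactSupport_inner_planeMap B p hc _)).2, zero_add]

end HalfPlane

/-! ### Germs of polyhedra -/

section Germs

variable {Δ : Set E3} {p x a b a' b' : E3}

/-- A property invariant under positive scaling holds everywhere once it holds near the origin. -/
lemma forall_of_eventually_sub {P : E3 → Prop} (h : ∀ᶠ x in 𝓝 p, P (x - p))
    (hP : ∀ v, ∀ t : ℝ, 0 < t → P (t • v) → P v) (v : E3) : P v := by
  have hc : Tendsto (fun t : ℝ => p + t • v) (𝓝[>] 0) (𝓝 p) := by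
    have : Continuous (fun t : ℝ => p + t • v) := by fun_prop
    have h0 := this.tendsto 0
    simp only [zero_smul, add_zero] at h0
    exact h0.mono_left nhdsWithin_le_nhds
  obtain ⟨t, ht, ht0⟩ := ((hc.eventually h).and self_mem_nhdsWithin).exists
  rw [add_sub_cancel_left] at ht
  exact hP v t ht0 ht

lemma inner_smul_nonpos_iff {t : ℝ} (ht : 0 < t) (v : E3) : ⟪a, t • v⟫ ≤ 0 ↔ ⟪a, v⟫ ≤ 0 := by
  rw [inner_smul_right]
  exact ⟨fun h => by nlinarith, fun h => mul_nonpos_of_nonneg_of_nonpos ht.le h⟩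

lemma mem_frontier_iff_notMem_nhds : x ∈ frontier Δ ↔ Δ ∉ 𝓝 x ∧ Δᶜ ∉ 𝓝 x := by
  rw [frontier, Set.mem_sdiff, mem_interior_iff_mem_nhds, closure_eq_compl_interior_compl,
    Set.mem_compl_iff, mem_interior_iff_mem_nhds, and_comm]

lemma IsFacePoint.notMem_nhds (h : IsFacePoint Δ p a) : Δ ∉ 𝓝 p := by
  intro hn
  have h2 : ∀ᶠ x in 𝓝 p, ⟪a, x - p⟫ ≤ 0 := by
    filter_upwards [h.2, hn] with x hx hx'
    exact hx.1 hx'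
  have := forall_of_eventually_sub (P := fun v => ⟪a, v⟫ ≤ 0) h2
    (fun v t ht => (inner_smul_nonpos_iff ht v).1) a
  rw [real_inner_self_eq_norm_sq, h.1] at this
  norm_num at this

lemma IsFacePoint.mem (h : IsFacePoint Δ p a) : p ∈ Δ := by
  rw [h.2.self_of_nhds]; simp

lemma IsFacePoint.mem_frontier (h : IsFacePoint Δ p a) : p ∈ frontier Δ :=
  mem_frontier_iff_notMem_nhds.2 ⟨h.notMem_nhds, fun h' => mem_of_mem_nhds h' h.mem⟩

/-- The outward unit normal at a point of a face is unique. -/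
lemma IsFacePoint.unique (h : IsFacePoint Δ p a) (h' : IsFacePoint Δ p a') : a = a' := by
  have h2 : ∀ᶠ x in 𝓝 p, (⟪a, x - p⟫ ≤ 0 ↔ ⟪a', x - p⟫ ≤ 0) := by
    filter_upwards [h.2, h'.2] with x hx hx'
    rw [← hx, hx']
  have h3 := forall_of_eventually_sub (P := fun v => (⟪a, v⟫ ≤ 0 ↔ ⟪a', v⟫ ≤ 0)) h2
    (fun v t ht => by rw [inner_smul_nonpos_iff ht, inner_smul_nonpos_iff ht]; exact id)
  have haa : ⟪a, a⟫ = 1 := by rw [real_inner_self_eq_norm_sq, h.1]; norm_num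
  have haa' : ⟪a', a'⟫ = 1 := by rw [real_inner_self_eq_norm_sq, h'.1]; norm_num
  -- The tangential part of `a'` lies in the first half space, hence in the second one.
  have h4 := (h3 (a' - ⟪a, a'⟫ • a)).1 (by
    rw [inner_sub_right, inner_smul_right, haa]; simp)
  rw [inner_sub_right, inner_smul_right, haa', real_inner_comm a a'] at h4
  have h5 : 0 < ⟪a, a'⟫ := by
    by_contra hneg
    have := (h3 a').1 (not_lt.1 hneg)
    rw [haa'] at this
    norm_num at this
  have h6 : 1 ≤ ⟪a, a'⟫ := by nlinarith
  have h7 : ⟪a, a'⟫ ≤ ‖a‖ * ‖a'‖ := real_inner_le_norm _ _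
  rw [h.1, h'.1] at h7
  exact (inner_eq_one_iff_of_norm_eq_one (𝕜 := ℝ) h.1 h'.1).1 (by linarith)

/-- Near a face point, all boundary points are face points with the same normal. -/
lemma IsFacePoint.eventually_near (h : IsFacePoint Δ p a) :
    ∀ᶠ x in 𝓝 p, (⟪a, x - p⟫ = 0 → IsFacePoint Δ x a) ∧ (⟪a, x - p⟫ < 0 → Δ ∈ 𝓝 x) ∧
      (0 < ⟪a, x - p⟫ → Δᶜ ∈ 𝓝 x) := by
  filter_upwards [eventually_eventually_nhds.2 h.2] with x hx
  have hcont : Continuous fun y : E3 => ⟪a, y - p⟫ := by fun_prop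
  refine ⟨fun h0 => ⟨h.1, ?_⟩, fun h0 => ?_, fun h0 => ?_⟩
  · filter_upwards [hx] with y hy
    rw [hy]
    have : ⟪a, y - x⟫ = ⟪a, y - p⟫ - ⟪a, x - p⟫ := by rw [← inner_sub_right]; congr 1; abel
    rw [this, h0, sub_zero]
  · filter_upwards [hx, hcont.continuousAt.eventually_lt continuousAt_const h0] with y hy hy'
    exact hy.2 hy'.le
  · filter_upwards [hx, continuousAt_const.eventually_lt hcont.continuousAt h0] with y hy hy'
    exact fun hmem => absurd (hy.1 hmem) (not_le.2 hy')

lemma IsConvexEdgePoint.symm (h : IsConvexEdgePoint Δ p a b) : IsConvexEdgePoint Δ p b a := by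
  refine ⟨h.2.1, h.1, ?_, ?_⟩
  · rw [LinearIndependent.pair_symm_iff]; exact h.2.2.1
  · filter_upwards [h.2.2.2] with x hx
    rw [hx, and_comm]

lemma IsConvexEdgePoint.mem (h : IsConvexEdgePoint Δ p a b) : p ∈ Δ := by
  rw [h.2.2.2.self_of_nhds]; simp

/-- Unit vectors that are linearly independent have scalar product in `(-1, 1)`. -/
lemma inner_sq_lt_one (ha : ‖a‖ = 1) (hb : ‖b‖ = 1) (h : LinearIndependent ℝ ![a, b]) :
    ⟪a, b⟫ ^ 2 < 1 := by
  have h1 : 0 < ‖b - ⟪a, b⟫ • a‖ ^ 2 := by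
    have : b - ⟪a, b⟫ • a ≠ 0 := by
      intro h0
      have := LinearIndependent.pair_iff.1 h (-⟪a, b⟫) 1 (by
        rw [← h0]; simp; abel)
      simpa using this.2
    positivity
  rw [← real_inner_self_eq_norm_sq, inner_sub_left, inner_sub_right, inner_sub_right,
    inner_smul_right, inner_smul_right, real_inner_smul_left, real_inner_smul_left,
    real_inner_self_eq_norm_sq, real_inner_self_eq_norm_sq, ha, hb, real_inner_comm a b] at h1
  nlinarith

lemma IsConvexEdgePoint.inner_sq_lt_one (h : IsConvexEdgePoint Δ p a b) : ⟪a, b⟫ ^ 2 < 1 :=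
  AHMass.inner_sq_lt_one h.1 h.2.1 h.2.2.1

/-- The boundary structure near a point of a convex edge. -/
lemma IsConvexEdgePoint.eventually_near (h : IsConvexEdgePoint Δ p a b) :
    ∀ᶠ x in 𝓝 p, (⟪a, x - p⟫ = 0 → ⟪b, x - p⟫ = 0 → IsConvexEdgePoint Δ x a b) ∧
      (⟪a, x - p⟫ = 0 → ⟪b, x - p⟫ < 0 → IsFacePoint Δ x a) ∧
      (⟪a, x - p⟫ < 0 → ⟪b, x - p⟫ = 0 → IsFacePoint Δ x b) ∧
      (⟪a, x - p⟫ < 0 → ⟪b, x - p⟫ < 0 → Δ ∈ 𝓝 x) ∧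
      (0 < ⟪a, x - p⟫ ∨ 0 < ⟪b, x - p⟫ → Δᶜ ∈ 𝓝 x) := by
  filter_upwards [eventually_eventually_nhds.2 h.2.2.2] with x hx
  have hca : ContinuousAt (fun y : E3 => ⟪a, y - p⟫) x := by fun_prop
  have hcb : ContinuousAt (fun y : E3 => ⟪b, y - p⟫) x := by fun_prop
  have e : ∀ c y : E3, ⟪c, x - p⟫ = 0 → ⟪c, y - x⟫ = ⟪c, y - p⟫ := fun c y h0 => by
    have : ⟪c, y - x⟫ = ⟪c, y - p⟫ - ⟪c, x - p⟫ := by rw [← inner_sub_right]; congr 1; abel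
    rw [this, h0, sub_zero]
  refine ⟨fun h1 h2 => ⟨h.1, h.2.1, h.2.2.1, ?_⟩, fun h1 h2 => ⟨h.1, ?_⟩,
    fun h1 h2 => ⟨h.2.1, ?_⟩, fun h1 h2 => ?_, fun h1 => ?_⟩
  · filter_upwards [hx] with y hy
    rw [hy, e a y h1, e b y h2]
  · filter_upwards [hx, hcb.eventually_lt continuousAt_const h2] with y hy hy'
    rw [hy, e a y h1, and_iff_left hy'.le]
  · filter_upwards [hx, hca.eventually_lt continuousAt_const h1] with y hy hy'
    rw [hy, e b y h2, and_iff_right hy'.le]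
  · filter_upwards [hx, hca.eventually_lt continuousAt_const h1,
      hcb.eventually_lt continuousAt_const h2] with y hy hya hyb
    exact hy.2 ⟨hya.le, hyb.le⟩
  · rcases h1 with h1 | h1
    · filter_upwards [hx, continuousAt_const.eventually_lt hca h1] with y hy hy'
      exact fun hmem => absurd (hy.1 hmem).1 (not_le.2 hy')
    · filter_upwards [hx, continuousAt_const.eventually_lt hcb h1] with y hy hy'
      exact fun hmem => absurd (hy.1 hmem).2 (not_le.2 hy')

lemma IsConvexEdgePoint.notMem_nhds (h : IsConvexEdgePoint Δ p a b) : Δ ∉ 𝓝 p := by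
  intro hn
  have h2 : ∀ᶠ x in 𝓝 p, ⟪a, x - p⟫ ≤ 0 := by
    filter_upwards [h.2.2.2, hn] with x hx hx'
    exact (hx.1 hx').1
  have := forall_of_eventually_sub (P := fun v => ⟪a, v⟫ ≤ 0) h2
    (fun v t ht => (inner_smul_nonpos_iff ht v).1) a
  rw [real_inner_self_eq_norm_sq, h.1] at this
  norm_num at this

lemma IsConvexEdgePoint.mem_frontier (h : IsConvexEdgePoint Δ p a b) : p ∈ frontier Δ :=
  mem_frontier_iff_notMem_nhds.2 ⟨h.notMem_nhds, fun h' => mem_of_mem_nhds h' h.mem⟩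

/-- A point of a convex edge is not a face point. -/
lemma IsConvexEdgePoint.not_isFacePoint (h : IsConvexEdgePoint Δ p a b) :
    ¬ IsFacePoint Δ p a' := by
  intro h'
  have h2 : ∀ᶠ x in 𝓝 p, (⟪a', x - p⟫ ≤ 0 ↔ ⟪a, x - p⟫ ≤ 0 ∧ ⟪b, x - p⟫ ≤ 0) := by
    filter_upwards [h.2.2.2, h'.2] with x hx hx'
    rw [← hx, hx']
  have h3 := forall_of_eventually_sub
    (P := fun v => (⟪a', v⟫ ≤ 0 ↔ ⟪a, v⟫ ≤ 0 ∧ ⟪b, v⟫ ≤ 0)) h2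
    (fun v t ht => by simp only [inner_smul_nonpos_iff ht]; exact id)
  -- A vector and its negative cannot both leave the half space.
  set v := b - ⟪a, b⟫ • a
  have hb : 0 < ⟪b, v⟫ := by
    have := h.inner_sq_lt_one
    simp only [v]
    rw [inner_sub_right, inner_smul_right, real_inner_self_eq_norm_sq, h.2.1, real_inner_comm a b]
    nlinarith
  have ha : ⟪a, v⟫ = 0 := by
    simp only [v]
    rw [inner_sub_right, inner_smul_right, real_inner_self_eq_norm_sq, h.1]
    ring
  have hv1 : 0 < ⟪a', v⟫ := by
    by_contra hneg
    exact absurd ((h3 v).1 (not_lt.1 hneg)).2 (not_le.2 hb)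
  -- Perturbing `-v` outwards through the first side keeps it inside the half space.
  have hε : ∃ ε : ℝ, 0 < ε ∧ ⟪a', -v + ε • a⟫ ≤ 0 := by
    refine ⟨⟪a', v⟫, hv1, ?_⟩
    rw [inner_add_right, inner_neg_right, inner_smul_right]
    have : ⟪a', a⟫ ≤ ‖a'‖ * ‖a‖ := real_inner_le_norm _ _
    rw [h.1, h'.1] at this
    nlinarith
  obtain ⟨ε, hε, hle⟩ := hε
  have := ((h3 _).1 hle).1
  rw [inner_add_right, inner_neg_right, ha, inner_smul_right, real_inner_self_eq_norm_sq,
    h.1] at this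
  linarith

/-- Arbitrarily close to a convex edge point there are face points with the first normal. -/
lemma IsConvexEdgePoint.frequently_face (h : IsConvexEdgePoint Δ p a b) :
    ∃ᶠ x in 𝓝 p, ⟪a, x - p⟫ = 0 ∧ ⟪b, x - p⟫ < 0 := by
  set v := ⟪a, b⟫ • a - b
  have hb : ⟪b, v⟫ < 0 := by
    have := h.inner_sq_lt_one
    simp only [v]
    rw [inner_sub_right, inner_smul_right, real_inner_self_eq_norm_sq, h.2.1, real_inner_comm a b]
    nlinarith
  have ha : ⟪a, v⟫ = 0 := by
    simp only [v]
    rw [inner_sub_right, inner_smul_right, real_inner_self_eq_norm_sq, h.1]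
    ring
  have hc : Tendsto (fun t : ℝ => p + t • v) (𝓝[>] 0) (𝓝 p) := by
    have : Continuous (fun t : ℝ => p + t • v) := by fun_prop
    have h0 := this.tendsto 0
    simp only [zero_smul, add_zero] at h0
    exact h0.mono_left nhdsWithin_le_nhds
  refine hc.frequently (Eventually.frequently ?_)
  filter_upwards [self_mem_nhdsWithin] with t ht
  simp only [add_sub_cancel_left, inner_smul_right, ha, mul_zero, true_and]
  exact mul_neg_of_pos_of_neg ht hb

lemma IsConvexEdgePoint.left_mem (h : IsConvexEdgePoint Δ p a b)
    (h' : IsConvexEdgePoint Δ p a' b') : a = a' ∨ a = b' := by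
  obtain ⟨x, ⟨hxa, hxb⟩, hx, hx'⟩ :=
    (h.frequently_face.and_eventually (h.eventually_near.and h'.eventually_near)).exists
  have hf := hx.2.1 hxa hxb
  rcases lt_trichotomy ⟪a', x - p⟫ 0 with h1 | h1 | h1
  · rcases lt_trichotomy ⟪b', x - p⟫ 0 with h2 | h2 | h2
    · exact absurd (hx'.2.2.2.1 h1 h2) hf.notMem_nhds
    · exact Or.inr (hf.unique (hx'.2.2.1 h1 h2))
    · exact absurd hf.mem (mem_of_mem_nhds (hx'.2.2.2.2 (Or.inr h2)))
  · rcases lt_trichotomy ⟪b', x - p⟫ 0 with h2 | h2 | h2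
    · exact Or.inl (hf.unique (hx'.2.1 h1 h2))
    · exact absurd hf (hx'.1 h1 h2).not_isFacePoint
    · exact absurd hf.mem (mem_of_mem_nhds (hx'.2.2.2.2 (Or.inr h2)))
  · exact absurd hf.mem (mem_of_mem_nhds (hx'.2.2.2.2 (Or.inl h1)))

/-- The unordered pair of normals at a convex edge point is unique. -/
lemma IsConvexEdgePoint.unique (h : IsConvexEdgePoint Δ p a b)
    (h' : IsConvexEdgePoint Δ p a' b') : (a = a' ∧ b = b') ∨ (a = b' ∧ b = a') := by
  have hab : a ≠ b := by
    rintro rfl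
    have := h.inner_sq_lt_one
    rw [real_inner_self_eq_norm_sq, h.1] at this
    norm_num at this
  rcases h.left_mem h' with h1 | h1 <;> rcases h.symm.left_mem h' with h2 | h2
  · exact absurd (h1.trans h2.symm) hab
  · exact Or.inl ⟨h1, h2⟩
  · exact Or.inr ⟨h1, h2⟩
  · exact absurd (h1.trans h2.symm) hab

open Classical in
/-- The outward unit normals of the two faces meeting at a point of a convex edge (in an arbitrary
order), and `0` elsewhere. -/
def edgeNormals (Δ : Set E3) (p : E3) : E3 × E3 :=
  if h : ∃ ab : E3 × E3, IsConvexEdgePoint Δ p ab.1 ab.2 then h.choose else 0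

lemma IsConvexEdgePoint.edgeNormals_spec (h : IsConvexEdgePoint Δ p a b) :
    IsConvexEdgePoint Δ p (edgeNormals Δ p).1 (edgeNormals Δ p).2 := by
  have h' : ∃ ab : E3 × E3, IsConvexEdgePoint Δ p ab.1 ab.2 := ⟨(a, b), h⟩
  rw [edgeNormals, dif_pos h']
  exact h'.choose_spec

lemma IsConvexEdgePoint.edgeNormals_eq (h : IsConvexEdgePoint Δ p a b) :
    edgeNormals Δ p = (a, b) ∨ edgeNormals Δ p = (b, a) := by
  rcases h.edgeNormals_spec.unique h with ⟨h1, h2⟩ | ⟨h1, h2⟩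
  · exact Or.inl (Prod.ext h1 h2)
  · exact Or.inr (Prod.ext h1 h2)

lemma IsConvexEdgePoint.dihedralAngle_eq (h : IsConvexEdgePoint Δ p a b) (g : MetricField) :
    dihedralAngle g Δ p
      = Real.pi - normalAngle g (edgeNormals Δ p).1 (edgeNormals Δ p).2 p := by
  have h' : ∃ ab : E3 × E3, IsConvexEdgePoint Δ p ab.1 ab.2 := ⟨(a, b), h⟩
  rw [dihedralAngle, edgeNormals, dif_pos h', dif_pos h']

lemma IsFacePoint.outwardNormal_eq (h : IsFacePoint Δ p a) : outwardNormal Δ p = a := by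
  have h' : ∃ a, IsFacePoint Δ p a := ⟨a, h⟩
  rw [outwardNormal, dif_pos h']
  exact h'.choose_spec.unique h

lemma outwardNormal_of_notMem (h : p ∉ faceSet Δ) : outwardNormal Δ p = 0 := by
  exact dif_neg h

lemma faceSet_subset_frontier : faceSet Δ ⊆ frontier Δ := fun _ ⟨_, h⟩ => h.mem_frontier

lemma measurableSet_faceSet : MeasurableSet (faceSet Δ) := by
  have : faceSet Δ = frontier Δ ∩ {p | ∀ᶠ x in 𝓝 p, x ∈ frontier Δ → x ∈ faceSet Δ} := by
    ext p
    constructor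
    · rintro ⟨a, h⟩
      refine ⟨h.mem_frontier, ?_⟩
      filter_upwards [h.eventually_near] with x hx hxf
      rw [mem_frontier_iff_notMem_nhds] at hxf
      rcases lt_trichotomy ⟪a, x - p⟫ 0 with h1 | h1 | h1
      · exact absurd (hx.2.1 h1) hxf.1
      · exact ⟨a, hx.1 h1⟩
      · exact absurd (hx.2.2 h1) hxf.2
    · rintro ⟨h1, h2⟩
      exact h2.self_of_nhds h1
  rw [this]
  exact isClosed_frontier.measurableSet.inter isOpen_setOfPred_eventually_nhds.measurableSet

/-- Functions of the position and of the normal that are continuous in the position are continuous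
on the union of the open faces. -/
lemma continuousOn_faceSet {U : Set E3} (hU : Δ ⊆ U) {F : E3 → E3 → ℝ}
    (hF : ∀ a, ‖a‖ = 1 → ContinuousOn (F a) U) :
    ContinuousOn (fun x => F (outwardNormal Δ x) x) (faceSet Δ) := by
  rintro p ⟨a, h⟩
  have h1 : ContinuousWithinAt (F a) (faceSet Δ) p :=
    ((hF a h.1) p (hU h.mem)).mono fun x ⟨_, hx⟩ => hU hx.mem
  refine h1.congr_of_eventuallyEq ?_ (by simp only [h.outwardNormal_eq])
  filter_upwards [nhdsWithin_le_nhds h.eventually_near, self_mem_nhdsWithin] with x hx ⟨b, hb⟩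
  have hxf := mem_frontier_iff_notMem_nhds.1 hb.mem_frontier
  rcases lt_trichotomy ⟪a, x - p⟫ 0 with h1 | h1 | h1
  · exact absurd (hx.2.1 h1) hxf.1
  · rw [(hx.1 h1).outwardNormal_eq]
  · exact absurd (hx.2.2 h1) hxf.2

/-- All edges of `Δ` are convex. -/
def ConvexEdges (Δ : Set E3) : Prop := ∀ p ∈ edgeSet Δ, ∃ a b, IsConvexEdgePoint Δ p a b

lemma IsConvexEdgePoint.mem_edgeSet (h : IsConvexEdgePoint Δ p a b) : p ∈ edgeSet Δ :=
  ⟨a, b, Or.inl h⟩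

/-- Symmetric functions of the two normals that are continuous in the position are continuous on
the union of the open edges. -/
lemma continuousOn_edgeSet {U : Set E3} (hU : Δ ⊆ U) (hE : ConvexEdges Δ) {F : E3 → E3 → E3 → ℝ}
    (hs : ∀ a b x, x ∈ U → F a b x = F b a x)
    (hF : ∀ a b, ‖a‖ = 1 → ‖b‖ = 1 → ContinuousOn (F a b) U) :
    ContinuousOn (fun x => F (edgeNormals Δ x).1 (edgeNormals Δ x).2 x) (edgeSet Δ) := by
  have key : ∀ {x a b}, IsConvexEdgePoint Δ x a b →
      F (edgeNormals Δ x).1 (edgeNormals Δ x).2 x = F a b x := by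
    intro x a b hx
    rcases hx.edgeNormals_eq with h | h
    · rw [h]
    · rw [h, hs _ _ _ (hU hx.mem)]
  intro p hp
  obtain ⟨a, b, h⟩ := hE p hp
  have h1 : ContinuousWithinAt (F a b) (edgeSet Δ) p :=
    ((hF a b h.1 h.2.1) p (hU h.mem)).mono fun x hx => by
      obtain ⟨_, _, hx⟩ := hE x hx
      exact hU hx.mem
  refine h1.congr_of_eventuallyEq ?_ (key h)
  filter_upwards [nhdsWithin_le_nhds h.eventually_near, self_mem_nhdsWithin] with x hx hxE
  obtain ⟨a', b', hx'⟩ := hE x hxE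
  have hxf := mem_frontier_iff_notMem_nhds.1 hx'.mem_frontier
  rcases lt_trichotomy ⟪a, x - p⟫ 0 with h1 | h1 | h1
  · rcases lt_trichotomy ⟪b, x - p⟫ 0 with h2 | h2 | h2
    · exact absurd (hx.2.2.2.1 h1 h2) hxf.1
    · exact absurd (hx.2.2.1 h1 h2) hx'.not_isFacePoint
    · exact absurd (hx.2.2.2.2 (Or.inr h2)) hxf.2
  · rcases lt_trichotomy ⟪b, x - p⟫ 0 with h2 | h2 | h2
    · exact absurd (hx.2.1 h1 h2) hx'.not_isFacePoint
    · exact key (hx.1 h1 h2)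
    · exact absurd (hx.2.2.2.2 (Or.inr h2)) hxf.2
  · exact absurd (hx.2.2.2.2 (Or.inl h1)) hxf.2

lemma edgeSet_subset_frontier (hE : ConvexEdges Δ) : edgeSet Δ ⊆ frontier Δ := fun p hp => by
  obtain ⟨_, _, h⟩ := hE p hp
  exact h.mem_frontier

lemma measurableSet_edgeSet (hE : ConvexEdges Δ) (hΔ : IsPolyhedron Δ) :
    MeasurableSet (edgeSet Δ) := by
  have : edgeSet Δ = (frontier Δ \ faceSet Δ) \ (frontier Δ \ (faceSet Δ ∪ edgeSet Δ)) := by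
    ext p
    constructor
    · intro hp
      refine ⟨⟨edgeSet_subset_frontier hE hp, ?_⟩, fun h => h.2 (Or.inr hp)⟩
      obtain ⟨_, _, h⟩ := hE p hp
      exact fun ⟨_, h'⟩ => h.not_isFacePoint h'
    · rintro ⟨⟨h1, h2⟩, h3⟩
      by_contra h4
      exact h3 ⟨h1, fun h => h.elim h2 h4⟩
  rw [this]
  exact (isClosed_frontier.measurableSet.diff measurableSet_faceSet).diff
    hΔ.vertices.measurableSet

end Germs

/-! ### Area and length of polyhedra -/

section Measures

variable {Δ : Set E3} {p x a b : E3}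

lemma exists_basis_two (ha : ‖a‖ = 1) : ∃ B : OrthonormalBasis (Fin 3) ℝ E3, B 2 = a := by
  have h : Orthonormal ℝ (({2} : Set (Fin 3)).domRestrict fun _ => a) := by
    refine ⟨fun i => ha, fun i j hij => absurd (Subtype.ext ?_) hij⟩
    rw [Set.mem_singleton_iff.1 i.2, Set.mem_singleton_iff.1 j.2]
  obtain ⟨B, hB⟩ := h.exists_orthonormalBasis_extension_of_card_eq (by simp)
  exact ⟨B, hB 2 rfl⟩

lemma exists_basis_one_two {m : E3} (hm : ‖m‖ = 1) (ha : ‖a‖ = 1) (h0 : ⟪m, a⟫ = 0) :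
    ∃ B : OrthonormalBasis (Fin 3) ℝ E3, B 1 = m ∧ B 2 = a := by
  have h : Orthonormal ℝ (({1, 2} : Set (Fin 3)).domRestrict ![0, m, a]) := by
    refine ⟨fun i => ?_, fun i j hij => ?_⟩
    · change ‖![0, m, a] i.1‖ = 1
      rcases i.2 with hi | hi
      · rw [hi]; exact hm
      · rw [Set.mem_singleton_iff.1 hi]; exact ha
    · change ⟪![0, m, a] i.1, ![0, m, a] j.1⟫ = 0
      rcases i.2 with hi | hi <;> rcases j.2 with hj | hj
      · exact absurd (Subtype.ext (hi.trans hj.symm)) hij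
      · rw [hi, Set.mem_singleton_iff.1 hj]; exact h0
      · rw [hj, Set.mem_singleton_iff.1 hi]; exact (real_inner_comm _ _).trans h0
      · exact absurd (Subtype.ext ((Set.mem_singleton_iff.1 hi).trans
          (Set.mem_singleton_iff.1 hj).symm)) hij
  obtain ⟨B, hB⟩ := h.exists_orthonormalBasis_extension_of_card_eq (by simp)
  exact ⟨B, hB 1 (by simp), hB 2 (by simp)⟩

/-- The unit vector orthogonal to `a` that points, inside the face with normal `a` of the wedge
`{⟪a, ·⟫ ≤ 0, ⟪b, ·⟫ ≤ 0}`, out of that face through its edge. -/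
def conormal (a b : E3) : E3 := (√(1 - ⟪a, b⟫ ^ 2))⁻¹ • (b - ⟪a, b⟫ • a)

lemma inner_conormal (a b y : E3) :
    ⟪conormal a b, y⟫ = (√(1 - ⟪a, b⟫ ^ 2))⁻¹ * (⟪b, y⟫ - ⟪a, b⟫ * ⟪a, y⟫) := by
  rw [conormal, real_inner_smul_left, inner_sub_left, real_inner_smul_left]

lemma inner_conormal_self (ha : ‖a‖ = 1) : ⟪conormal a b, a⟫ = 0 := by
  rw [inner_conormal, real_inner_self_eq_norm_sq, ha, real_inner_comm a b]
  ring

lemma sqrt_one_sub_pos (h : ⟪a, b⟫ ^ 2 < 1) : 0 < √(1 - ⟪a, b⟫ ^ 2) :=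
  Real.sqrt_pos.2 (by linarith)

lemma norm_conormal (ha : ‖a‖ = 1) (hb : ‖b‖ = 1) (h : ⟪a, b⟫ ^ 2 < 1) : ‖conormal a b‖ = 1 := by
  have hs := sqrt_one_sub_pos h
  have hsq : √(1 - ⟪a, b⟫ ^ 2) ^ 2 = 1 - ⟪a, b⟫ ^ 2 := Real.sq_sqrt (by linarith)
  have : ‖conormal a b‖ ^ 2 = 1 := by
    rw [← real_inner_self_eq_norm_sq, inner_conormal, real_inner_comm (conormal a b) b,
      real_inner_comm (conormal a b) a, inner_conormal, inner_conormal_self ha,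
      real_inner_self_eq_norm_sq, hb]
    field_simp
    rw [hsq]; ring
  nlinarith [norm_nonneg (conormal a b)]

/-- The orthonormal basis adapted to the face with normal `a` at the edge shared with the face with
normal `b`. -/
lemma exists_basis_edge (ha : ‖a‖ = 1) (hb : ‖b‖ = 1) (h : ⟪a, b⟫ ^ 2 < 1) :
    ∃ B : OrthonormalBasis (Fin 3) ℝ E3, B 1 = conormal a b ∧ B 2 = a :=
  exists_basis_one_two (norm_conormal ha hb h) ha (inner_conormal_self ha)

lemma inner_conormal_nonpos_iff (h : ⟪a, b⟫ ^ 2 < 1) {y : E3} (hy : ⟪a, y⟫ = 0) :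
    ⟪conormal a b, y⟫ ≤ 0 ↔ ⟪b, y⟫ ≤ 0 := by
  have hs := inv_pos.2 (sqrt_one_sub_pos h)
  rw [inner_conormal, hy, mul_zero, sub_zero]
  exact ⟨fun h => by nlinarith, fun h => mul_nonpos_of_nonneg_of_nonpos hs.le h⟩

lemma line_eq (h : ⟪a, b⟫ ^ 2 < 1) (p : E3) :
    {x : E3 | ⟪conormal a b, x - p⟫ = 0 ∧ ⟪a, x - p⟫ = 0}
      = {x | ⟪a, x - p⟫ = 0 ∧ ⟪b, x - p⟫ = 0} := by
  ext x
  have hs := (inv_pos.2 (sqrt_one_sub_pos h)).ne'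
  simp only [Set.mem_ofPred_eq, inner_conormal]
  constructor
  · rintro ⟨h1, h2⟩
    rw [h2, mul_zero, sub_zero] at h1
    exact ⟨h2, (mul_eq_zero.1 h1).resolve_left hs⟩
  · rintro ⟨h1, h2⟩
    rw [h1, h2]; simp

/-- Two transverse planes meet in a set of area zero whose bounded parts have finite length. -/
lemma measure_inter_planes (ha : ‖a‖ = 1) (hb : ‖b‖ = 1) (h : ⟪a, b⟫ ^ 2 < 1) (α β : ℝ) :
    (μHE[2] : Measure E3) {x | ⟪a, x⟫ = α ∧ ⟪b, x⟫ = β} = 0 ∧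
      ∀ R, (μHE[1] : Measure E3) ({x | ⟪a, x⟫ = α ∧ ⟪b, x⟫ = β} ∩ Metric.closedBall 0 R) < ⊤ := by
  rcases Set.eq_empty_or_nonempty {x : E3 | ⟪a, x⟫ = α ∧ ⟪b, x⟫ = β} with h0 | ⟨p, hp⟩
  · simp [h0]
  · obtain ⟨B, hB1, hB2⟩ := exists_basis_edge ha hb h
    have : {x : E3 | ⟪a, x⟫ = α ∧ ⟪b, x⟫ = β} = {x | ⟪B 1, x - p⟫ = 0 ∧ ⟪B 2, x - p⟫ = 0} := by
      rw [hB1, hB2, line_eq h]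
      ext x
      have hp' : ⟪a, p⟫ = α ∧ ⟪b, p⟫ = β := hp
      simp only [Set.mem_ofPred_eq, inner_sub_right, sub_eq_zero, hp'.1, hp'.2]
    rw [this]
    exact ⟨measure_line_eq_zero B p, fun R => measure_line_inter_ball_lt_top B p 0 R⟩

lemma eq_or_eq_neg_of_inner_sq (ha : ‖a‖ = 1) (hb : ‖b‖ = 1) (h : ¬ ⟪a, b⟫ ^ 2 < 1) :
    b = a ∨ b = -a := by
  have h1 : |⟪a, b⟫| ≤ 1 := by simpa [ha, hb] using abs_real_inner_le_norm a b
  have h2 : ⟪a, b⟫ ^ 2 = 1 := le_antisymm (by rwa [sq_le_one_iff_abs_le_one]) (not_lt.1 h)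
  rcases sq_eq_one_iff.1 h2 with h3 | h3
  · exact Or.inl ((inner_eq_one_iff_of_norm_eq_one (𝕜 := ℝ) ha hb).1 h3).symm
  · have h4 : ⟪-a, b⟫ = 1 := by rw [inner_neg_left, h3]; norm_num
    exact Or.inr ((inner_eq_one_iff_of_norm_eq_one (𝕜 := ℝ) (by simpa using ha) hb).1 h4).symm

/-- At a convex edge, the plane of the first face is one of the finitely many planes of the
polyhedron: the others cover only a null set of this face. -/
lemma IsConvexEdgePoint.exists_plane (h : IsConvexEdgePoint Δ p a b) {P : Set (E3 × ℝ)}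
    (hPf : P.Finite) (hP1 : ∀ P' ∈ P, ‖P'.1‖ = 1)
    (hP : ∀ x ∈ frontier Δ, ∃ P' ∈ P, ⟪P'.1, x⟫ = P'.2) :
    ∃ P' ∈ P, (P'.1 = a ∨ P'.1 = -a) ∧ ⟪P'.1, p⟫ = P'.2 := by
  by_contra! hcon
  obtain ⟨W, hW, hWo, hpW⟩ := eventually_nhds_iff.1 h.eventually_near
  -- A relatively open piece of the face, which has positive area.
  set S : Set E3 := {x | ⟪a, x - p⟫ = 0} ∩ (W ∩ {x | ⟪b, x - p⟫ < 0})
  have hne : S.Nonempty := by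
    obtain ⟨x, ⟨hxa, hxb⟩, hxW⟩ := (h.frequently_face.and_eventually (hWo.mem_nhds hpW)).exists
    exact ⟨x, hxa, hxW, hxb⟩
  have hpos : 0 < (μHE[2] : Measure E3) S := by
    obtain ⟨B, hB⟩ := exists_basis_two h.1
    have := measure_plane_inter_pos B p (s := W ∩ {x | ⟪b, x - p⟫ < 0})
      (hWo.inter (isOpen_lt (by fun_prop) continuous_const)) (by rw [hB]; exact hne)
    rwa [hB] at this
  have hsub : S ⊆ ⋃ P' ∈ P, {x | ⟪a, x - p⟫ = 0} ∩ {x | ⟪P'.1, x⟫ = P'.2} := by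
    rintro x ⟨hxa, hxW, hxb⟩
    obtain ⟨P', hP', hx⟩ := hP x ((hW x hxW).2.1 hxa hxb).mem_frontier
    exact Set.mem_biUnion hP' ⟨hxa, hx⟩
  have hnull : (μHE[2] : Measure E3) S = 0 := by
    refine measure_mono_null hsub ((measure_biUnion_null_iff hPf.countable).2 fun P' hP' => ?_)
    by_cases hlt : ⟪a, P'.1⟫ ^ 2 < 1
    · refine measure_mono_null ?_ (measure_inter_planes h.1 (hP1 P' hP') hlt ⟪a, p⟫ P'.2).1
      rintro x ⟨h1, h2⟩
      have h1' : ⟪a, x - p⟫ = 0 := h1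
      rw [inner_sub_right, sub_eq_zero] at h1'
      exact ⟨h1', h2⟩
    · have hor := eq_or_eq_neg_of_inner_sq h.1 (hP1 P' hP') hlt
      have hne := hcon P' hP' hor
      refine measure_mono_null ?_ measure_empty
      rintro x ⟨h1, h2⟩
      have h1' : ⟪a, x - p⟫ = 0 := h1
      have h2' : ⟪P'.1, x⟫ = P'.2 := h2
      rw [inner_sub_right, sub_eq_zero] at h1'
      apply hne
      rw [← h2']
      rcases hor with e | e <;> rw [e]
      · exact h1'.symm
      · rw [inner_neg_left, inner_neg_left, h1']
  exact hpos.ne' hnull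

/-- The edges of a polyhedron with convex edges lie on finitely many lines. -/
lemma exists_lines_edgeSet (hΔ : IsPolyhedron Δ) (hE : ConvexEdges Δ) :
    ∃ L : Set (Set E3), L.Finite ∧ edgeSet Δ ⊆ ⋃₀ L ∧ ∀ s ∈ L, (μHE[2] : Measure E3) s = 0 ∧
      ∀ R, (μHE[1] : Measure E3) (s ∩ Metric.closedBall 0 R) < ⊤ := by
  obtain ⟨P, hPf, hP1, hP⟩ := hΔ.planes
  refine ⟨(fun PP : (E3 × ℝ) × (E3 × ℝ) =>
      {x : E3 | ⟪PP.1.1, x⟫ = PP.1.2 ∧ ⟪PP.2.1, x⟫ = PP.2.2}) ''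
    ((P ×ˢ P) ∩ {PP | ⟪PP.1.1, PP.2.1⟫ ^ 2 < 1}),
    (Set.Finite.inter_of_left (hPf.prod hPf) _).image _, ?_, ?_⟩
  · intro p hp
    obtain ⟨a, b, h⟩ := hE p hp
    obtain ⟨P1, h1, h1n, h1p⟩ := h.exists_plane hPf hP1 hP
    obtain ⟨P2, h2, h2n, h2p⟩ := h.symm.exists_plane hPf hP1 hP
    refine Set.mem_sUnion.2 ⟨_, ⟨(P1, P2), ⟨⟨h1, h2⟩, ?_⟩, rfl⟩, h1p, h2p⟩
    have := h.inner_sq_lt_one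
    rcases h1n with e1 | e1 <;> rcases h2n with e2 | e2 <;>
      simpa [e1, e2, inner_neg_left, inner_neg_right] using this
  · rintro _ ⟨PP, ⟨⟨h1, h2⟩, h3⟩, rfl⟩
    exact measure_inter_planes (hP1 _ h1) (hP1 _ h2) h3 _ _

lemma measure_edgeSet_lt_top (hΔ : IsPolyhedron Δ) (hE : ConvexEdges Δ) :
    (μHE[1] : Measure E3) (edgeSet Δ) < ⊤ := by
  obtain ⟨L, hL, hsub, hm⟩ := exists_lines_edgeSet hΔ hE
  obtain ⟨R, hR⟩ := hΔ.isCompact.isBounded.subset_closedBall (0 : E3)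
  have : edgeSet Δ ⊆ ⋃ s ∈ L, s ∩ Metric.closedBall 0 R := by
    intro p hp
    obtain ⟨s, hs, hps⟩ := hsub hp
    obtain ⟨_, _, h⟩ := hE p hp
    exact Set.mem_biUnion hs ⟨hps, hR h.mem⟩
  exact (measure_mono this).trans_lt (measure_biUnion_lt_top hL fun s hs => (hm s hs).2 R)

lemma measure_singleton_eq_zero (v : E3) : (μHE[2] : Measure E3) {v} = 0 := by
  refine measure_mono_null ?_ (measure_line_eq_zero (EuclideanSpace.basisFun (Fin 3) ℝ) v)
  rintro x rfl
  simp

/-- Almost every boundary point is a face point. -/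
lemma measure_frontier_diff_faceSet (hΔ : IsPolyhedron Δ) (hE : ConvexEdges Δ) :
    (μHE[2] : Measure E3) (frontier Δ \ faceSet Δ) = 0 := by
  obtain ⟨L, hL, hsub, hm⟩ := exists_lines_edgeSet hΔ hE
  have : frontier Δ \ faceSet Δ ⊆ (⋃ s ∈ L, s) ∪
      ⋃ v ∈ frontier Δ \ (faceSet Δ ∪ edgeSet Δ), {v} := by
    rintro p ⟨h1, h2⟩
    by_cases h3 : p ∈ edgeSet Δ
    · exact Or.inl (by simpa using hsub h3)
    · exact Or.inr (Set.mem_biUnion ⟨h1, fun h => h.elim h2 h3⟩ rfl)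
  refine measure_mono_null this (measure_union_null ?_ ?_)
  · exact (measure_biUnion_null_iff hL.countable).2 fun s hs => (hm s hs).1
  · exact (measure_biUnion_null_iff hΔ.vertices.countable).2 fun v _ => measure_singleton_eq_zero v

/-- The boundary area of a polyhedron in balls of radius `ρ` is at most quadratic in `ρ`. -/
lemma exists_measure_frontier_inter_ball_le (hΔ : IsPolyhedron Δ) :
    ∃ C : ℝ, 0 ≤ C ∧ ∀ v ρ, 0 ≤ ρ →
      (μHE[2] : Measure E3) (frontier Δ ∩ Metric.closedBall v ρ) ≤ ENNReal.ofReal (C * ρ ^ 2) := by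
  obtain ⟨P, hPf, hP1, hP⟩ := hΔ.planes
  refine ⟨hPf.toFinset.card * 4, by positivity, fun v ρ hρ => ?_⟩
  have hsub : frontier Δ ∩ Metric.closedBall v ρ
      ⊆ ⋃ P' ∈ hPf.toFinset, {x : E3 | ⟪P'.1, x⟫ = P'.2} ∩ Metric.closedBall v ρ := by
    rintro x ⟨h1, h2⟩
    obtain ⟨P', hP', hx⟩ := hP x h1
    exact Set.mem_biUnion (hPf.mem_toFinset.2 hP') ⟨hx, h2⟩
  refine (measure_mono hsub).trans ((measure_biUnion_finset_le _ _).trans ?_)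
  refine (Finset.sum_le_card_nsmul _ _ (ENNReal.ofReal (4 * ρ ^ 2)) fun P' hP' => ?_).trans ?_
  · have hn := hP1 P' (hPf.mem_toFinset.1 hP')
    obtain ⟨B, hB⟩ := exists_basis_two hn
    have := measure_plane_inter_ball_le B (P'.2 • P'.1) v hρ
    have e : {x : E3 | ⟪B 2, x - P'.2 • P'.1⟫ = 0} = {x : E3 | ⟪P'.1, x⟫ = P'.2} := by
      ext x
      simp only [Set.mem_ofPred_eq, hB, inner_sub_right, inner_smul_right,
        real_inner_self_eq_norm_sq, hn, sub_eq_zero]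
      norm_num
    rwa [e] at this
  · rw [nsmul_eq_mul, ← ENNReal.ofReal_natCast, ← ENNReal.ofReal_mul (by positivity), mul_assoc]

lemma measure_frontier_lt_top (hΔ : IsPolyhedron Δ) : (μHE[2] : Measure E3) (frontier Δ) < ⊤ := by
  obtain ⟨C, hC, h⟩ := exists_measure_frontier_inter_ball_le hΔ
  obtain ⟨R, hR⟩ := hΔ.isCompact.isBounded.subset_closedBall (0 : E3)
  have hsub : frontier Δ ⊆ frontier Δ ∩ Metric.closedBall 0 (max R 0) := fun x hx =>
    ⟨hx, Metric.closedBall_subset_closedBall (le_max_left _ _) (hR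
      (hΔ.isCompact.isClosed.frontier_subset hx))⟩
  exact (measure_mono hsub).trans_lt ((h 0 _ (le_max_right _ _)).trans_lt ENNReal.ofReal_lt_top)

end Measures

/-! ### The divergence theorem on polyhedra -/

lemma isOpen_upperHalfSpace : IsOpen upperHalfSpace :=
  isOpen_lt continuous_const (by fun_prop)

section Local

variable {Δ : Set E3} {p x a b : E3} {Y : E3 → E3 → E3} {χ : E3 → ℝ}

lemma integrableOn_frontier (hΔ : IsPolyhedron Δ) (hE : ConvexEdges Δ) {F : E3 → E3 → ℝ}
    (hF : ∀ a, ‖a‖ = 1 → ContinuousOn (F a) upperHalfSpace) {C : ℝ}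
    (hC : ∀ a, ‖a‖ = 1 → ∀ x ∈ Δ, |F a x| ≤ C) :
    IntegrableOn (fun x => F (outwardNormal Δ x) x) (frontier Δ) μHE[2] := by
  have h1 : IntegrableOn (fun x => F (outwardNormal Δ x) x) (faceSet Δ) μHE[2] := by
    have : IsFiniteMeasure ((μHE[2] : Measure E3).restrict (faceSet Δ)) :=
      isFiniteMeasure_restrict.2
        ((measure_mono faceSet_subset_frontier).trans_lt (measure_frontier_lt_top hΔ)).ne
    refine Integrable.of_bound
      ((continuousOn_faceSet hΔ.subset hF).aestronglyMeasurable measurableSet_faceSet) C ?_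
    filter_upwards [ae_restrict_mem measurableSet_faceSet] with x ⟨a, hx⟩
    rw [hx.outwardNormal_eq]
    exact hC a hx.1 x hx.mem
  refine h1.congr_set_ae ?_
  have h2 : frontier Δ ≤ᵐ[μHE[2]] faceSet Δ :=
    ae_le_set.2 (measure_frontier_diff_faceSet hΔ hE)
  exact h2.antisymm (Eventually.of_forall faceSet_subset_frontier)

lemma integrableOn_edgeSet (hΔ : IsPolyhedron Δ) (hE : ConvexEdges Δ) {F : E3 → E3 → E3 → ℝ}
    (hs : ∀ a b x, x ∈ upperHalfSpace → F a b x = F b a x)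
    (hF : ∀ a b, ‖a‖ = 1 → ‖b‖ = 1 → ContinuousOn (F a b) upperHalfSpace) {C : ℝ}
    (hC : ∀ a b x, IsConvexEdgePoint Δ x a b → |F a b x| ≤ C) :
    IntegrableOn (fun x => F (edgeNormals Δ x).1 (edgeNormals Δ x).2 x) (edgeSet Δ) μHE[1] := by
  have : IsFiniteMeasure ((μHE[1] : Measure E3).restrict (edgeSet Δ)) :=
    isFiniteMeasure_restrict.2 (measure_edgeSet_lt_top hΔ hE).ne
  refine Integrable.of_bound ((continuousOn_edgeSet hΔ.subset hE hs hF).aestronglyMeasurable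
    (measurableSet_edgeSet hE hΔ)) C ?_
  filter_upwards [ae_restrict_mem (measurableSet_edgeSet hE hΔ)] with x hx
  obtain ⟨a, b, h⟩ := hE x hx
  exact hC _ _ x h.edgeNormals_spec

/-- The flux of the fields `Y a` and `Y b`, along the faces with normals `a` and `b`, out of these
faces through their common edge. -/
def edgeFlux (Y : E3 → E3 → E3) (a b x : E3) : ℝ :=
  ⟪Y a x, conormal a b⟫ + ⟪Y b x, conormal b a⟫

lemma edgeFlux_symm (Y : E3 → E3 → E3) (a b x : E3) : edgeFlux Y a b x = edgeFlux Y b a x :=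
  add_comm _ _

/-- The divergence of `χ Y` along the plane with unit normal `a`, written out with the product
rule. -/
def cutDiv (Y : E3 → E3 → E3) (χ : E3 → ℝ) (a x : E3) : ℝ :=
  χ x * tangentialDiv a (Y a) x + fderiv ℝ χ x (Y a x - ⟪Y a x, a⟫ • a)

lemma tangentialDiv_smul {Z : E3 → E3} (hχ : DifferentiableAt ℝ χ x)
    (hZ : DifferentiableAt ℝ Z x) :
    tangentialDiv a (fun y => χ y • Z y) x
      = χ x * tangentialDiv a Z x + fderiv ℝ χ x (Z x - ⟪Z x, a⟫ • a) := by
  have h1 : fderiv ℝ (fun y => χ y • Z y) x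
      = χ x • fderiv ℝ Z x + (fderiv ℝ χ x).smulRight (Z x) :=
    (hχ.hasFDerivAt.smul hZ.hasFDerivAt).fderiv
  have h2 : fderiv ℝ χ x (Z x) = ∑ i, fderiv ℝ χ x (EuclideanSpace.single i 1) * Z x i := by
    conv_lhs => rw [← (EuclideanSpace.basisFun (Fin 3) ℝ).sum_repr (Z x)]
    rw [map_sum]
    refine Finset.sum_congr rfl fun i _ => ?_
    simp [mul_comm]
  simp only [tangentialDiv, h1, map_sub, map_smul, h2]
  simp only [add_apply, smul_apply,
    ContinuousLinearMap.smulRight_apply, PiLp.add_apply, PiLp.smul_apply, smul_eq_mul,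
    Finset.sum_add_distrib, inner_add_left, real_inner_smul_left, ← Finset.mul_sum]
  ring

/-- The divergence theorem for the field `χ Y` on the boundary of `Δ`. -/
def DivIdentity (Δ : Set E3) (Y : E3 → E3 → E3) (χ : E3 → ℝ) : Prop :=
  ∫ x in frontier Δ, cutDiv Y χ (outwardNormal Δ x) x ∂μHE[2]
    = ∫ x in edgeSet Δ, χ x * edgeFlux Y (edgeNormals Δ x).1 (edgeNormals Δ x).2 x ∂μHE[1]

lemma fderiv_eq_zero_of_notMem_tsupport (hx : x ∉ tsupport χ) : fderiv ℝ χ x = 0 := by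
  rw [(notMem_tsupport_iff_eventuallyEq.1 hx).fderiv_eq]
  simp

lemma cutDiv_of_notMem_tsupport (hx : x ∉ tsupport χ) : cutDiv Y χ a x = 0 := by
  rw [cutDiv, image_eq_zero_of_notMem_tsupport hx, fderiv_eq_zero_of_notMem_tsupport hx]
  simp

lemma contDiff_cut (hY : ∀ a, ‖a‖ = 1 → ContDiffOn ℝ 1 (Y a) upperHalfSpace)
    (ha : ‖a‖ = 1) (hχ : ContDiff ℝ 1 χ) (hs : tsupport χ ⊆ upperHalfSpace) :
    ContDiff ℝ 1 (fun y => χ y • Y a y) := by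
  refine contDiff_iff_contDiffAt.2 fun x => ?_
  by_cases hx : x ∈ tsupport χ
  · exact hχ.contDiffAt.smul ((hY a ha).contDiffAt (isOpen_upperHalfSpace.mem_nhds (hs hx)))
  · refine (contDiffAt_const (c := (0 : E3))).congr_of_eventuallyEq ?_
    filter_upwards [notMem_tsupport_iff_eventuallyEq.1 hx] with y hy
    simp [hy]

lemma cutDiv_eq (hY : ∀ a, ‖a‖ = 1 → ContDiffOn ℝ 1 (Y a) upperHalfSpace)
    (ha : ‖a‖ = 1) (hχ : ContDiff ℝ 1 χ) (hs : tsupport χ ⊆ upperHalfSpace) (x : E3) :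
    cutDiv Y χ a x = tangentialDiv a (fun y => χ y • Y a y) x := by
  by_cases hx : x ∈ tsupport χ
  · refine (tangentialDiv_smul (hχ.differentiable one_ne_zero x) ?_).symm
    exact ((hY a ha).contDiffAt (isOpen_upperHalfSpace.mem_nhds (hs hx))).differentiableAt
      one_ne_zero
  · rw [cutDiv_of_notMem_tsupport hx]
    have : (fun y => χ y • Y a y) =ᶠ[𝓝 x] fun _ => 0 := by
      filter_upwards [notMem_tsupport_iff_eventuallyEq.1 hx] with y hy
      simp [hy]
    simp [tangentialDiv, this.fderiv_eq]

lemma divIdentity_of_disjoint (hE : ConvexEdges Δ) (h : Disjoint (tsupport χ) (frontier Δ)) :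
    DivIdentity Δ Y χ := by
  have hn : ∀ x ∈ frontier Δ, x ∉ tsupport χ := fun x hx hx' =>
    Set.disjoint_left.1 h hx' hx
  rw [DivIdentity, setIntegral_eq_zero_of_forall_eq_zero, setIntegral_eq_zero_of_forall_eq_zero]
  · intro x hx
    rw [image_eq_zero_of_notMem_tsupport (hn x (edgeSet_subset_frontier hE hx)), zero_mul]
  · intro x hx
    exact cutDiv_of_notMem_tsupport (hn x hx)

lemma setIntegral_eq_of_indicator {μ : Measure E3} {s t : Set E3} {f f' : E3 → ℝ}
    (hs : MeasurableSet s) (ht : MeasurableSet t) (h : s.indicator f =ᵐ[μ] t.indicator f') :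
    ∫ x in s, f x ∂μ = ∫ x in t, f' x ∂μ := by
  rw [← integral_indicator hs, ← integral_indicator ht, integral_congr_ae h]

lemma measurableSet_plane (a p : E3) : MeasurableSet {x : E3 | ⟪a, x - p⟫ = 0} :=
  (isClosed_eq (by fun_prop) continuous_const).measurableSet

/-- The divergence theorem for fields supported near a face point. -/
lemma IsFacePoint.exists_divIdentity
    (hY : ∀ a, ‖a‖ = 1 → ContDiffOn ℝ 1 (Y a) upperHalfSpace)
    (hE : ConvexEdges Δ) (hΔ : Δ ⊆ upperHalfSpace)
    (h : IsFacePoint Δ p a) :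
    ∃ W, IsOpen W ∧ p ∈ W ∧ ∀ χ : E3 → ℝ, ContDiff ℝ 1 χ → HasCompactSupport χ →
      tsupport χ ⊆ W → DivIdentity Δ Y χ := by
  obtain ⟨W, hW, hWo, hpW⟩ := eventually_nhds_iff.1 h.eventually_near
  refine ⟨W ∩ upperHalfSpace, hWo.inter isOpen_upperHalfSpace, ⟨hpW, hΔ h.mem⟩,
    fun χ hχ hc hs => ?_⟩
  have hf : ∀ x ∈ W, x ∈ frontier Δ → ⟪a, x - p⟫ = 0 := by
    intro x hx hxf
    rw [mem_frontier_iff_notMem_nhds] at hxf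
    rcases lt_trichotomy ⟪a, x - p⟫ 0 with h1 | h1 | h1
    · exact absurd ((hW x hx).2.1 h1) hxf.1
    · exact h1
    · exact absurd ((hW x hx).2.2 h1) hxf.2
  have hsU := hs.trans Set.inter_subset_right
  have hZ := contDiff_cut hY h.1 hχ hsU
  obtain ⟨B, hB⟩ := exists_basis_two h.1
  have hdiv := integral_tangentialDiv_plane B p hZ (hc.smul_right)
  rw [hB] at hdiv
  rw [DivIdentity, setIntegral_eq_of_indicator (f' := tangentialDiv a (fun y => χ y • Y a y))
    isClosed_frontier.measurableSet (measurableSet_plane a p) (Eventually.of_forall fun x => ?_),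
    hdiv, setIntegral_eq_zero_of_forall_eq_zero]
  · intro x hx
    by_cases hxs : x ∈ tsupport χ
    · obtain ⟨b, b', hxb⟩ := hE x hx
      have hxW := (hs hxs).1
      exact absurd ((hW x hxW).1 (hf x hxW hxb.mem_frontier)) hxb.not_isFacePoint
    · rw [image_eq_zero_of_notMem_tsupport hxs, zero_mul]
  · by_cases hxs : x ∈ tsupport χ
    · have hxW := (hs hxs).1
      by_cases hx : ⟪a, x - p⟫ = 0
      · have hx' := (hW x hxW).1 hx
        have hx2 : x ∈ {x : E3 | ⟪a, x - p⟫ = 0} := hx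
        rw [Set.indicator_of_mem hx'.mem_frontier, Set.indicator_of_mem hx2, hx'.outwardNormal_eq,
          cutDiv_eq hY h.1 hχ hsU]
      · have hx2 : x ∉ {x : E3 | ⟪a, x - p⟫ = 0} := hx
        rw [Set.indicator_of_notMem (fun h' => hx (hf x hxW h')), Set.indicator_of_notMem hx2]
    · have h1 : ∀ n, cutDiv Y χ n x = 0 := fun n => cutDiv_of_notMem_tsupport hxs
      simp [Set.indicator, h1, ← cutDiv_eq hY h.1 hχ hsU]

lemma integrableOn_plane (B : OrthonormalBasis (Fin 3) ℝ E3) (p : E3) {f : E3 → ℝ}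
    (hf : Continuous f) (hc : HasCompactSupport f) :
    IntegrableOn f {x | ⟪B 2, x - p⟫ = 0} μHE[2] := by
  rw [IntegrableOn, ← map_planeMap, (measurableEmbedding_planeMap B p).integrable_map_iff]
  exact (hf.comp (contDiff_planeMap B p).continuous).integrable_of_hasCompactSupport
    (hc.comp_isClosedEmbedding (isClosedEmbedding_planeMap B p))

lemma integrableOn_line (B : OrthonormalBasis (Fin 3) ℝ E3) (p : E3) {f : E3 → ℝ}
    (hf : Continuous f) (hc : HasCompactSupport f) :
    IntegrableOn f {x | ⟪B 1, x - p⟫ = 0 ∧ ⟪B 2, x - p⟫ = 0} μHE[1] := by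
  rw [IntegrableOn, ← map_lineMap, (measurableEmbedding_lineMap B p).integrable_map_iff]
  exact (hf.comp (contDiff_lineMap B p).continuous).integrable_of_hasCompactSupport
    (hc.comp_isClosedEmbedding (isometry_lineMap B p).isClosedEmbedding)

lemma continuous_tangentialDiv {Z : E3 → E3} (hZ : ContDiff ℝ 1 Z) :
    Continuous (tangentialDiv a Z) := by
  have := hZ.continuous_fderiv one_ne_zero
  unfold tangentialDiv
  fun_prop

lemma hasCompactSupport_tangentialDiv {Z : E3 → E3} (hc : HasCompactSupport Z) :
    HasCompactSupport (tangentialDiv a Z) :=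
  (hc.fderiv ℝ).comp_left
    (g := fun T : E3 →L[ℝ] E3 => ∑ i, T (EuclideanSpace.single i 1) i - ⟪T a, a⟫) (by simp)

/-- One face of a wedge contributes the flux through the edge. -/
lemma integral_halfPlane_wedge
    (hY : ∀ a, ‖a‖ = 1 → ContDiffOn ℝ 1 (Y a) upperHalfSpace)
    (ha : ‖a‖ = 1) (hb : ‖b‖ = 1) (hab : ⟪a, b⟫ ^ 2 < 1) (p : E3)
    (hχ : ContDiff ℝ 1 χ) (hc : HasCompactSupport χ) (hs : tsupport χ ⊆ upperHalfSpace) :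
    IntegrableOn (cutDiv Y χ a) ({x | ⟪a, x - p⟫ = 0} ∩ {x | ⟪b, x - p⟫ ≤ 0}) μHE[2] ∧
    IntegrableOn (fun x => χ x * ⟪Y a x, conormal a b⟫)
      {x | ⟪a, x - p⟫ = 0 ∧ ⟪b, x - p⟫ = 0} μHE[1] ∧
    ∫ x in {x | ⟪a, x - p⟫ = 0} ∩ {x | ⟪b, x - p⟫ ≤ 0}, cutDiv Y χ a x ∂μHE[2]
      = ∫ x in {x | ⟪a, x - p⟫ = 0 ∧ ⟪b, x - p⟫ = 0},
          χ x * ⟪Y a x, conormal a b⟫ ∂μHE[1] := by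
  obtain ⟨B, hB1, hB2⟩ := exists_basis_edge ha hb hab
  have hZ := contDiff_cut hY ha hχ hs
  have hZc : HasCompactSupport (fun y => χ y • Y a y) := hc.smul_right
  have hdiv := integral_tangentialDiv_halfPlane B p hZ hZc
  have hset : {x : E3 | ⟪a, x - p⟫ = 0} ∩ {x | ⟪conormal a b, x - p⟫ ≤ 0}
      = {x | ⟪a, x - p⟫ = 0} ∩ {x | ⟪b, x - p⟫ ≤ 0} := by
    ext x
    exact and_congr_right fun h => inner_conormal_nonpos_iff hab h
  have hcd : cutDiv Y χ a = tangentialDiv a (fun y => χ y • Y a y) :=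
    funext fun x => cutDiv_eq hY ha hχ hs x
  have hlin : (fun x => χ x * ⟪Y a x, conormal a b⟫)
      = fun x => ⟪(fun y => χ y • Y a y) x, conormal a b⟫ := by
    funext x; simp only [real_inner_smul_left]
  rw [hB1, hB2, hset, line_eq hab] at hdiv
  rw [hcd, hlin]
  refine ⟨?_, ?_, hdiv⟩
  · have := integrableOn_plane B p (continuous_tangentialDiv (a := a) hZ)
      (hasCompactSupport_tangentialDiv hZc)
    rw [hB2] at this
    exact this.mono_set Set.inter_subset_left
  · have := integrableOn_line B p (f := fun x => ⟪(fun y => χ y • Y a y) x, conormal a b⟫)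
      (hZ.continuous.inner continuous_const)
      (hZc.comp_left (g := fun z => ⟪z, conormal a b⟫) (inner_zero_left _))
    rwa [hB1, hB2, line_eq hab] at this

/-- The divergence theorem for fields supported near a point of a convex edge. -/
lemma IsConvexEdgePoint.exists_divIdentity
    (hY : ∀ a, ‖a‖ = 1 → ContDiffOn ℝ 1 (Y a) upperHalfSpace)
    (hE : ConvexEdges Δ) (hΔp : IsPolyhedron Δ)
    (h : IsConvexEdgePoint Δ p a b) :
    ∃ W, IsOpen W ∧ p ∈ W ∧ ∀ χ : E3 → ℝ, ContDiff ℝ 1 χ → HasCompactSupport χ →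
      tsupport χ ⊆ W → DivIdentity Δ Y χ := by
  obtain ⟨W, hW, hWo, hpW⟩ := eventually_nhds_iff.1 h.eventually_near
  refine ⟨W ∩ upperHalfSpace, hWo.inter isOpen_upperHalfSpace, ⟨hpW, hΔp.subset h.mem⟩,
    fun χ hχ hc hs => ?_⟩
  have hsU := hs.trans Set.inter_subset_right
  have hab := h.inner_sq_lt_one
  have hba : ⟪b, a⟫ ^ 2 < 1 := by rwa [real_inner_comm]
  obtain ⟨ia, ja, ea⟩ := integral_halfPlane_wedge hY h.1 h.2.1 hab p hχ hc hsU
  obtain ⟨ib, jb, eb⟩ := integral_halfPlane_wedge hY h.2.1 h.1 hba p hχ hc hsU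
  have hline : {x : E3 | ⟪b, x - p⟫ = 0 ∧ ⟪a, x - p⟫ = 0}
      = {x | ⟪a, x - p⟫ = 0 ∧ ⟪b, x - p⟫ = 0} := by
    ext x; exact and_comm
  rw [hline] at jb eb
  have hmh : ∀ a b : E3, MeasurableSet ({x : E3 | ⟪a, x - p⟫ = 0} ∩ {x | ⟪b, x - p⟫ ≤ 0}) :=
    fun a b => (measurableSet_plane a p).inter
      (isClosed_le (by fun_prop) continuous_const).measurableSet
  have hml : MeasurableSet {x : E3 | ⟪a, x - p⟫ = 0 ∧ ⟪b, x - p⟫ = 0} :=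
    (measurableSet_plane a p).inter (measurableSet_plane b p)
  have hnull : (μHE[2] : Measure E3) {x | ⟪a, x - p⟫ = 0 ∧ ⟪b, x - p⟫ = 0} = 0 := by
    obtain ⟨B, hB1, hB2⟩ := exists_basis_edge h.1 h.2.1 hab
    have := measure_line_eq_zero B p
    rwa [hB1, hB2, line_eq hab] at this
  -- Off the edge, the boundary is the disjoint union of the two half planes.
  have hL : ∫ x in frontier Δ, cutDiv Y χ (outwardNormal Δ x) x ∂μHE[2]
      = ∫ x in {x | ⟪a, x - p⟫ = 0} ∩ {x | ⟪b, x - p⟫ ≤ 0}, cutDiv Y χ a x ∂μHE[2]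
        + ∫ x in {x | ⟪b, x - p⟫ = 0} ∩ {x | ⟪a, x - p⟫ ≤ 0}, cutDiv Y χ b x ∂μHE[2] := by
    rw [← integral_indicator isClosed_frontier.measurableSet, ← integral_indicator (hmh a b),
      ← integral_indicator (hmh b a), ← integral_add (ia.integrable_indicator (hmh a b))
        (ib.integrable_indicator (hmh b a))]
    refine integral_congr_ae ?_
    filter_upwards [compl_mem_ae_iff.2 hnull] with x hxl
    by_cases hxs : x ∈ tsupport χ
    · have hxW := hW x (hs hxs).1
      have hxl' : ¬ (⟪a, x - p⟫ = 0 ∧ ⟪b, x - p⟫ = 0) := hxl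
      simp only [Set.indicator, Set.mem_inter_iff, Set.mem_ofPred_eq]
      rcases lt_trichotomy ⟪a, x - p⟫ 0 with h1 | h1 | h1 <;>
        rcases lt_trichotomy ⟪b, x - p⟫ 0 with h2 | h2 | h2
      · have : x ∉ frontier Δ := fun hf =>
          (mem_frontier_iff_notMem_nhds.1 hf).1 (hxW.2.2.2.1 h1 h2)
        simp [this, h1.ne, h2.ne]
      · have hf := hxW.2.2.1 h1 h2
        simp [hf.mem_frontier, hf.outwardNormal_eq, h1.ne, h1.le, h2]
      · have : x ∉ frontier Δ := fun hf =>
          (mem_frontier_iff_notMem_nhds.1 hf).2 (hxW.2.2.2.2 (Or.inr h2))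
        simp [this, h1.ne, h2.ne']
      · have hf := hxW.2.1 h1 h2
        simp [hf.mem_frontier, hf.outwardNormal_eq, h1, h2.le, h2.ne]
      · exact absurd ⟨h1, h2⟩ hxl'
      · have : x ∉ frontier Δ := fun hf =>
          (mem_frontier_iff_notMem_nhds.1 hf).2 (hxW.2.2.2.2 (Or.inr h2))
        simp [this, h2.ne', h2.not_ge]
      all_goals
        have : x ∉ frontier Δ := fun hf =>
          (mem_frontier_iff_notMem_nhds.1 hf).2 (hxW.2.2.2.2 (Or.inl h1))
        simp [this, h1.ne', h1.not_ge]
    · have h1 : ∀ n, cutDiv Y χ n x = 0 := fun n => cutDiv_of_notMem_tsupport hxs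
      simp [Set.indicator, h1]
  have hR : ∫ x in edgeSet Δ, χ x * edgeFlux Y (edgeNormals Δ x).1 (edgeNormals Δ x).2 x ∂μHE[1]
      = ∫ x in {x | ⟪a, x - p⟫ = 0 ∧ ⟪b, x - p⟫ = 0}, (χ x * ⟪Y a x, conormal a b⟫
        + χ x * ⟪Y b x, conormal b a⟫) ∂μHE[1] := by
    refine setIntegral_eq_of_indicator (measurableSet_edgeSet hE hΔp) hml
      (Eventually.of_forall fun x => ?_)
    by_cases hxs : x ∈ tsupport χ
    · have hxW := hW x (hs hxs).1
      by_cases hx : ⟪a, x - p⟫ = 0 ∧ ⟪b, x - p⟫ = 0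
      · have hxe := hxW.1 hx.1 hx.2
        have : edgeFlux Y (edgeNormals Δ x).1 (edgeNormals Δ x).2 x = edgeFlux Y a b x := by
          rcases hxe.edgeNormals_eq with h' | h' <;> rw [h']
          exact edgeFlux_symm Y b a x
        have hx2 : x ∈ {x : E3 | ⟪a, x - p⟫ = 0 ∧ ⟪b, x - p⟫ = 0} := hx
        rw [Set.indicator_of_mem hxe.mem_edgeSet, Set.indicator_of_mem hx2, this, edgeFlux, mul_add]
      · have hx2 : x ∉ {x : E3 | ⟪a, x - p⟫ = 0 ∧ ⟪b, x - p⟫ = 0} := hx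
        rw [Set.indicator_of_notMem (fun hxe => ?_), Set.indicator_of_notMem hx2]
        obtain ⟨a', b', hx'⟩ := hE x hxe
        have hxf := mem_frontier_iff_notMem_nhds.1 hx'.mem_frontier
        rcases lt_trichotomy ⟪a, x - p⟫ 0 with h1 | h1 | h1
        · rcases lt_trichotomy ⟪b, x - p⟫ 0 with h2 | h2 | h2
          · exact hxf.1 (hxW.2.2.2.1 h1 h2)
          · exact hx'.not_isFacePoint (hxW.2.2.1 h1 h2)
          · exact hxf.2 (hxW.2.2.2.2 (Or.inr h2))
        · rcases lt_trichotomy ⟪b, x - p⟫ 0 with h2 | h2 | h2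
          · exact hx'.not_isFacePoint (hxW.2.1 h1 h2)
          · exact hx ⟨h1, h2⟩
          · exact hxf.2 (hxW.2.2.2.2 (Or.inr h2))
        · exact hxf.2 (hxW.2.2.2.2 (Or.inl h1))
    · simp [Set.indicator, image_eq_zero_of_notMem_tsupport hxs]
  rw [DivIdentity, hL, hR, ea, eb, integral_add ja jb]

end Local

section Global

variable {Δ : Set E3} {p x a b : E3} {Y : E3 → E3 → E3} {χ : E3 → ℝ}

lemma continuousOn_tangentialDiv {Z : E3 → E3} (hZ : ContDiffOn ℝ 1 Z upperHalfSpace) :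
    ContinuousOn (tangentialDiv a Z) upperHalfSpace := by
  have := hZ.continuousOn_fderiv_of_isOpen isOpen_upperHalfSpace le_rfl
  unfold tangentialDiv
  fun_prop

/-- The hypotheses of the divergence theorem on the family of fields `Y a`, one for each unit normal
`a`: they are `C¹`, and bounded with their divergences on `Δ` uniformly in `a`. -/
structure IsAdmissible (Δ : Set E3) (Y : E3 → E3 → E3) (C : ℝ) : Prop where
  contDiffOn : ∀ a, ‖a‖ = 1 → ContDiffOn ℝ 1 (Y a) upperHalfSpace
  norm_le : ∀ a, ‖a‖ = 1 → ∀ x ∈ Δ, ‖Y a x‖ ≤ C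
  div_le : ∀ a, ‖a‖ = 1 → ∀ x ∈ Δ, |tangentialDiv a (Y a) x| ≤ C

variable {C : ℝ}

lemma norm_sub_inner_smul_le (ha : ‖a‖ = 1) (y : E3) : ‖y - ⟪y, a⟫ • a‖ ≤ 2 * ‖y‖ := by
  have h1 : ‖⟪y, a⟫ • a‖ ≤ ‖y‖ := by
    rw [norm_smul, ha, mul_one]
    simpa [ha] using abs_real_inner_le_norm y a
  linarith [norm_sub_le y (⟪y, a⟫ • a)]

lemma IsAdmissible.continuousOn_cutDiv (hY : IsAdmissible Δ Y C) (ha : ‖a‖ = 1)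
    (hχ : ContDiff ℝ 1 χ) : ContinuousOn (cutDiv Y χ a) upperHalfSpace := by
  have h1 := continuousOn_tangentialDiv (a := a) (hY.contDiffOn a ha)
  have h2 := (hY.contDiffOn a ha).continuousOn
  have h3 := hχ.continuous_fderiv one_ne_zero
  have h4 := hχ.continuous
  unfold cutDiv
  fun_prop

lemma IsAdmissible.abs_cutDiv_le (hY : IsAdmissible Δ Y C) (ha : ‖a‖ = 1) (hx : x ∈ Δ) :
    |cutDiv Y χ a x| ≤ |χ x| * C + ‖fderiv ℝ χ x‖ * (2 * C) := by
  refine (abs_add_le _ _).trans (add_le_add ?_ ?_)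
  · rw [abs_mul]
    exact mul_le_mul_of_nonneg_left (hY.div_le a ha x hx) (abs_nonneg _)
  · refine ((fderiv ℝ χ x).le_opNorm _).trans (mul_le_mul_of_nonneg_left ?_ (norm_nonneg _))
    linarith [norm_sub_inner_smul_le ha (Y a x), hY.norm_le a ha x hx]

lemma IsAdmissible.integrableOn_cutDiv (hY : IsAdmissible Δ Y C) (hΔ : IsPolyhedron Δ)
    (hE : ConvexEdges Δ) (hχ : ContDiff ℝ 1 χ) (hc : HasCompactSupport χ) :
    IntegrableOn (fun x => cutDiv Y χ (outwardNormal Δ x) x) (frontier Δ) μHE[2] := by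
  obtain ⟨C1, hC1⟩ := hc.exists_bound_of_continuous hχ.continuous
  obtain ⟨C2, hC2⟩ := (hc.fderiv ℝ).exists_bound_of_continuous
    (hχ.continuous_fderiv one_ne_zero)
  refine integrableOn_frontier (F := fun a x => cutDiv Y χ a x) (C := C1 * C + C2 * (2 * C)) hΔ hE
    (fun a ha => hY.continuousOn_cutDiv ha hχ) fun a ha x hx => ?_
  have hC : 0 ≤ C := (norm_nonneg _).trans (hY.norm_le a ha x hx)
  refine (hY.abs_cutDiv_le ha hx).trans (add_le_add ?_ ?_)
  · exact mul_le_mul_of_nonneg_right (hC1 x) hC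
  · exact mul_le_mul_of_nonneg_right (hC2 x) (by linarith)

lemma IsAdmissible.abs_edgeFlux_le (hY : IsAdmissible Δ Y C) (h : IsConvexEdgePoint Δ x a b) :
    |edgeFlux Y a b x| ≤ 2 * C := by
  have hab := h.inner_sq_lt_one
  have hba : ⟪b, a⟫ ^ 2 < 1 := by rwa [real_inner_comm]
  have e : ∀ a b : E3, ‖a‖ = 1 → ‖b‖ = 1 → ⟪a, b⟫ ^ 2 < 1 → |⟪Y a x, conormal a b⟫| ≤ C := by
    intro a b ha hb hab
    have := abs_real_inner_le_norm (Y a x) (conormal a b)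
    rw [norm_conormal ha hb hab, mul_one] at this
    exact this.trans (hY.norm_le a ha x h.mem)
  refine (abs_add_le _ _).trans ?_
  linarith [e a b h.1 h.2.1 hab, e b a h.2.1 h.1 hba]

lemma IsAdmissible.integrableOn_edgeFlux (hY : IsAdmissible Δ Y C) (hΔ : IsPolyhedron Δ)
    (hE : ConvexEdges Δ) (hχ : Continuous χ) (hc : HasCompactSupport χ) :
    IntegrableOn (fun x => χ x * edgeFlux Y (edgeNormals Δ x).1 (edgeNormals Δ x).2 x)
      (edgeSet Δ) μHE[1] := by
  obtain ⟨C1, hC1⟩ := hc.exists_bound_of_continuous hχ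
  refine integrableOn_edgeSet (F := fun a b x => χ x * edgeFlux Y a b x) (C := C1 * (2 * C)) hΔ hE
    (fun a b x _ => by rw [edgeFlux_symm]) (fun a b ha hb => ?_) fun a b x h => ?_
  · have h1 := (hY.contDiffOn a ha).continuousOn
    have h2 := (hY.contDiffOn b hb).continuousOn
    unfold edgeFlux
    fun_prop
  · rw [abs_mul]
    exact mul_le_mul (hC1 x) (hY.abs_edgeFlux_le h) (abs_nonneg _) ((norm_nonneg _).trans (hC1 x))

lemma cutDiv_sum {ι : Type*} (s : Finset ι) (f : ι → E3 → ℝ)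
    (hf : ∀ i ∈ s, DifferentiableAt ℝ (f i) x) :
    cutDiv Y (fun y => ∑ i ∈ s, f i y) a x = ∑ i ∈ s, cutDiv Y (f i) a x := by
  simp only [cutDiv]
  rw [fderiv_fun_sum hf, sum_apply, Finset.sum_add_distrib, Finset.sum_mul]

lemma DivIdentity.sum {ι : Type*} (s : Finset ι) (f : ι → E3 → ℝ) (hY : IsAdmissible Δ Y C)
    (hΔ : IsPolyhedron Δ) (hE : ConvexEdges Δ)
    (hf : ∀ i ∈ s, ContDiff ℝ 1 (f i) ∧ HasCompactSupport (f i) ∧ DivIdentity Δ Y (f i)) :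
    DivIdentity Δ Y (fun y => ∑ i ∈ s, f i y) := by
  rw [DivIdentity]
  simp_rw [Finset.sum_mul]
  rw [integral_finsetSum _ fun i hi =>
    hY.integrableOn_edgeFlux hΔ hE (hf i hi).1.continuous (hf i hi).2.1]
  simp_rw [cutDiv_sum s f fun i hi => (hf i hi).1.differentiable one_ne_zero _]
  rw [integral_finsetSum _ fun i hi =>
    hY.integrableOn_cutDiv hΔ hE (hf i hi).1 (hf i hi).2.1]
  exact Finset.sum_congr rfl fun i hi => (hf i hi).2.2

/-- The divergence theorem away from the vertices, by a partition of unity. -/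
lemma divIdentity_of_disjoint_vertices (hY : IsAdmissible Δ Y C) (hΔ : IsPolyhedron Δ)
    (hE : ConvexEdges Δ) (hχ : ContDiff ℝ 1 χ) (hc : HasCompactSupport χ)
    (hd : Disjoint (tsupport χ) (frontier Δ \ (faceSet Δ ∪ edgeSet Δ))) :
    DivIdentity Δ Y χ := by
  have hloc : ∀ x ∈ tsupport χ, ∃ W, IsOpen W ∧ x ∈ W ∧ ∀ χ : E3 → ℝ, ContDiff ℝ 1 χ →
      HasCompactSupport χ → tsupport χ ⊆ W → DivIdentity Δ Y χ := by
    intro x hx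
    by_cases hxf : x ∈ frontier Δ
    · have : x ∈ faceSet Δ ∪ edgeSet Δ := by
        by_contra h
        exact Set.disjoint_left.1 hd hx ⟨hxf, h⟩
      rcases this with ⟨a, h⟩ | h
      · exact h.exists_divIdentity hY.contDiffOn hE hΔ.subset
      · obtain ⟨a, b, h⟩ := hE x h
        exact h.exists_divIdentity hY.contDiffOn hE hΔ
    · refine ⟨(frontier Δ)ᶜ, isClosed_frontier.isOpen_compl, hxf, fun χ _ _ hs => ?_⟩
      exact divIdentity_of_disjoint hE (Set.disjoint_left.2 hs)
  choose! W hWo hxW hW using hloc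
  obtain ⟨t, ht, hcov⟩ := hc.isCompact.elim_nhds_subcover W
    fun x hx => (hWo x hx).mem_nhds (hxW x hx)
  obtain ⟨ρ, hρ⟩ := SmoothPartitionOfUnity.exists_isSubordinate (modelWithCornersSelf ℝ E3)
    (isClosed_tsupport χ) (fun i : t => W i) (fun i => hWo i (ht i i.2))
    (fun x hx => by simpa using hcov hx)
  have hsum : χ = fun x => ∑ i ∈ Finset.univ, ρ i x * χ x := by
    funext x
    by_cases hx : x ∈ tsupport χ
    · have h1 := ρ.sum_eq_one hx
      rw [finsum_eq_sum_of_fintype] at h1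
      rw [← Finset.sum_mul, h1, one_mul]
    · simp [image_eq_zero_of_notMem_tsupport hx]
  rw [hsum]
  refine DivIdentity.sum Finset.univ (fun i x => ρ i x * χ x) hY hΔ hE fun i _ => ?_
  have h1 : ContDiff ℝ 1 fun x => ρ i x * χ x :=
    ((ρ i).contMDiff.contDiff.of_le (by simp)).mul hχ
  have h2 : HasCompactSupport fun x => ρ i x * χ x := hc.mul_left
  refine ⟨h1, h2, hW i (ht i i.2) _ h1 h2 ?_⟩
  exact (tsupport_mul_subset_left).trans (hρ i)

/-- Isolated points can be removed from the support of the cutoff: the gradient of a cutoff at scale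
`ε` is of size `1/ε`, on a piece of the boundary of area `O(ε²)`. -/
lemma divIdentity_remove_point (hY : IsAdmissible Δ Y C) (hΔ : IsPolyhedron Δ)
    (hE : ConvexEdges Δ) (hχ : ContDiff ℝ 1 χ) (hc : HasCompactSupport χ) (v : E3)
    (h : ∀ η : E3 → ℝ, ContDiff ℝ 1 η → (∀ᶠ x in 𝓝 v, η x = 0) →
      DivIdentity Δ Y (fun x => η x * χ x)) :
    DivIdentity Δ Y χ := by
  -- `η n` vanishes near `v`, equals one outside the ball of radius `2 / (n + 1)`, and has a
  -- gradient of size `O(n)`.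
  let f : ContDiffBump (0 : E3) := ⟨1, 2, one_pos, by norm_num⟩
  let N : ℕ → ℝ := fun n => n + 1
  have hN : ∀ n, 0 < N n := fun n => by positivity
  let η : ℕ → E3 → ℝ := fun n x => 1 - f (N n • (x - v))
  have hη : ∀ n, ContDiff ℝ 1 (η n) := fun n => by
    have : ContDiff ℝ 1 f := f.contDiff
    fun_prop
  have hη01 : ∀ n x, 0 ≤ η n x ∧ η n x ≤ 1 := fun n x =>
    ⟨by simp only [η]; linarith [f.le_one (x := N n • (x - v))],
      by simp only [η]; linarith [f.nonneg (x := N n • (x - v))]⟩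
  have hη1 : ∀ n x, 2 ≤ N n * ‖x - v‖ → η n x = 1 := fun n x hx => by
    have : f (N n • (x - v)) = 0 := f.zero_of_le_dist (by
      simpa [norm_smul, abs_of_pos (hN n)] using hx)
    simp [η, this]
  have hηlim : ∀ x, x ≠ v → Tendsto (fun n => η n x) atTop (𝓝 1) := fun x hx => by
    refine tendsto_const_nhds.congr' ?_
    obtain ⟨n0, hn0⟩ := exists_nat_ge (2 / ‖x - v‖)
    filter_upwards [eventually_ge_atTop n0] with n hn
    have hpos : 0 < ‖x - v‖ := norm_pos_iff.2 (sub_ne_zero.2 hx)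
    refine (hη1 n x ?_).symm
    rw [div_le_iff₀ hpos] at hn0
    have : (n0 : ℝ) ≤ N n := by
      have : (n0 : ℝ) ≤ n := by exact_mod_cast hn
      simp only [N]; linarith
    nlinarith
  have hη0 : ∀ n, ∀ᶠ x in 𝓝 v, η n x = 0 := fun n => by
    have hcont : Tendsto (fun x : E3 => N n • (x - v)) (𝓝 v) (𝓝 0) := by
      have : Continuous fun x : E3 => N n • (x - v) := by fun_prop
      simpa using this.tendsto v
    filter_upwards [hcont.eventually f.eventuallyEq_one] with x hx
    simp [η, hx]
  obtain ⟨L, hL⟩ := (f.hasCompactSupport.fderiv ℝ).exists_bound_of_continuous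
    ((f.contDiff (n := 1)).continuous_fderiv one_ne_zero)
  have hηd : ∀ n x, ‖fderiv ℝ (η n) x‖ ≤ L * N n := fun n x => by
    have h1 : HasFDerivAt (fun x : E3 => N n • (x - v)) (N n • ContinuousLinearMap.id ℝ E3) x :=
      ((hasFDerivAt_id x).sub_const v).const_smul (N n)
    have h2 : HasFDerivAt (η n) (-(fderiv ℝ f (N n • (x - v))).comp
        (N n • ContinuousLinearMap.id ℝ E3)) x :=
      (((f.contDiff (n := 1)).differentiable one_ne_zero _).hasFDerivAt.comp x h1).const_sub 1
    rw [h2.fderiv, norm_neg, ContinuousLinearMap.comp_smul, norm_smul, Real.norm_eq_abs,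
      abs_of_pos (hN n), ContinuousLinearMap.comp_id, mul_comm]
    exact mul_le_mul_of_nonneg_right (hL _) (hN n).le
  have hid := fun n => h (η n) (hη n) (hη0 n)
  obtain ⟨C1, hC1⟩ := hc.exists_bound_of_continuous hχ.continuous
  have hC1' : 0 ≤ C1 := (norm_nonneg _).trans (hC1 0)
  have hL' : 0 ≤ L := (norm_nonneg _).trans (hL 0)
  -- The product rule separates the two contributions of the cutoff.
  have hprod : ∀ n a x, cutDiv Y (fun x => η n x * χ x) a x
      = η n x * cutDiv Y χ a x + χ x * fderiv ℝ (η n) x (Y a x - ⟪Y a x, a⟫ • a) := fun n a x => by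
    simp only [cutDiv]
    rw [fderiv_fun_mul ((hη n).differentiable one_ne_zero x) (hχ.differentiable one_ne_zero x)]
    simp
    ring
  have hint := hY.integrableOn_cutDiv hΔ hE hχ hc
  have hint' : ∀ n, IntegrableOn (fun x => η n x * cutDiv Y χ (outwardNormal Δ x) x)
      (frontier Δ) μHE[2] := fun n =>
    hint.bdd_mul (c := 1) (hη n).continuous.aestronglyMeasurable
      (Eventually.of_forall fun x => by
        rw [Real.norm_eq_abs, abs_of_nonneg (hη01 n x).1]; exact (hη01 n x).2)
  have hint2 : ∀ n, IntegrableOn (fun x => χ x * fderiv ℝ (η n) x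
      (Y (outwardNormal Δ x) x - ⟪Y (outwardNormal Δ x) x, outwardNormal Δ x⟫ • outwardNormal Δ x))
      (frontier Δ) μHE[2] := fun n => by
    have := (hY.integrableOn_cutDiv hΔ hE ((hη n).mul hχ) hc.mul_left).sub (hint' n)
    refine this.congr (Eventually.of_forall fun x => ?_)
    simp [hprod]
  have lim1 : Tendsto (fun n => ∫ x in frontier Δ, η n x * cutDiv Y χ (outwardNormal Δ x) x ∂μHE[2])
      atTop (𝓝 (∫ x in frontier Δ, cutDiv Y χ (outwardNormal Δ x) x ∂μHE[2])) := by
    refine tendsto_integral_of_dominated_convergence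
      (fun x => |cutDiv Y χ (outwardNormal Δ x) x|) (fun n => (hint' n).aestronglyMeasurable)
      hint.abs (fun n => Eventually.of_forall fun x => ?_) ?_
    · rw [norm_mul, Real.norm_eq_abs, abs_of_nonneg (hη01 n x).1]
      exact mul_le_of_le_one_left (abs_nonneg _) (hη01 n x).2
    · have hv : ∀ᵐ x ∂(μHE[2] : Measure E3), x ≠ v :=
        compl_mem_ae_iff.2 (measure_singleton_eq_zero v)
      filter_upwards [ae_restrict_of_ae hv] with x hx
      simpa using (hηlim x hx).mul_const (cutDiv Y χ (outwardNormal Δ x) x)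
  -- A gradient of size `O(n)` is integrated over a set of area `O(1 / n ^ 2)`.
  have lim2 : Tendsto (fun n => ∫ x in frontier Δ, χ x * fderiv ℝ (η n) x
      (Y (outwardNormal Δ x) x - ⟪Y (outwardNormal Δ x) x, outwardNormal Δ x⟫ • outwardNormal Δ x)
      ∂μHE[2]) atTop (𝓝 0) := by
    obtain ⟨A, hA, hball⟩ := exists_measure_frontier_inter_ball_le hΔ
    have hC0 : 0 ≤ C := by
      obtain ⟨x, hx⟩ := hΔ.nonempty
      have h1 : ‖(EuclideanSpace.single 0 1 : E3)‖ = 1 := by simp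
      exact (norm_nonneg _).trans (hY.norm_le _ h1 x hx)
    have hbound : ∀ n, ‖∫ x in frontier Δ, χ x * fderiv ℝ (η n) x
        (Y (outwardNormal Δ x) x - ⟪Y (outwardNormal Δ x) x, outwardNormal Δ x⟫ • outwardNormal Δ x)
        ∂μHE[2]‖ ≤ (C1 * (L * (2 * C)) * (A * 4)) * (1 / ((n : ℝ) + 1)) := fun n => by
      rw [setIntegral_eq_of_subset_of_forall_sdiff_eq_zero isClosed_frontier.measurableSet
        (Set.inter_subset_left (t := Metric.closedBall v (2 / N n)))]
      · have hm := hball v (2 / N n) (by have := hN n; positivity)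
        have hae : ∀ᵐ x ∂(μHE[2] : Measure E3), x ∈ frontier Δ ∩ Metric.closedBall v (2 / N n) →
            ‖χ x * fderiv ℝ (η n) x (Y (outwardNormal Δ x) x
              - ⟪Y (outwardNormal Δ x) x, outwardNormal Δ x⟫ • outwardNormal Δ x)‖
              ≤ C1 * (L * N n * (2 * C)) := by
          filter_upwards [compl_mem_ae_iff.2 (measure_frontier_diff_faceSet hΔ hE)] with x hx hxf
          have hxF : x ∈ faceSet Δ := by
            by_contra h'
            exact hx ⟨hxf.1, h'⟩
          obtain ⟨a, hxa⟩ := hxF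
          rw [hxa.outwardNormal_eq, norm_mul]
          refine mul_le_mul (hC1 x) ?_ (norm_nonneg _) hC1'
          refine ((fderiv ℝ (η n) x).le_opNorm _).trans (mul_le_mul (hηd n x) ?_ (norm_nonneg _)
            (mul_nonneg hL' (hN n).le))
          linarith [norm_sub_inner_smul_le hxa.1 (Y a x), hY.norm_le a hxa.1 x hxa.mem]
        refine (norm_setIntegral_le_of_norm_le_const_ae' (hm.trans_lt ENNReal.ofReal_lt_top)
          hae).trans ?_
        have hreal : (μHE[2] : Measure E3).real (frontier Δ ∩ Metric.closedBall v (2 / N n))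
            ≤ A * (2 / N n) ^ 2 :=
          ENNReal.toReal_le_of_le_ofReal (by positivity) hm
        have hpos := hN n
        calc C1 * (L * N n * (2 * C)) *
              (μHE[2] : Measure E3).real (frontier Δ ∩ Metric.closedBall v (2 / N n))
            ≤ C1 * (L * N n * (2 * C)) * (A * (2 / N n) ^ 2) :=
              mul_le_mul_of_nonneg_left hreal (by positivity)
          _ = (C1 * (L * (2 * C)) * (A * 4)) * (1 / N n) := by field_simp; ring
      · rintro x ⟨hxf, hxb⟩
        have hxv : 2 / N n < ‖x - v‖ := by
          by_contra hle
          exact hxb ⟨hxf, by simpa [dist_eq_norm] using hle⟩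
        have hcont : Continuous fun y : E3 => ‖y - v‖ := by fun_prop
        have : η n =ᶠ[𝓝 x] fun _ => 1 := by
          filter_upwards [continuousAt_const.eventually_lt hcont.continuousAt hxv] with y hy
          refine hη1 n y ?_
          rw [div_lt_iff₀ (hN n)] at hy
          linarith
        simp [this.fderiv_eq]
    refine squeeze_zero_norm hbound ?_
    simpa using tendsto_one_div_add_atTop_nhds_zero_nat.const_mul (C1 * (L * (2 * C)) * (A * 4))
  have hedge := hY.integrableOn_edgeFlux hΔ hE hχ.continuous hc
  have lim3 : Tendsto (fun n => ∫ x in edgeSet Δ, η n x * χ x *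
      edgeFlux Y (edgeNormals Δ x).1 (edgeNormals Δ x).2 x ∂μHE[1]) atTop
      (𝓝 (∫ x in edgeSet Δ, χ x * edgeFlux Y (edgeNormals Δ x).1 (edgeNormals Δ x).2 x
        ∂μHE[1])) := by
    refine tendsto_integral_of_dominated_convergence
      (fun x => |χ x * edgeFlux Y (edgeNormals Δ x).1 (edgeNormals Δ x).2 x|)
      (fun n => ?_) hedge.abs (fun n => Eventually.of_forall fun x => ?_) ?_
    · simp_rw [mul_assoc]
      exact (hη n).continuous.aestronglyMeasurable.mul hedge.aestronglyMeasurable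
    · rw [mul_assoc, norm_mul, Real.norm_eq_abs, abs_of_nonneg (hη01 n x).1]
      exact mul_le_of_le_one_left (abs_nonneg _) (hη01 n x).2
    · have hv : ∀ᵐ x ∂(μHE[1] : Measure E3), x ≠ v := by
        refine compl_mem_ae_iff.2 ?_
        have h1 := map_lineMap (EuclideanSpace.basisFun (Fin 3) ℝ) v
        have h2 : (μHE[1] : Measure E3) ({v} ∩
            {x | ⟪(EuclideanSpace.basisFun (Fin 3) ℝ) 1, x - v⟫ = 0
            ∧ ⟪(EuclideanSpace.basisFun (Fin 3) ℝ) 2, x - v⟫ = 0}) = 0 := by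
          rw [← Measure.restrict_apply (measurableSet_singleton v), ← h1,
            Measure.map_apply (contDiff_lineMap _ v).continuous.measurable
              (measurableSet_singleton v)]
          refine (Set.Subsingleton.measure_zero ?_ _)
          intro s hs t ht
          exact (isometry_lineMap (EuclideanSpace.basisFun (Fin 3) ℝ) v).injective
            ((Set.mem_singleton_iff.1 hs).trans (Set.mem_singleton_iff.1 ht).symm)
        rwa [Set.inter_eq_left.2 (by rintro x rfl; simp)] at h2
      filter_upwards [ae_restrict_of_ae hv] with x hx
      simpa using ((hηlim x hx).mul_const (χ x)).mul_const
        (edgeFlux Y (edgeNormals Δ x).1 (edgeNormals Δ x).2 x)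
  have lim12 := lim1.add lim2
  rw [add_zero] at lim12
  refine tendsto_nhds_unique (lim12.congr fun n => ?_) lim3
  rw [← hid n, ← integral_add (hint' n) (hint2 n)]
  simp_rw [hprod]

/-- The divergence theorem on the boundary of a polyhedron with convex edges: the integral of the
tangential divergences over the faces equals the flux through the edges. -/
theorem integral_tangentialDiv_frontier (hY : IsAdmissible Δ Y C) (hΔ : IsPolyhedron Δ)
    (hE : ConvexEdges Δ) :
    ∫ x in frontier Δ, tangentialDiv (outwardNormal Δ x) (Y (outwardNormal Δ x)) x ∂μHE[2]
      = ∫ x in edgeSet Δ, edgeFlux Y (edgeNormals Δ x).1 (edgeNormals Δ x).2 x ∂μHE[1] := by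
  have key : ∀ S : Set E3, S.Finite → (∀ χ : E3 → ℝ, ContDiff ℝ 1 χ → HasCompactSupport χ →
      Disjoint (tsupport χ) S → DivIdentity Δ Y χ) →
      ∀ χ : E3 → ℝ, ContDiff ℝ 1 χ → HasCompactSupport χ → DivIdentity Δ Y χ := by
    intro S hS
    induction S, hS using Set.Finite.induction_on with
    | empty => exact fun h χ h1 h2 => h χ h1 h2 (Set.disjoint_empty _)
    | @insert v S _ _ ih =>
      intro h
      refine ih fun χ h1 h2 h3 => ?_
      refine divIdentity_remove_point hY hΔ hE h1 h2 v fun η hη hη0 => ?_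
      refine h _ (hη.mul h1) h2.mul_left ?_
      refine Set.disjoint_insert_right.2 ⟨?_, h3.mono_left tsupport_mul_subset_right⟩
      rw [notMem_tsupport_iff_eventuallyEq]
      filter_upwards [hη0] with x hx
      simp [hx]
  obtain ⟨R, hR⟩ := hΔ.isCompact.isBounded.subset_ball (0 : E3)
  let f : ContDiffBump (0 : E3) := ⟨max R 1, max R 1 + 1, by positivity, by linarith⟩
  have hf : ∀ x ∈ Δ, f =ᶠ[𝓝 x] 1 := fun x hx =>
    f.eventuallyEq_one_of_mem_ball (Metric.ball_subset_ball (le_max_left _ _) (hR hx))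
  have hid := key _ hΔ.vertices (fun χ h1 h2 h3 =>
    divIdentity_of_disjoint_vertices hY hΔ hE h1 h2 h3)
    f f.contDiff f.hasCompactSupport
  rw [DivIdentity] at hid
  rw [setIntegral_congr_fun isClosed_frontier.measurableSet (g := fun x =>
      tangentialDiv (outwardNormal Δ x) (Y (outwardNormal Δ x)) x) fun x hx => ?_,
    setIntegral_congr_fun (measurableSet_edgeSet hE hΔ) (g := fun x =>
      edgeFlux Y (edgeNormals Δ x).1 (edgeNormals Δ x).2 x) fun x hx => ?_] at hid
  · exact hid
  · have := (hf x (hΔ.isCompact.isClosed.frontier_subset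
      (edgeSet_subset_frontier hE hx))).eq_of_nhds
    simp [this]
  · have h1 := hf x (hΔ.isCompact.isClosed.frontier_subset hx)
    have h2 : fderiv ℝ f x = 0 := by rw [h1.fderiv_eq]; exact fderiv_const_apply 1
    simp [cutDiv, h1.eq_of_nhds, h2]

end Global

/-! ### The hyperbolic metric and the orthonormal frame `x^3 ∂_i` -/

lemma hasFDerivAt_coord (i : Fin 3) (x : E3) :
    HasFDerivAt (fun y : E3 => y i) (EuclideanSpace.proj i : E3 →L[ℝ] ℝ) x :=
  (EuclideanSpace.proj i : E3 →L[ℝ] ℝ).hasFDerivAt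

lemma hypMetric_apply (x : E3) (i j : Fin 3) :
    hypMetric x i j = (x 2 ^ 2)⁻¹ * if i = j then 1 else 0 := by
  simp [hypMetric, Matrix.one_apply]

lemma hypMetric_inv {x : E3} (hx : x ∈ upperHalfSpace) :
    (hypMetric x)⁻¹ = (x 2 ^ 2) • (1 : Matrix (Fin 3) (Fin 3) ℝ) := by
  have hz : (0 : ℝ) < x 2 := hx
  refine Matrix.inv_eq_left_inv ?_
  rw [hypMetric, Matrix.smul_mul, Matrix.mul_smul, smul_smul, mul_inv_cancel₀ (by positivity)]
  simp

lemma hypMetric_inv_apply {x : E3} (hx : x ∈ upperHalfSpace) (i j : Fin 3) :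
    (hypMetric x)⁻¹ i j = x 2 ^ 2 * if i = j then 1 else 0 := by
  simp [hypMetric_inv hx, Matrix.one_apply]

lemma hasFDerivAt_hypMetric {x : E3} (hx : x ∈ upperHalfSpace) (i j : Fin 3) :
    HasFDerivAt (fun y => hypMetric y i j)
      ((-(2 * (x 2 ^ 3)⁻¹) * if i = j then 1 else 0) • (EuclideanSpace.proj 2 : E3 →L[ℝ] ℝ)) x := by
  have hz : (0 : ℝ) < x 2 := hx
  have h1 : HasDerivAt (fun t : ℝ => (t ^ 2)⁻¹ * if i = j then (1 : ℝ) else 0)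
      (-(2 * (x 2 ^ 3)⁻¹) * if i = j then 1 else 0) (x 2) := by
    refine HasDerivAt.mul_const ?_ _
    refine (((hasDerivAt_id (x 2)).pow 2).inv (by simpa using hz.ne')).congr_deriv ?_
    simp
    field_simp
  have h2 := h1.comp_hasFDerivAt x (hasFDerivAt_coord 2 x)
  refine h2.congr_of_eventuallyEq (Eventually.of_forall fun y => ?_)
  simp [hypMetric_apply]

lemma pd_hypMetric {x : E3} (hx : x ∈ upperHalfSpace) (k i j : Fin 3) :
    pd k (fun y => hypMetric y i j) x
      = -(2 * (x 2 ^ 3)⁻¹) * (if i = j then 1 else 0) * if k = 2 then 1 else 0 := by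
  rw [pd, (hasFDerivAt_hypMetric hx i j).fderiv]
  have h1 : (EuclideanSpace.proj 2 : E3 →L[ℝ] ℝ) (EuclideanSpace.single k 1)
      = if k = 2 then 1 else 0 := by
    by_cases hk : k = 2
    · simp [hk]
    · simp [hk, Ne.symm hk]
  rw [smul_apply, h1, smul_eq_mul]

/-- A Riemannian metric of class `C²` on the half space: `Matrix.PosDef` includes the symmetry. -/
structure IsMetric (g : MetricField) : Prop where
  contDiffOn : ∀ i j, ContDiffOn ℝ 2 (fun x => g x i j) upperHalfSpace
  posDef : ∀ x ∈ upperHalfSpace, (g x).PosDef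

lemma IsAsymptoticallyHyperbolic.isMetric {τ : ℝ} {g : MetricField}
    (hg : IsAsymptoticallyHyperbolic τ g) : IsMetric g := ⟨hg.contDiffOn, hg.posDef⟩

lemma isMetric_hypMetric : IsMetric hypMetric := by
  refine ⟨fun i j x hx => ?_, fun x hx => ?_⟩
  · have hz : (0 : ℝ) < x 2 := hx
    simp only [hypMetric_apply]
    have hc : ContDiffWithinAt ℝ 2 (fun y : E3 => y 2) upperHalfSpace x := by fun_prop
    exact ((hc.pow 2).inv (by positivity)).mul contDiffWithinAt_const
  · have hz : (0 : ℝ) < x 2 := hx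
    exact Matrix.PosDef.one.smul (by positivity)

namespace IsMetric

variable {g : MetricField} (hg : IsMetric g) {x : E3}

lemma differentiableAt (hg : IsMetric g) (hx : x ∈ upperHalfSpace) (i j : Fin 3) :
    DifferentiableAt ℝ (fun y => g y i j) x :=
  ((hg.contDiffOn i j).contDiffAt (isOpen_upperHalfSpace.mem_nhds hx)).differentiableAt two_ne_zero

lemma symm (hg : IsMetric g) (hx : x ∈ upperHalfSpace) (i j : Fin 3) : g x i j = g x j i := by
  simpa using (hg.posDef x hx).isHermitian.apply j i

lemma pd_symm (hg : IsMetric g) (hx : x ∈ upperHalfSpace) (k i j : Fin 3) :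
    pd k (fun y => g y i j) x = pd k (fun y => g y j i) x := by
  have : (fun y => g y i j) =ᶠ[𝓝 x] fun y => g y j i := by
    filter_upwards [isOpen_upperHalfSpace.mem_nhds hx] with y hy
    exact hg.symm hy i j
  rw [pd, pd, this.fderiv_eq]

lemma isUnit_det (hg : IsMetric g) (hx : x ∈ upperHalfSpace) : IsUnit (g x).det :=
  (hg.posDef x hx).det_pos.ne'.isUnit

lemma sum_mul_inv (hg : IsMetric g) (hx : x ∈ upperHalfSpace) (i j : Fin 3) :
    ∑ k, g x i k * (g x)⁻¹ k j = if i = j then 1 else 0 := by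
  rw [← Matrix.mul_apply, Matrix.mul_nonsing_inv _ (hg.isUnit_det hx), Matrix.one_apply]

lemma sum_inv_mul (hg : IsMetric g) (hx : x ∈ upperHalfSpace) (i j : Fin 3) :
    ∑ k, (g x)⁻¹ i k * g x k j = if i = j then 1 else 0 := by
  rw [← Matrix.mul_apply, Matrix.nonsing_inv_mul _ (hg.isUnit_det hx), Matrix.one_apply]

lemma inv_symm (hg : IsMetric g) (hx : x ∈ upperHalfSpace) (i j : Fin 3) :
    (g x)⁻¹ i j = (g x)⁻¹ j i := by
  simpa using (hg.posDef x hx).inv.isHermitian.apply j i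

lemma differentiableAt_inv (hg : IsMetric g) (hx : x ∈ upperHalfSpace) (i j : Fin 3) :
    DifferentiableAt ℝ (fun y => (g y)⁻¹ i j) x := by
  have hd := fun i j => hg.differentiableAt hx i j
  have hdet : DifferentiableAt ℝ (fun y => (g y).det) x := by
    simp only [Matrix.det_fin_three]
    fun_prop
  have hadj : DifferentiableAt ℝ (fun y => (g y).adjugate i j) x := by
    simp only [Matrix.adjugate_fin_three]
    fin_cases i <;> fin_cases j <;> simp <;> fun_prop
  have : (fun y => (g y)⁻¹ i j) = fun y => ((g y).det)⁻¹ * (g y).adjugate i j := by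
    funext y
    simp [Matrix.inv_def]
  rw [this]
  exact (hdet.inv (hg.isUnit_det hx).ne_zero).mul hadj

lemma continuousOn (hg : IsMetric g) (i j : Fin 3) :
    ContinuousOn (fun y => g y i j) upperHalfSpace := (hg.contDiffOn i j).continuousOn

lemma continuousOn_inv (hg : IsMetric g) (i j : Fin 3) :
    ContinuousOn (fun y => (g y)⁻¹ i j) upperHalfSpace := fun _ hx =>
  (hg.differentiableAt_inv hx i j).continuousAt.continuousWithinAt

lemma continuousOn_pd (hg : IsMetric g) (k i j : Fin 3) :
    ContinuousOn (pd k fun y => g y i j) upperHalfSpace := by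
  have := (hg.contDiffOn i j).continuousOn_fderiv_of_isOpen isOpen_upperHalfSpace (by norm_num)
  unfold pd
  fun_prop

end IsMetric

/-- The components of `e = g - ḡ` in the `ḡ`-orthonormal frame `x^3 ∂_i`. -/
def frameDev (g : MetricField) (x : E3) (i j : Fin 3) : ℝ :=
  x 2 ^ 2 * g x i j - if i = j then 1 else 0

/-- The derivatives of the frame components `frameDev g x i j` in the directions of the frame. -/
def frameDer (g : MetricField) (x : E3) (k i j : Fin 3) : ℝ :=
  x 2 ^ 3 * pd k (fun y => g y i j) x + 2 * x 2 ^ 2 * (if k = 2 then 1 else 0) * g x i j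

lemma deviation_eq {g : MetricField} {x : E3} (hx : x ∈ upperHalfSpace) (I : Fin 2 → Fin 3) :
    deviation g x I = (x 2 ^ 2)⁻¹ * frameDev g x (I 0) (I 1) := by
  have hz : (0 : ℝ) < x 2 := hx
  rw [deviation, hypMetric_apply, frameDev]
  field_simp

lemma christoffel_hypMetric {x : E3} (hx : x ∈ upperHalfSpace) (k i j : Fin 3) :
    christoffel hypMetric x k i j = -(x 2)⁻¹ * ((if i = 2 then 1 else 0) * (if j = k then 1 else 0)
      + (if j = 2 then 1 else 0) * (if i = k then 1 else 0)
      - (if k = 2 then 1 else 0) * (if i = j then 1 else 0)) := by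
  have hz : (0 : ℝ) < x 2 := hx
  simp only [christoffel, hypMetric_inv_apply hx, pd_hypMetric hx]
  simp only [mul_ite, ite_mul, mul_one, mul_zero, zero_mul, Finset.sum_ite_eq, Finset.mem_univ,
    if_true]
  split_ifs <;> (try field_simp) <;> norm_num

/-- The covariant derivative of the deviation in the orthonormal frame. -/
lemma covDeriv_deviation {g : MetricField} (hg : IsMetric g) {x : E3} (hx : x ∈ upperHalfSpace)
    (k i j : Fin 3) :
    x 2 ^ 3 * covDeriv hypMetric (deviation g) x ![k, i, j] = frameDer g x k i j
      + (if i = 2 then 1 else 0) * frameDev g x k j - (if k = i then 1 else 0) * frameDev g x 2 j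
      + (if j = 2 then 1 else 0) * frameDev g x i k
      - (if k = j then 1 else 0) * frameDev g x i 2 := by
  have hz : (0 : ℝ) < x 2 := hx
  have ht : Fin.tail ![k, i, j] = ![i, j] := rfl
  have h1 : pd k (fun y => deviation g y ![i, j]) x
      = pd k (fun y => g y i j) x - pd k (fun y => hypMetric y i j) x := by
    have : HasFDerivAt (fun y => deviation g y ![i, j]) _ x :=
      (hg.differentiableAt hx i j).hasFDerivAt.sub
        (isMetric_hypMetric.differentiableAt hx i j).hasFDerivAt
    rw [pd, this.fderiv]
    rfl
  have h2 : ∀ m, deviation g x (Function.update ![i, j] 0 m)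
      = (x 2 ^ 2)⁻¹ * frameDev g x m j := fun m => by
    rw [deviation_eq hx]; simp
  have h3 : ∀ m, deviation g x (Function.update ![i, j] 1 m)
      = (x 2 ^ 2)⁻¹ * frameDev g x i m := fun m => by
    rw [deviation_eq hx]; simp
  rw [covDeriv, ht]
  simp only [Matrix.cons_val_zero, h1, Fin.sum_univ_two, h2, h3, pd_hypMetric hx,
    christoffel_hypMetric hx]
  have e0 : (![k, i, j] : Fin 3 → Fin 3) (Fin.succ 0) = i := rfl
  have e1 : (![k, i, j] : Fin 3 → Fin 3) (Fin.succ 1) = j := rfl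
  simp only [e0, e1, frameDer]
  have key : ∀ (l : Fin 3) (f : Fin 3 → ℝ), ∑ m, -(x 2)⁻¹ * ((if k = 2 then 1 else 0) *
      (if l = m then 1 else 0) + (if l = 2 then 1 else 0) * (if k = m then 1 else 0)
      - (if m = 2 then 1 else 0) * (if k = l then 1 else 0)) * ((x 2 ^ 2)⁻¹ * f m)
      = -(x 2 ^ 3)⁻¹ * ((if k = 2 then 1 else 0) * f l + (if l = 2 then 1 else 0) * f k
        - (if k = l then 1 else 0) * f 2) := by
    intro l f
    have a1 : ∀ m, -(x 2)⁻¹ * ((if k = 2 then 1 else 0) *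
      (if l = m then 1 else 0) + (if l = 2 then 1 else 0) * (if k = m then 1 else 0)
      - (if m = 2 then 1 else 0) * (if k = l then 1 else 0)) * ((x 2 ^ 2)⁻¹ * f m)
      = -(x 2 ^ 3)⁻¹ * ((if k = 2 then 1 else 0) * (if l = m then f m else 0)
        + (if l = 2 then 1 else 0) * (if k = m then f m else 0)
        - (if k = l then 1 else 0) * (if m = 2 then f m else 0)) := by
      intro m
      have : (x 2 ^ 3)⁻¹ = (x 2)⁻¹ * (x 2 ^ 2)⁻¹ := by field_simp
      rw [this]
      split_ifs <;> ring
    simp only [a1, ← Finset.mul_sum, Finset.sum_sub_distrib, Finset.sum_add_distrib,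
      Finset.sum_ite_eq, Finset.sum_ite_eq', Finset.mem_univ, if_true]
  rw [key i fun m => frameDev g x m j, key j fun m => frameDev g x i m]
  have hg2 : x 2 ^ 2 * g x i j = frameDev g x i j + if i = j then 1 else 0 := by
    rw [frameDev]; ring
  have : 2 * x 2 ^ 2 * (if k = 2 then 1 else 0) * g x i j
      = 2 * (if k = 2 then 1 else 0) * (frameDev g x i j + if i = j then 1 else 0) := by
    rw [← hg2]; ring
  rw [this]
  generalize frameDev g x i j = e1
  field_simp
  ring

lemma le_tensorNorm {k : ℕ} {x : E3} (hx : x ∈ upperHalfSpace) (T : (Fin k → Fin 3) → ℝ)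
    (I : Fin k → Fin 3) : x 2 ^ k * |T I| ≤ tensorNorm hypMetric x T := by
  have hz : (0 : ℝ) < x 2 := hx
  have h1 : ∀ I J : Fin k → Fin 3, (∏ s, (hypMetric x)⁻¹ (I s) (J s)) * T I * T J
      = if I = J then (x 2 ^ k * T I) ^ 2 else 0 := by
    intro I J
    simp only [hypMetric_inv_apply hx]
    split_ifs with h
    · subst h
      simp
      ring
    · obtain ⟨s, hs⟩ := Function.ne_iff.1 h
      rw [Finset.prod_eq_zero (Finset.mem_univ s) (by simp [hs])]
      ring
  simp only [tensorNorm, h1, Finset.sum_ite_eq, Finset.mem_univ, if_true]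
  refine Real.le_sqrt_of_sq_le ?_
  have h2 : (x 2 ^ k * |T I|) ^ 2 = (x 2 ^ k * T I) ^ 2 := by rw [mul_pow, mul_pow, sq_abs]
  rw [h2]
  exact Finset.single_le_sum (f := fun I => (x 2 ^ k * T I) ^ 2) (fun I _ => sq_nonneg _)
    (Finset.mem_univ I)

/-! ### Decay at infinity and uniform bounds -/

lemma isBigO_sum {α : Type*} {l : Filter α} {A : Fin 3 → α → ℝ} {f : α → ℝ}
    (h : ∀ k, A k =O[l] f) : (fun x => ∑ k, A k x) =O[l] f := IsBigO.fun_sum fun k _ => h k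

lemma cosh_rad {x : E3} (hx : x ∈ upperHalfSpace) :
    Real.cosh (rad x) = 1 + ‖x - basePoint‖ ^ 2 / (2 * x 2) := by
  have hz : (0 : ℝ) < x 2 := hx
  have hb : basePoint 2 = 1 := by simp [basePoint]
  rw [rad, hypDist, hb, mul_one, Real.cosh_arcosh]
  have : 0 ≤ ‖x - basePoint‖ ^ 2 / (2 * x 2) := by positivity
  linarith

lemma rad_nonneg {x : E3} (hx : x ∈ upperHalfSpace) : 0 ≤ rad x := by
  have hz : (0 : ℝ) < x 2 := hx
  have hb : basePoint 2 = 1 := by simp [basePoint]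
  rw [rad, hypDist, hb, mul_one]
  refine Real.arcosh_nonneg ?_
  have : 0 ≤ ‖x - basePoint‖ ^ 2 / (2 * x 2) := by positivity
  linarith

lemma abs_coord_sub_le (x : E3) : |x 2 - 1| ≤ ‖x - basePoint‖ := by
  have h := PiLp.norm_apply_le (x - basePoint) 2
  simpa [basePoint] using h

lemma potential_le {x : E3} (hx : x ∈ upperHalfSpace) : potential x ≤ 2 * Real.cosh (rad x) := by
  have hz : (0 : ℝ) < x 2 := hx
  rw [cosh_rad hx, potential]
  have h1 : (x 2 - 1) ^ 2 ≤ ‖x - basePoint‖ ^ 2 := by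
    rw [← sq_abs]
    exact pow_le_pow_left₀ (abs_nonneg _) (abs_coord_sub_le x) 2
  have h2 : (x 2 - 1) ^ 2 / (2 * x 2) ≤ ‖x - basePoint‖ ^ 2 / (2 * x 2) := by gcongr
  have h3 : 1 / x 2 ≤ 2 * (1 + (x 2 - 1) ^ 2 / (2 * x 2)) := by
    rw [← sub_nonneg]
    have : 2 * (1 + (x 2 - 1) ^ 2 / (2 * x 2)) - 1 / x 2 = x 2 := by field_simp; ring
    rw [this]; exact hz.le
  linarith

/-- Hyperbolic balls are contained in compact subsets of the half space. -/
lemma exists_compact_of_cosh_rad_le (A : ℝ) : ∃ K : Set E3, IsCompact K ∧ K ⊆ upperHalfSpace ∧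
    ∀ x ∈ upperHalfSpace, Real.cosh (rad x) ≤ A → x ∈ K := by
  have hco : ∀ x : E3, x 2 ≤ 1 + ‖x - basePoint‖ := fun x => by
    have := (abs_le.1 (abs_coord_sub_le x)).2
    linarith
  refine ⟨{x | ‖x - basePoint‖ ^ 2 ≤ 2 * max A 1 * x 2}, ?_, ?_, ?_⟩
  · refine (isCompact_closedBall basePoint (2 * max A 1 + 1)).of_isClosed_subset
      (isClosed_le (by fun_prop) (by fun_prop)) fun x hx => ?_
    have hx' : ‖x - basePoint‖ ^ 2 ≤ 2 * max A 1 * x 2 := hx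
    rw [Metric.mem_closedBall, dist_eq_norm]
    by_contra! hlt
    have hA : 1 ≤ max A 1 := le_max_right _ _
    have h1 : 2 * max A 1 * x 2 ≤ 2 * max A 1 * (1 + ‖x - basePoint‖) :=
      mul_le_mul_of_nonneg_left (hco x) (by positivity)
    nlinarith
  · intro x hx
    have hx' : ‖x - basePoint‖ ^ 2 ≤ 2 * max A 1 * x 2 := hx
    by_contra hneg
    have hneg' : x 2 ≤ 0 := not_lt.1 hneg
    have hA : 1 ≤ max A 1 := le_max_right _ _
    have h0 : ‖x - basePoint‖ ^ 2 ≤ 0 := hx'.trans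
      (mul_nonpos_of_nonneg_of_nonpos (by positivity) hneg')
    have h1 : ‖x - basePoint‖ = 0 := by nlinarith [norm_nonneg (x - basePoint)]
    have h2 := abs_coord_sub_le x
    rw [h1] at h2
    have := abs_nonpos_iff.1 h2
    linarith
  · intro x hx hA
    have hz : (0 : ℝ) < x 2 := hx
    rw [cosh_rad hx] at hA
    have h1 : ‖x - basePoint‖ ^ 2 / (2 * x 2) ≤ max A 1 := by
      linarith [le_max_left A 1]
    rw [div_le_iff₀ (by positivity)] at h1
    show ‖x - basePoint‖ ^ 2 ≤ 2 * max A 1 * x 2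
    linarith

/-- The decay weight `cosh^{-τ} r`. -/
def weight (τ : ℝ) (x : E3) : ℝ := Real.cosh (rad x) ^ (-τ)

lemma weight_pos (τ : ℝ) (x : E3) : 0 < weight τ x := Real.rpow_pos_of_pos (Real.cosh_pos _) _

lemma exp_le_weight {τ : ℝ} (hτ : 0 < τ) {x : E3} (hx : x ∈ upperHalfSpace) :
    Real.exp (-τ * rad x) ≤ weight τ x := by
  have h0 := rad_nonneg hx
  have h1 : Real.cosh (rad x) ≤ Real.exp (rad x) := by
    rw [Real.cosh_eq]
    have : Real.exp (-rad x) ≤ Real.exp (rad x) := Real.exp_le_exp.2 (by linarith)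
    linarith
  rw [mul_comm, Real.exp_mul, weight]
  exact Real.rpow_le_rpow_of_nonpos (Real.cosh_pos _) h1 (by linarith)

lemma weight_le_one {τ : ℝ} (hτ : 0 < τ) (x : E3) : weight τ x ≤ 1 :=
  Real.rpow_le_one_of_one_le_of_nonpos (Real.one_le_cosh _) (by linarith)

lemma isBigO_weight_one {τ : ℝ} (hτ : 0 < τ) (l : Filter E3) :
    weight τ =O[l] fun _ => (1 : ℝ) := by
  refine IsBigO.of_bound 1 (Eventually.of_forall fun x => ?_)
  rw [Real.norm_eq_abs, abs_of_pos (weight_pos τ x)]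
  simpa using weight_le_one hτ x

/-- Decay near infinity is uniform decay on the half space, for continuous functions. -/
lemma isBigO_of_decay {τ : ℝ} (hτ : 0 < τ) {f : E3 → ℝ} (hf : ContinuousOn f upperHalfSpace)
    {K R : ℝ} (h : ∀ x ∈ upperHalfSpace, R ≤ rad x → |f x| ≤ K * Real.exp (-τ * rad x)) :
    f =O[𝓟 upperHalfSpace] weight τ := by
  obtain ⟨S, hS, hSU, hmem⟩ := exists_compact_of_cosh_rad_le (Real.cosh R)
  obtain ⟨M, hM⟩ := hS.exists_bound_of_continuousOn (hf.mono hSU)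
  have hw := Real.rpow_pos_of_pos (Real.cosh_pos R) (-τ)
  refine IsBigO.of_bound (max |K| (M / Real.cosh R ^ (-τ))) (eventually_principal.2 fun x hx => ?_)
  rw [Real.norm_eq_abs, Real.norm_eq_abs, abs_of_pos (weight_pos τ x)]
  by_cases hR : R ≤ rad x
  · calc |f x| ≤ K * Real.exp (-τ * rad x) := h x hx hR
      _ ≤ |K| * Real.exp (-τ * rad x) :=
        mul_le_mul_of_nonneg_right (le_abs_self K) (Real.exp_pos _).le
      _ ≤ |K| * weight τ x := mul_le_mul_of_nonneg_left (exp_le_weight hτ hx) (abs_nonneg _)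
      _ ≤ _ := mul_le_mul_of_nonneg_right (le_max_left _ _) (weight_pos τ x).le
  · have hc : Real.cosh (rad x) ≤ Real.cosh R := by
      rw [Real.cosh_le_cosh, abs_of_nonneg (rad_nonneg hx)]
      exact (not_le.1 hR).le.trans (le_abs_self R)
    have h1 := hM x (hmem x hx hc)
    have hM0 : 0 ≤ M := (norm_nonneg _).trans h1
    have h2 : Real.cosh R ^ (-τ) ≤ weight τ x :=
      Real.rpow_le_rpow_of_nonpos (Real.cosh_pos _) hc (by linarith)
    calc |f x| ≤ M := h1
      _ = M / Real.cosh R ^ (-τ) * Real.cosh R ^ (-τ) := by field_simp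
      _ ≤ M / Real.cosh R ^ (-τ) * weight τ x := mul_le_mul_of_nonneg_left h2 (by positivity)
      _ ≤ _ := mul_le_mul_of_nonneg_right (le_max_right _ _) (weight_pos τ x).le

/-- The end at infinity of the upper half space. -/
def atInfty : Filter E3 := comap (fun x => Real.cosh (rad x)) atTop ⊓ 𝓟 upperHalfSpace

lemma tendsto_weight_atInfty {τ : ℝ} (hτ : 0 < τ) : Tendsto (weight τ) atInfty (𝓝 0) :=
  (tendsto_rpow_neg_atTop hτ).comp (tendsto_comap.mono_left inf_le_left)

/-- Continuous functions with a limit at infinity are bounded. -/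
lemma isBigO_one_of_tendsto {f : E3 → ℝ} (hf : ContinuousOn f upperHalfSpace) {L : ℝ}
    (h : Tendsto f atInfty (𝓝 L)) : f =O[𝓟 upperHalfSpace] fun _ => (1 : ℝ) := by
  have h1 : ∀ᶠ x in atInfty, |f x| ≤ |L| + 1 := by
    filter_upwards [h.abs.eventually_lt_const (lt_add_one |L|)] with x hx using hx.le
  obtain ⟨A, -, hA⟩ := ((atTop_basis.comap (fun x : E3 => Real.cosh (rad x))).inf_principal
    upperHalfSpace).eventually_iff.1 h1
  obtain ⟨S, hS, hSU, hmem⟩ := exists_compact_of_cosh_rad_le A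
  obtain ⟨M, hM⟩ := hS.exists_bound_of_continuousOn (hf.mono hSU)
  refine IsBigO.of_bound (max (|L| + 1) M) (eventually_principal.2 fun x hx => ?_)
  rw [norm_one, mul_one]
  rcases le_total A (Real.cosh (rad x)) with hc | hc
  · exact (hA ⟨hc, hx⟩).trans (le_max_left _ _)
  · exact (hM x (hmem x hx hc)).trans (le_max_right _ _)

section

variable {τ : ℝ} {g : MetricField}

lemma continuousOn_coord : ContinuousOn (fun x : E3 => x 2) upperHalfSpace := by fun_prop

lemma continuousOn_coord_inv : ContinuousOn (fun x : E3 => (x 2)⁻¹) upperHalfSpace :=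
  continuousOn_coord.inv₀ fun _ hx => (show (0 : ℝ) < _ from hx).ne'

lemma IsMetric.continuousOn_frameDev (hg : IsMetric g) (i j : Fin 3) :
    ContinuousOn (fun x => frameDev g x i j) upperHalfSpace := by
  have h1 := hg.continuousOn i j
  have h2 := continuousOn_coord
  unfold frameDev
  fun_prop

lemma IsMetric.continuousOn_frameDer (hg : IsMetric g) (k i j : Fin 3) :
    ContinuousOn (fun x => frameDer g x k i j) upperHalfSpace := by
  have h1 := hg.continuousOn i j
  have h2 := continuousOn_coord
  have h3 := hg.continuousOn_pd k i j
  unfold frameDer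
  fun_prop

lemma isBigO_frameDev (hτ : 0 < τ) (hg : IsAsymptoticallyHyperbolic τ g) (i j : Fin 3) :
    (fun x => frameDev g x i j) =O[𝓟 upperHalfSpace] weight τ := by
  obtain ⟨K, R, h⟩ := hg.decay
  refine isBigO_of_decay hτ (hg.isMetric.continuousOn_frameDev i j) (K := K) (R := R)
    fun x hx hR => ?_
  have hz : (0 : ℝ) < x 2 := hx
  have h1 := le_tensorNorm hx (deviation g x) ![i, j]
  have h2 : frameDev g x i j = x 2 ^ 2 * deviation g x ![i, j] := by
    rw [deviation_eq hx]
    simp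
    field_simp
  rw [h2, abs_mul, abs_of_pos (by positivity)]
  refine h1.trans (le_trans ?_ (h x hx hR))
  have : ∀ (k : ℕ) (T : (Fin k → Fin 3) → ℝ), 0 ≤ tensorNorm hypMetric x T := fun k T =>
    Real.sqrt_nonneg _
  linarith [this _ (covDeriv hypMetric (deviation g) x),
    this _ (covDeriv hypMetric (covDeriv hypMetric (deviation g)) x)]

lemma isBigO_frameDer (hτ : 0 < τ) (hg : IsAsymptoticallyHyperbolic τ g) (k i j : Fin 3) :
    (fun x => frameDer g x k i j) =O[𝓟 upperHalfSpace] weight τ := by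
  have hE := isBigO_frameDev hτ hg
  have h1 : (fun x => x 2 ^ 3 * covDeriv hypMetric (deviation g) x ![k, i, j])
      =O[𝓟 upperHalfSpace] weight τ := by
    obtain ⟨K, R, h⟩ := hg.decay
    refine isBigO_of_decay hτ ?_ (K := K) (R := R) fun x hx hR => ?_
    · have h1 := hg.isMetric.continuousOn_frameDer k i j
      have h2 := hg.isMetric.continuousOn_frameDev
      refine ContinuousOn.congr (f := fun x => frameDer g x k i j
        + (if i = 2 then 1 else 0) * frameDev g x k j - (if k = i then 1 else 0) * frameDev g x 2 j
        + (if j = 2 then 1 else 0) * frameDev g x i k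
        - (if k = j then 1 else 0) * frameDev g x i 2) ?_
        fun x hx => covDeriv_deviation hg.isMetric hx k i j
      have h3 := h2 k j
      have h4 := h2 2 j
      have h5 := h2 i k
      have h6 := h2 i 2
      fun_prop
    · have hz : (0 : ℝ) < x 2 := hx
      have h1 := le_tensorNorm hx (covDeriv hypMetric (deviation g) x) ![k, i, j]
      rw [abs_mul, abs_of_pos (by positivity)]
      refine h1.trans (le_trans ?_ (h x hx hR))
      have : ∀ (k : ℕ) (T : (Fin k → Fin 3) → ℝ), 0 ≤ tensorNorm hypMetric x T := fun k T =>
        Real.sqrt_nonneg _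
      linarith [this _ (deviation g x),
        this _ (covDeriv hypMetric (covDeriv hypMetric (deviation g)) x)]
  have h2 : ∀ (c : ℝ) i j, (fun x => c * frameDev g x i j) =O[𝓟 upperHalfSpace] weight τ :=
    fun c i j => (hE i j).const_mul_left c
  refine ((((h1.sub (h2 (if i = 2 then 1 else 0) k j)).add (h2 (if k = i then 1 else 0) 2 j)).sub
    (h2 (if j = 2 then 1 else 0) i k)).add (h2 (if k = j then 1 else 0) i 2)).congr' ?_ .rfl
  refine eventually_principal.2 fun x hx => ?_
  simp only
  rw [covDeriv_deviation hg.isMetric hx k i j]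
  ring

/-- The components of the inverse metric in the frame, the entries of `G⁻¹`. -/
def frameInv (g : MetricField) (x : E3) (i j : Fin 3) : ℝ := (x 2 ^ 2)⁻¹ * (g x)⁻¹ i j

lemma IsMetric.continuousOn_frameInv (hg : IsMetric g) (i j : Fin 3) :
    ContinuousOn (fun x => frameInv g x i j) upperHalfSpace := by
  have h1 := hg.continuousOn_inv i j
  have h2 : ContinuousOn (fun x : E3 => (x 2 ^ 2)⁻¹) upperHalfSpace := by
    simp only [← inv_pow]
    exact continuousOn_coord_inv.pow 2
  exact h2.mul h1

lemma frameDev_symm (hg : IsMetric g) {x : E3} (hx : x ∈ upperHalfSpace) (i j : Fin 3) :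
    frameDev g x i j = frameDev g x j i := by
  rw [frameDev, frameDev, hg.symm hx]
  simp only [eq_comm]

lemma frameDer_symm (hg : IsMetric g) {x : E3} (hx : x ∈ upperHalfSpace) (k i j : Fin 3) :
    frameDer g x k i j = frameDer g x k j i := by
  rw [frameDer, frameDer, hg.symm hx, hg.pd_symm hx]

/-- `G⁻¹ = 1 - E G⁻¹`. -/
lemma frameInv_eq (hg : IsMetric g) {x : E3} (hx : x ∈ upperHalfSpace) (i j : Fin 3) :
    frameInv g x i j = (if i = j then 1 else 0) - ∑ k, frameDev g x i k * frameInv g x k j := by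
  have hz : (0 : ℝ) < x 2 := hx
  have h := hg.sum_mul_inv hx i j
  simp only [frameDev, sub_mul, Finset.sum_sub_distrib]
  have h1 : ∑ k, x 2 ^ 2 * g x i k * frameInv g x k j = if i = j then 1 else 0 := by
    rw [← h]
    refine Finset.sum_congr rfl fun k _ => ?_
    rw [frameInv]
    field_simp
  rw [h1]
  simp

lemma isBigO_frameInv_one (hτ : 0 < τ) (hg : IsAsymptoticallyHyperbolic τ g) (i j : Fin 3) :
    (fun x => frameInv g x i j) =O[𝓟 upperHalfSpace] fun _ => (1 : ℝ) := by
  refine isBigO_one_of_tendsto (hg.isMetric.continuousOn_frameInv i j)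
    (L := (1 : Matrix (Fin 3) (Fin 3) ℝ)⁻¹ i j) ?_
  have h1 : Tendsto (fun x => (x 2 ^ 2) • g x) atInfty (𝓝 (1 : Matrix (Fin 3) (Fin 3) ℝ)) := by
    refine tendsto_pi_nhds.2 fun i => tendsto_pi_nhds.2 fun j => ?_
    have h2 : Tendsto (fun x => frameDev g x i j) atInfty (𝓝 0) :=
      ((isBigO_frameDev hτ hg i j).mono inf_le_right).trans_tendsto (tendsto_weight_atInfty hτ)
    have h3 := h2.add_const (if i = j then (1 : ℝ) else 0)
    rw [zero_add] at h3
    rw [Matrix.one_apply]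
    refine h3.congr fun x => ?_
    simp [frameDev]
  have h2 : ContinuousAt (fun A : Matrix (Fin 3) (Fin 3) ℝ => A⁻¹) 1 := by
    refine continuousAt_matrix_inv 1 ?_
    rw [Matrix.det_one]
    have : (Ring.inverse : ℝ → ℝ) = fun x => x⁻¹ := funext fun x => Ring.inverse_eq_inv x
    rw [this]
    exact continuousAt_inv₀ one_ne_zero
  have h3 : Tendsto (fun x => ((x 2 ^ 2) • g x)⁻¹ i j) atInfty
      (𝓝 ((1 : Matrix (Fin 3) (Fin 3) ℝ)⁻¹ i j)) :=
    tendsto_pi_nhds.1 (tendsto_pi_nhds.1 (h2.tendsto.comp h1) i) j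
  refine h3.congr' ?_
  filter_upwards [mem_inf_of_right (mem_principal_self upperHalfSpace)] with x hx
  have hz : (0 : ℝ) < x 2 := hx
  have : ((x 2 ^ 2) • g x)⁻¹ = (x 2 ^ 2)⁻¹ • (g x)⁻¹ := by
    refine Matrix.inv_eq_left_inv ?_
    rw [Matrix.smul_mul, Matrix.mul_smul, smul_smul, inv_mul_cancel₀ (by positivity),
      Matrix.nonsing_inv_mul _ (hg.isMetric.isUnit_det hx), one_smul]
  rw [this, Matrix.smul_apply, smul_eq_mul, frameInv]

lemma isBigO_frameInv_sub (hτ : 0 < τ) (hg : IsAsymptoticallyHyperbolic τ g) (i j : Fin 3) :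
    (fun x => frameInv g x i j - if i = j then 1 else 0) =O[𝓟 upperHalfSpace] weight τ := by
  have h1 : (fun x => ∑ k, frameDev g x i k * frameInv g x k j)
      =O[𝓟 upperHalfSpace] weight τ := by
    refine isBigO_sum fun k => ?_
    simpa using (isBigO_frameDev hτ hg i k).mul (isBigO_frameInv_one hτ hg k j)
  refine h1.neg_left.congr' (eventually_principal.2 fun x hx => ?_) .rfl
  simp only
  rw [frameInv_eq hg.isMetric hx i j]
  ring

/-- `G⁻¹ = 1 - E + O(|E|²)`. -/
lemma isBigO_frameInv_sub_add (hτ : 0 < τ) (hg : IsAsymptoticallyHyperbolic τ g) (i j : Fin 3) :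
    (fun x => frameInv g x i j - (if i = j then 1 else 0) + frameDev g x i j)
      =O[𝓟 upperHalfSpace] fun x => weight τ x * weight τ x := by
  have h1 : (fun x => ∑ k, frameDev g x i k * (frameInv g x k j - if k = j then 1 else 0))
      =O[𝓟 upperHalfSpace] fun x => weight τ x * weight τ x := by
    refine isBigO_sum fun k => ?_
    exact (isBigO_frameDev hτ hg i k).mul (isBigO_frameInv_sub hτ hg k j)
  refine h1.neg_left.congr' (eventually_principal.2 fun x hx => ?_) .rfl
  simp only
  rw [frameInv_eq hg.isMetric hx i j]
  simp only [mul_sub, Finset.sum_sub_distrib]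
  simp
  ring

end

/-! ### Mean curvature of Euclidean planes -/

section

variable {g : MetricField} {x a : E3}

lemma sum_coord_sq (ha : ‖a‖ = 1) : ∑ i, a i * a i = 1 := by
  have := EuclideanSpace.norm_sq_eq a
  rw [ha] at this
  simpa [sq] using this.symm

lemma coord_ne_zero_of_norm (ha : ‖a‖ = 1) : (fun i => a i) ≠ 0 := by
  intro h
  have h1 := sum_coord_sq ha
  have h2 : ∀ i, a i = 0 := fun i => congrFun h i
  simp [h2] at h1

/-- The squared norm `g^{kl} a_k a_l` of the covector `a`. -/
def conormSq (g : MetricField) (a x : E3) : ℝ := ∑ k, ∑ l, (g x)⁻¹ k l * a k * a l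

lemma IsMetric.conormSq_pos (hg : IsMetric g) (hx : x ∈ upperHalfSpace) (ha : ‖a‖ = 1) :
    0 < conormSq g a x := by
  have h := (hg.posDef x hx).inv.dotProduct_mulVec_pos (coord_ne_zero_of_norm ha)
  simp only [dotProduct, Matrix.mulVec, star_trivial, Finset.mul_sum] at h
  refine lt_of_lt_of_eq h ?_
  refine Finset.sum_congr rfl fun i _ => Finset.sum_congr rfl fun j _ => ?_
  ring

lemma unitNormal_eq (g : MetricField) (a x : E3) (i : Fin 3) :
    unitNormal g a x i = (∑ j, (g x)⁻¹ i j * a j) / √(conormSq g a x) := rfl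

/-- Lowering the index of the unit normal gives the normalized conormal. -/
lemma IsMetric.sum_mul_unitNormal (hg : IsMetric g) (hx : x ∈ upperHalfSpace) (j : Fin 3) :
    ∑ k, g x j k * unitNormal g a x k = a j * (√(conormSq g a x))⁻¹ := by
  have h : ∑ k, g x j k * ∑ l, (g x)⁻¹ k l * a l = a j := by
    simp only [Finset.mul_sum]
    rw [Finset.sum_comm]
    have : ∀ l, ∑ k, g x j k * ((g x)⁻¹ k l * a l) = (if j = l then 1 else 0) * a l := fun l => by
      rw [← hg.sum_mul_inv hx j l, Finset.sum_mul]
      exact Finset.sum_congr rfl fun k _ => by ring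
    simp [this]
  simp only [unitNormal_eq, mul_div_assoc', ← Finset.sum_div, h]
  rw [div_eq_mul_inv]

lemma IsMetric.sum_coord_mul_unitNormal (hg : IsMetric g) (hx : x ∈ upperHalfSpace)
    (ha : ‖a‖ = 1) : ∑ j, a j * unitNormal g a x j = √(conormSq g a x) := by
  have h0 := hg.conormSq_pos hx ha
  have hs := Real.sqrt_pos.2 h0
  have h1 : ∑ j, a j * ∑ l, (g x)⁻¹ j l * a l = conormSq g a x := by
    rw [conormSq]
    simp only [Finset.mul_sum]
    exact Finset.sum_congr rfl fun k _ => Finset.sum_congr rfl fun l _ => by ring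
  simp only [unitNormal_eq, mul_div_assoc', ← Finset.sum_div, h1]
  rw [div_eq_iff hs.ne', Real.mul_self_sqrt h0.le]

/-- The inverse of the metric induced on the plane. -/
def tangentInv (g : MetricField) (a x : E3) (i j : Fin 3) : ℝ :=
  (g x)⁻¹ i j - unitNormal g a x i * unitNormal g a x j

lemma IsMetric.tangentInv_symm (hg : IsMetric g) (hx : x ∈ upperHalfSpace) (i j : Fin 3) :
    tangentInv g a x i j = tangentInv g a x j i := by
  rw [tangentInv, tangentInv, hg.inv_symm hx, mul_comm (unitNormal g a x i)]

/-- The conormal lies in the kernel of the tangential inverse metric. -/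
lemma IsMetric.sum_tangentInv_mul (hg : IsMetric g) (hx : x ∈ upperHalfSpace) (ha : ‖a‖ = 1)
    (i : Fin 3) : ∑ j, tangentInv g a x i j * a j = 0 := by
  have hs := Real.sqrt_pos.2 (hg.conormSq_pos hx ha)
  simp only [tangentInv, sub_mul, Finset.sum_sub_distrib, mul_assoc, ← Finset.mul_sum]
  have h : ∑ j, unitNormal g a x j * a j = √(conormSq g a x) := by
    rw [← hg.sum_coord_mul_unitNormal hx ha]
    exact Finset.sum_congr rfl fun j _ => mul_comm _ _
  rw [h, unitNormal_eq, div_mul_cancel₀ _ hs.ne', sub_self]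

/-- The Christoffel symbols with lowered index. -/
lemma IsMetric.sum_mul_christoffel (hg : IsMetric g) (hx : x ∈ upperHalfSpace) (i j l : Fin 3) :
    ∑ k, g x j k * christoffel g x k i l = (1 / 2) * (pd i (fun y => g y l j) x
      + pd l (fun y => g y i j) x - pd j (fun y => g y i l) x) := by
  set f : Fin 3 → ℝ := fun m => pd i (fun y => g y l m) x + pd l (fun y => g y i m) x
    - pd m (fun y => g y i l) x
  have h1 : ∀ k, christoffel g x k i l = (1 / 2) * ∑ m, (g x)⁻¹ k m * f m := fun k => rfl
  have h2 : ∑ k, g x j k * ∑ m, (g x)⁻¹ k m * f m = f j := by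
    simp only [Finset.mul_sum]
    rw [Finset.sum_comm]
    have : ∀ m, ∑ k, g x j k * ((g x)⁻¹ k m * f m) = (if j = m then 1 else 0) * f m := fun m => by
      rw [← hg.sum_mul_inv hx j m, Finset.sum_mul]
      exact Finset.sum_congr rfl fun k _ => by ring
    simp [this]
  have h3 : ∑ k, g x j k * christoffel g x k i l = (1 / 2) * f j := by
    simp only [h1, mul_left_comm _ (1 / 2 : ℝ), ← Finset.mul_sum, h2]
  exact h3

lemma IsMetric.differentiableAt_conormSq (hg : IsMetric g) (hx : x ∈ upperHalfSpace) (a : E3) :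
    DifferentiableAt ℝ (conormSq g a) x := by
  have h := fun i j => hg.differentiableAt_inv hx i j
  unfold conormSq
  refine DifferentiableAt.fun_sum fun k _ => DifferentiableAt.fun_sum fun l _ => ?_
  exact ((h k l).mul_const _).mul_const _

lemma IsMetric.differentiableAt_unitNormal (hg : IsMetric g) (hx : x ∈ upperHalfSpace)
    (ha : ‖a‖ = 1) (i : Fin 3) : DifferentiableAt ℝ (fun y => unitNormal g a y i) x := by
  have h := fun i j => hg.differentiableAt_inv hx i j
  have h0 := hg.conormSq_pos hx ha
  simp only [unitNormal_eq, div_eq_mul_inv]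
  refine DifferentiableAt.mul ?_ (((hg.differentiableAt_conormSq hx a).sqrt h0.ne').inv
    (Real.sqrt_pos.2 h0).ne')
  exact DifferentiableAt.fun_sum fun k _ => (h i k).mul_const _

/-- The derivative of the identity `g_{jk} ν^k = a_j / √(g^{kl} a_k a_l)`. -/
lemma IsMetric.sum_mul_pd_unitNormal (hg : IsMetric g) (hx : x ∈ upperHalfSpace) (ha : ‖a‖ = 1)
    (i j : Fin 3) : ∑ k, g x j k * pd i (fun y => unitNormal g a y k) x
      = a j * pd i (fun y => (√(conormSq g a y))⁻¹) x
        - ∑ k, pd i (fun y => g y j k) x * unitNormal g a x k := by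
  have h1 : (fun y => ∑ k, g y j k * unitNormal g a y k)
      =ᶠ[𝓝 x] fun y => a j * (√(conormSq g a y))⁻¹ := by
    filter_upwards [isOpen_upperHalfSpace.mem_nhds hx] with y hy
    exact hg.sum_mul_unitNormal hy j
  have h0 := hg.conormSq_pos hx ha
  have hd : DifferentiableAt ℝ (fun y => (√(conormSq g a y))⁻¹) x :=
    ((hg.differentiableAt_conormSq hx a).sqrt h0.ne').inv (Real.sqrt_pos.2 h0).ne'
  have h2 := h1.fderiv_eq (𝕜 := ℝ)
  have h5 : fderiv ℝ (fun y => a j * (√(conormSq g a y))⁻¹) x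
      = a j • fderiv ℝ (fun y => (√(conormSq g a y))⁻¹) x := fderiv_const_mul hd (a j)
  have h6 : fderiv ℝ (fun y => ∑ k, g y j k * unitNormal g a y k) x
      = ∑ k, fderiv ℝ (fun y => g y j k * unitNormal g a y k) x :=
    fderiv_fun_sum fun k _ => (hg.differentiableAt hx j k).fun_mul
      (hg.differentiableAt_unitNormal hx ha k)
  rw [h6, h5] at h2
  have h3 := congrArg (fun T : E3 →L[ℝ] ℝ => T (EuclideanSpace.single i 1)) h2
  simp only [sum_apply, smul_apply, smul_eq_mul] at h3
  have h4 : ∀ k, fderiv ℝ (fun y => g y j k * unitNormal g a y k) x (EuclideanSpace.single i 1)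
      = g x j k * pd i (fun y => unitNormal g a y k) x
        + pd i (fun y => g y j k) x * unitNormal g a x k := fun k => by
    rw [fderiv_fun_mul (hg.differentiableAt hx j k) (hg.differentiableAt_unitNormal hx ha k)]
    simp only [add_apply, smul_apply, smul_eq_mul, pd]
    ring
  simp only [h4, Finset.sum_add_distrib] at h3
  rw [pd, ← h3]
  ring

/-- The mean curvature of a Euclidean plane in terms of first derivatives of the metric:
`H = -h^{ij} ν^l ∂_i g_{jl} + ½ h^{ij} ν^l ∂_l g_{ij}`. -/
lemma IsMetric.meanCurvature_eq (hg : IsMetric g) (hx : x ∈ upperHalfSpace) (ha : ‖a‖ = 1) :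
    meanCurvature g a x = ∑ i, ∑ j, tangentInv g a x i j * ∑ l, unitNormal g a x l *
      (1 / 2 * pd l (fun y => g y i j) x - pd i (fun y => g y j l) x) := by
  set h := tangentInv g a x with hh
  set ν := unitNormal g a x with hν
  -- Traced over the tangent plane, the first and the last term will vanish: the first is a multiple
  -- of the covector `a`, the last is antisymmetric.
  have hsecond : ∀ i j, secondFF g a x i j = a j * pd i (fun y => (√(conormSq g a y))⁻¹) x
      + ∑ l, ν l * (1 / 2 * pd l (fun y => g y i j) x - pd i (fun y => g y j l) x)
      + ∑ l, ν l * (1 / 2 * (pd i (fun y => g y j l) x - pd j (fun y => g y i l) x)) := by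
    intro i j
    have h1 : ∑ k, g x j k * ∑ l, christoffel g x k i l * ν l
        = ∑ l, (1 / 2) * (pd i (fun y => g y l j) x
      + pd l (fun y => g y i j) x - pd j (fun y => g y i l) x) * ν l := by
      simp only [Finset.mul_sum]
      rw [Finset.sum_comm]
      refine Finset.sum_congr rfl fun l _ => ?_
      rw [← hg.sum_mul_christoffel hx i j l, Finset.sum_mul]
      exact Finset.sum_congr rfl fun k _ => by ring
    simp only [secondFF, covDerivVec, mul_add, Finset.sum_add_distrib]
    rw [← hν, h1, hg.sum_mul_pd_unitNormal hx ha, sub_add_eq_add_sub, sub_eq_add_neg,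
      ← Finset.sum_neg_distrib, add_assoc, add_assoc, ← Finset.sum_add_distrib,
      ← Finset.sum_add_distrib]
    refine congrArg _ (Finset.sum_congr rfl fun l _ => ?_)
    rw [hg.pd_symm hx i l j, ← hν]
    ring
  have hsym : ∑ i, ∑ j, h i j *
      ∑ l, ν l * (1 / 2 * (pd i (fun y => g y j l) x - pd j (fun y => g y i l) x)) = 0 := by
    -- The summand is antisymmetric in `i` and `j`.
    have hanti : ∑ i, ∑ j, h i j *
        ∑ l, ν l * (1 / 2 * (pd i (fun y => g y j l) x - pd j (fun y => g y i l) x))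
        = -∑ i, ∑ j, h i j *
        ∑ l, ν l * (1 / 2 * (pd i (fun y => g y j l) x - pd j (fun y => g y i l) x)) := by
      conv_lhs => rw [Finset.sum_comm]
      rw [← Finset.sum_neg_distrib]
      refine Finset.sum_congr rfl fun i _ => ?_
      rw [← Finset.sum_neg_distrib]
      refine Finset.sum_congr rfl fun j _ => ?_
      rw [hh, hg.tangentInv_symm hx j i, ← mul_neg, ← Finset.sum_neg_distrib]
      refine congrArg _ (Finset.sum_congr rfl fun l _ => ?_)
      ring
    linarith
  have hker : ∑ i, ∑ j, h i j * (a j * pd i (fun y => (√(conormSq g a y))⁻¹) x) = 0 := by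
    refine Finset.sum_eq_zero fun i _ => ?_
    simp only [← mul_assoc, ← Finset.sum_mul]
    rw [hh, hg.sum_tangentInv_mul hx ha, zero_mul]
  have hmean : meanCurvature g a x = ∑ i, ∑ j, h i j * secondFF g a x i j := rfl
  rw [hmean]
  simp only [hsecond, mul_add, Finset.sum_add_distrib]
  rw [hker, hsym]
  ring

end

/-! ### The face terms in the orthonormal frame -/

section

variable {g : MetricField} {x a : E3}

/-- The squared norm of the covector `a` in the frame. -/
def frameConormSq (g : MetricField) (a x : E3) : ℝ := ∑ k, ∑ l, frameInv g x k l * a k * a l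

/-- The frame components of the unit normal. -/
def frameNormal (g : MetricField) (a x : E3) (i : Fin 3) : ℝ :=
  (∑ j, frameInv g x i j * a j) * (√(frameConormSq g a x))⁻¹

/-- The frame components of the inverse of the metric induced on the plane. -/
def frameTangentInv (g : MetricField) (a x : E3) (i j : Fin 3) : ℝ :=
  frameInv g x i j - frameNormal g a x i * frameNormal g a x j

lemma inv_eq_frameInv (hx : x ∈ upperHalfSpace) (i j : Fin 3) :
    (g x)⁻¹ i j = x 2 ^ 2 * frameInv g x i j := by
  have hz : (0 : ℝ) < x 2 := hx
  rw [frameInv]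
  field_simp

lemma conormSq_eq_frame (hx : x ∈ upperHalfSpace) (a : E3) :
    conormSq g a x = x 2 ^ 2 * frameConormSq g a x := by
  simp only [conormSq, frameConormSq, inv_eq_frameInv hx, Finset.mul_sum, mul_assoc]

lemma unitNormal_eq_frame (hx : x ∈ upperHalfSpace) (a : E3) (i : Fin 3) :
    unitNormal g a x i = x 2 * frameNormal g a x i := by
  have hz : (0 : ℝ) < x 2 := hx
  have h1 : ∑ j, (g x)⁻¹ i j * a j = x 2 ^ 2 * ∑ j, frameInv g x i j * a j := by
    simp only [inv_eq_frameInv hx, Finset.mul_sum, mul_assoc]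
  rw [unitNormal_eq, h1, conormSq_eq_frame hx, Real.sqrt_mul (by positivity),
    Real.sqrt_sq hz.le, frameNormal, div_eq_mul_inv, mul_inv]
  field_simp

lemma tangentInv_eq_frame (hx : x ∈ upperHalfSpace) (a : E3) (i j : Fin 3) :
    tangentInv g a x i j = x 2 ^ 2 * frameTangentInv g a x i j := by
  rw [tangentInv, frameTangentInv, unitNormal_eq_frame hx, unitNormal_eq_frame hx,
    inv_eq_frameInv hx]
  ring

lemma pd_eq_frameDer (hx : x ∈ upperHalfSpace) (k i j : Fin 3) :
    pd k (fun y => g y i j) x = (x 2 ^ 3)⁻¹ * frameDer g x k i j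
      - 2 * (x 2)⁻¹ * (if k = 2 then 1 else 0) * g x i j := by
  have hz : (0 : ℝ) < x 2 := hx
  rw [frameDer]
  field_simp
  ring

lemma IsMetric.frameConormSq_pos (hg : IsMetric g) (hx : x ∈ upperHalfSpace) (ha : ‖a‖ = 1) :
    0 < frameConormSq g a x := by
  have hz : (0 : ℝ) < x 2 := hx
  have := hg.conormSq_pos hx ha
  rw [conormSq_eq_frame hx] at this
  exact pos_of_mul_pos_right this (by positivity)

/-- The unit normal has length one. -/
lemma IsMetric.sum_unitNormal_sq (hg : IsMetric g) (hx : x ∈ upperHalfSpace) (ha : ‖a‖ = 1) :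
    ∑ i, unitNormal g a x i * ∑ j, g x i j * unitNormal g a x j = 1 := by
  have hs := Real.sqrt_pos.2 (hg.conormSq_pos hx ha)
  simp only [hg.sum_mul_unitNormal hx]
  have : ∑ i, unitNormal g a x i * (a i * (√(conormSq g a x))⁻¹)
      = (∑ i, a i * unitNormal g a x i) * (√(conormSq g a x))⁻¹ := by
    rw [Finset.sum_mul]
    exact Finset.sum_congr rfl fun i _ => by ring
  rw [this, hg.sum_coord_mul_unitNormal hx ha, mul_inv_cancel₀ hs.ne']

/-- The metric has trace two on a plane. -/
lemma IsMetric.sum_tangentInv_mul_metric (hg : IsMetric g) (hx : x ∈ upperHalfSpace)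
    (ha : ‖a‖ = 1) : ∑ i, ∑ j, tangentInv g a x i j * g x i j = 2 := by
  have h1 : ∑ i, ∑ j, (g x)⁻¹ i j * g x i j = 3 := by
    have : ∀ i, ∑ j, (g x)⁻¹ i j * g x i j = 1 := fun i => by
      have := hg.sum_inv_mul hx i i
      rw [if_pos rfl] at this
      rw [← this]
      exact Finset.sum_congr rfl fun j _ => by rw [hg.symm hx i j]
    simp [this]
  have h2 := hg.sum_unitNormal_sq hx ha
  simp only [tangentInv, sub_mul, Finset.sum_sub_distrib, h1]
  have h3 : ∑ i, ∑ j, unitNormal g a x i * unitNormal g a x j * g x i j = 1 := by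
    rw [← h2]
    refine Finset.sum_congr rfl fun i _ => ?_
    rw [Finset.mul_sum]
    exact Finset.sum_congr rfl fun j _ => by ring
  rw [h3]; norm_num

/-- The mean curvature of a Euclidean plane in the frame. -/
lemma IsMetric.meanCurvature_eq_frame (hg : IsMetric g) (hx : x ∈ upperHalfSpace) (ha : ‖a‖ = 1) :
    meanCurvature g a x = ∑ i, ∑ j, frameTangentInv g a x i j * ∑ l, frameNormal g a x l *
      (1 / 2 * frameDer g x l i j - frameDer g x i j l) - 2 * frameNormal g a x 2 := by
  have hz : (0 : ℝ) < x 2 := hx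
  rw [hg.meanCurvature_eq hx ha]
  have h1 : ∀ i j, ∑ l, unitNormal g a x l *
      (1 / 2 * pd l (fun y => g y i j) x - pd i (fun y => g y j l) x)
      = (x 2 ^ 2)⁻¹ * ∑ l, frameNormal g a x l * (1 / 2 * frameDer g x l i j - frameDer g x i j l)
        - frameNormal g a x 2 * g x i j
        + (if i = 2 then 1 else 0) * (2 * (x 2)⁻¹ * (√(conormSq g a x))⁻¹) * a j := by
    intro i j
    have h2 : ∀ l, unitNormal g a x l *
      (1 / 2 * pd l (fun y => g y i j) x - pd i (fun y => g y j l) x)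
      = (x 2 ^ 2)⁻¹ * (frameNormal g a x l * (1 / 2 * frameDer g x l i j - frameDer g x i j l))
        - (if l = 2 then frameNormal g a x l * g x i j else 0)
        + (if i = 2 then 1 else 0) * (2 * (x 2)⁻¹) * (g x j l * unitNormal g a x l) := by
      intro l
      rw [pd_eq_frameDer hx, pd_eq_frameDer hx, unitNormal_eq_frame hx]
      split_ifs <;> field_simp <;> ring
    simp only [h2, Finset.sum_add_distrib, Finset.sum_sub_distrib, ← Finset.mul_sum,
      Finset.sum_ite_eq', Finset.mem_univ, if_true, hg.sum_mul_unitNormal hx]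
    ring
  have hker : ∀ i, ∑ j, tangentInv g a x i j *
      ((if i = 2 then 1 else 0) * (2 * (x 2)⁻¹ * (√(conormSq g a x))⁻¹) * a j) = 0 := fun i => by
    have : ∀ j, tangentInv g a x i j *
      ((if i = 2 then 1 else 0) * (2 * (x 2)⁻¹ * (√(conormSq g a x))⁻¹) * a j)
      = ((if i = 2 then 1 else 0) * (2 * (x 2)⁻¹ * (√(conormSq g a x))⁻¹))
        * (tangentInv g a x i j * a j) := fun j => by ring
    simp only [this, ← Finset.mul_sum, hg.sum_tangentInv_mul hx ha, mul_zero]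
  have htr : ∀ i j, tangentInv g a x i j * (frameNormal g a x 2 * g x i j)
      = frameNormal g a x 2 * (tangentInv g a x i j * g x i j) := fun i j => by ring
  simp only [h1]
  generalize hS : (fun i j => ∑ l, frameNormal g a x l *
    (1 / 2 * frameDer g x l i j - frameDer g x i j l)) = S
  have hS' : ∀ i j, ∑ l, frameNormal g a x l *
    (1 / 2 * frameDer g x l i j - frameDer g x i j l) = S i j := fun i j => congrFun₂ hS i j
  simp only [hS']
  simp only [mul_add, mul_sub, Finset.sum_add_distrib, Finset.sum_sub_distrib, hker, htr]
  simp only [← Finset.mul_sum (s := Finset.univ) (a := frameNormal g a x 2),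
    hg.sum_tangentInv_mul_metric hx ha]
  rw [Finset.sum_const_zero, add_zero, mul_comm (frameNormal g a x 2) 2]
  congr 1
  refine Finset.sum_congr rfl fun i _ => Finset.sum_congr rfl fun j _ => ?_
  rw [tangentInv_eq_frame hx]
  field_simp

lemma frameInv_hypMetric (hx : x ∈ upperHalfSpace) (i j : Fin 3) :
    frameInv hypMetric x i j = if i = j then 1 else 0 := by
  have hz : (0 : ℝ) < x 2 := hx
  rw [frameInv, hypMetric_inv_apply hx]
  field_simp

lemma frameNormal_hypMetric (hx : x ∈ upperHalfSpace) (ha : ‖a‖ = 1) (i : Fin 3) :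
    frameNormal hypMetric a x i = a i := by
  have h1 : frameConormSq hypMetric a x = 1 := by
    rw [← sum_coord_sq ha]
    simp [frameConormSq, frameInv_hypMetric hx]
  simp [frameNormal, h1, frameInv_hypMetric hx]

lemma frameDer_hypMetric (hx : x ∈ upperHalfSpace) (k i j : Fin 3) :
    frameDer hypMetric x k i j = 0 := by
  have hz : (0 : ℝ) < x 2 := hx
  rw [frameDer, pd_hypMetric hx, hypMetric_apply]
  field_simp
  ring

lemma meanCurvature_hypMetric (hx : x ∈ upperHalfSpace) (ha : ‖a‖ = 1) :
    meanCurvature hypMetric a x = -2 * a 2 := by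
  rw [isMetric_hypMetric.meanCurvature_eq_frame hx ha]
  simp [frameDer_hypMetric hx, frameNormal_hypMetric hx ha]

lemma unitNormal_hypMetric (hx : x ∈ upperHalfSpace) (ha : ‖a‖ = 1) (i : Fin 3) :
    unitNormal hypMetric a x i = x 2 * a i := by
  rw [unitNormal_eq_frame hx, frameNormal_hypMetric hx ha]

lemma pd_potential (hx : x ∈ upperHalfSpace) (i : Fin 3) :
    pd i potential x = -(x 2 ^ 2)⁻¹ * if i = 2 then 1 else 0 := by
  have hz : (0 : ℝ) < x 2 := hx
  have h1 : HasFDerivAt potential (-(x 2 ^ 2)⁻¹ • (EuclideanSpace.proj 2 : E3 →L[ℝ] ℝ)) x := by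
    have := (hasDerivAt_inv hz.ne').comp_hasFDerivAt x (hasFDerivAt_coord 2 x)
    refine this.congr_of_eventuallyEq (Eventually.of_forall fun y => ?_)
    simp [potential]
  have h2 : (EuclideanSpace.proj 2 : E3 →L[ℝ] ℝ) (EuclideanSpace.single i 1)
      = if i = 2 then 1 else 0 := by
    by_cases hk : i = 2
    · simp [hk]
    · simp [hk, Ne.symm hk]
  rw [pd, h1.fderiv, smul_apply, h2, smul_eq_mul]

lemma gradPotential_eq (hx : x ∈ upperHalfSpace) (j : Fin 3) :
    gradPotential x j = -if j = 2 then 1 else 0 := by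
  have hz : (0 : ℝ) < x 2 := hx
  simp only [gradPotential, hypMetric_inv_apply hx, pd_potential hx]
  rw [Finset.sum_eq_single j (fun k _ hk => by simp [hk.symm]) (by simp), if_pos rfl]
  field_simp

lemma trDev_eq (hx : x ∈ upperHalfSpace) : trDev g x = ∑ i, frameDev g x i i := by
  have hz : (0 : ℝ) < x 2 := hx
  simp only [trDev, hypMetric_inv_apply hx, deviation_eq hx]
  simp only [mul_ite, ite_mul, mul_one, mul_zero, zero_mul, Finset.sum_ite_eq, Finset.mem_univ,
    if_true]
  refine Finset.sum_congr rfl fun i _ => ?_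
  simp
  field_simp

lemma IsMetric.pd_trDev (hg : IsMetric g) (hx : x ∈ upperHalfSpace) (k : Fin 3) :
    pd k (trDev g) x = (x 2)⁻¹ * ∑ i, frameDer g x k i i := by
  have hz : (0 : ℝ) < x 2 := hx
  have h1 : trDev g =ᶠ[𝓝 x] fun y => ∑ i, (y 2 ^ 2 * g y i i - 1) := by
    filter_upwards [isOpen_upperHalfSpace.mem_nhds hx] with y hy
    rw [trDev_eq hy]
    simp [frameDev]
  have h2 : ∀ i, HasFDerivAt (fun y => y 2 ^ 2 * g y i i - 1)
      (x 2 ^ 2 • fderiv ℝ (fun y => g y i i) x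
        + g x i i • ((2 * x 2) • (EuclideanSpace.proj 2 : E3 →L[ℝ] ℝ))) x := fun i => by
    refine HasFDerivAt.sub_const (1 : ℝ) ?_
    refine HasFDerivAt.mul ?_ (hg.differentiableAt hx i i).hasFDerivAt
    have := (hasDerivAt_pow 2 (x 2)).comp_hasFDerivAt x (hasFDerivAt_coord 2 x)
    refine (this.congr_of_eventuallyEq (Eventually.of_forall fun y => rfl)).congr_fderiv ?_
    simp
  have h3 : (EuclideanSpace.proj 2 : E3 →L[ℝ] ℝ) (EuclideanSpace.single k 1)
      = if k = 2 then 1 else 0 := by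
    by_cases hk : k = 2
    · simp [hk]
    · simp [hk, Ne.symm hk]
  rw [pd, h1.fderiv_eq, (HasFDerivAt.fun_sum fun i _ => h2 i).fderiv, sum_apply, Finset.mul_sum]
  refine Finset.sum_congr rfl fun i _ => ?_
  rw [add_apply, smul_apply, smul_apply, smul_apply, h3, frameDer]
  simp only [smul_eq_mul, pd]
  field_simp

lemma IsMetric.divDev_eq (hg : IsMetric g) (hx : x ∈ upperHalfSpace) (i : Fin 3) :
    divDev g x i = (x 2)⁻¹ * (∑ j, frameDer g x j j i - 3 * frameDev g x 2 i
      + (if i = 2 then 1 else 0) * ∑ j, frameDev g x j j) := by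
  have hz : (0 : ℝ) < x 2 := hx
  have h1 : divDev g x i = ∑ j, (x 2)⁻¹ *
      (x 2 ^ 3 * covDeriv hypMetric (deviation g) x ![j, j, i]) := by
    simp only [divDev, hypMetric_inv_apply hx]
    simp only [mul_ite, ite_mul, mul_one, mul_zero, zero_mul, Finset.sum_ite_eq, Finset.mem_univ,
      if_true]
    refine Finset.sum_congr rfl fun j _ => ?_
    field_simp
  rw [h1]
  simp only [covDeriv_deviation hg hx, ← Finset.mul_sum]
  simp only [Finset.sum_add_distrib, Finset.sum_sub_distrib, ite_mul, one_mul, zero_mul,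
    Finset.sum_ite_eq', Finset.mem_univ, if_true]
  rw [frameDev_symm hg hx i 2]
  congr 1
  split_ifs <;> simp <;> ring

/-- The mass integrand on the normal of a plane, in the frame. -/
lemma IsMetric.massIntegrand_normal (hg : IsMetric g) (hx : x ∈ upperHalfSpace) (ha : ‖a‖ = 1) :
    ∑ i, massIntegrand g x i * unitNormal hypMetric a x i
      = (x 2)⁻¹ * (∑ i, ∑ j, a i * frameDer g x j j i - ∑ l, ∑ i, a l * frameDer g x l i i
        - 2 * ∑ i, frameDev g x 2 i * a i) := by
  have hz : (0 : ℝ) < x 2 := hx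
  have h0 : ∀ i, ∑ j, gradPotential x j * deviation g x ![j, i]
      = -((x 2 ^ 2)⁻¹ * frameDev g x 2 i) := fun i => by
    simp only [gradPotential_eq hx, deviation_eq hx]
    simp
  have h1 : ∀ i, massIntegrand g x i * unitNormal hypMetric a x i
      = (x 2)⁻¹ * (a i * ∑ j, frameDer g x j j i - a i * ∑ j, frameDer g x i j j
        - 2 * (frameDev g x 2 i * a i)) := fun i => by
    rw [massIntegrand, h0, hg.divDev_eq hx, hg.pd_trDev hx, trDev_eq hx, pd_potential hx,
      unitNormal_hypMetric hx ha, potential]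
    field_simp
    ring
  simp only [h1, ← Finset.mul_sum, Finset.sum_sub_distrib]

/-- The vector field `Y_a^i = g_{ij} a_j` whose tangential part, on a plane with Euclidean normal
`a`, is up to the conformal factor the tangential part of `V e(ν̄, ·)`. -/
def normalField (g : MetricField) (a x : E3) : E3 := WithLp.toLp 2 fun i => ∑ j, g x i j * a j

lemma IsMetric.contDiffOn_normalField (hg : IsMetric g) (a : E3) :
    ContDiffOn ℝ 1 (normalField g a) upperHalfSpace := by
  rw [contDiffOn_euclidean]
  intro i
  have h : ∀ j, ContDiffOn ℝ 1 (fun x => g x i j) upperHalfSpace := fun j =>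
    (hg.contDiffOn i j).of_le (by norm_num)
  change ContDiffOn ℝ 1 (fun x => ∑ j, g x i j * a j) upperHalfSpace
  exact ContDiffOn.sum fun j _ => (h j).mul contDiffOn_const

/-- The divergence of the field `Y_a` along the plane, in the frame. -/
lemma IsMetric.tangentialDiv_normalField (hg : IsMetric g) (hx : x ∈ upperHalfSpace)
    (ha : ‖a‖ = 1) :
    x 2 ^ 2 * tangentialDiv a (normalField g a) x
      = (x 2)⁻¹ * ∑ i, ∑ j, ((if i = j then 1 else 0) - a i * a j) *
        (∑ l, frameDer g x i j l * a l
          - 2 * (if i = 2 then 1 else 0) * ∑ l, frameDev g x j l * a l) := by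
  have hz : (0 : ℝ) < x 2 := hx
  have hd : DifferentiableAt ℝ (normalField g a) x :=
    ((hg.contDiffOn_normalField a).contDiffAt (isOpen_upperHalfSpace.mem_nhds hx)).differentiableAt
      one_ne_zero
  have hcomp : ∀ i v, fderiv ℝ (normalField g a) x v i
      = ∑ j, a j * fderiv ℝ (fun y => g y i j) x v := by
    intro i v
    have h1 : HasFDerivAt (fun y => normalField g a y i)
        ((EuclideanSpace.proj i : E3 →L[ℝ] ℝ).comp (fderiv ℝ (normalField g a) x)) x :=
      (EuclideanSpace.proj i : E3 →L[ℝ] ℝ).hasFDerivAt.comp x hd.hasFDerivAt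
    have h2 : HasFDerivAt (fun y => normalField g a y i)
        (∑ j, a j • fderiv ℝ (fun y => g y i j) x) x := by
      change HasFDerivAt (fun y => ∑ j, g y i j * a j) _ x
      refine HasFDerivAt.fun_sum fun j _ => ?_
      exact (hg.differentiableAt hx i j).hasFDerivAt.mul_const (a j)
    have h3 := DFunLike.congr_fun (h1.unique h2) v
    rw [sum_apply] at h3
    simpa using h3
  have hvec : ∀ f : E3 →L[ℝ] ℝ, f a = ∑ k, a k * f (EuclideanSpace.single k 1) := fun f => by
    conv_lhs => rw [← (EuclideanSpace.basisFun (Fin 3) ℝ).sum_repr a]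
    rw [map_sum]
    refine Finset.sum_congr rfl fun i _ => ?_
    simp
  have h1 : tangentialDiv a (normalField g a) x = ∑ i, ∑ j, ((if i = j then 1 else 0) - a i * a j) *
      ∑ l, a l * pd i (fun y => g y j l) x := by
    have e1 : ⟪fderiv ℝ (normalField g a) x a, a⟫
        = ∑ i, ∑ j, a i * a j * ∑ l, a l * pd i (fun y => g y j l) x := by
      rw [Finset.sum_comm, PiLp.inner_apply]
      refine Finset.sum_congr rfl fun j _ => ?_
      rw [hcomp]
      simp only [hvec (fderiv ℝ _ x)]
      rw [RCLike.inner_apply, conj_trivial]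
      simp only [Finset.mul_sum, pd]
      rw [Finset.sum_comm]
      refine Finset.sum_congr rfl fun i _ => Finset.sum_congr rfl fun l _ => ?_
      ring
    rw [tangentialDiv, e1]
    simp only [hcomp, sub_mul, Finset.sum_sub_distrib, ite_mul, one_mul, zero_mul,
      Finset.sum_ite_eq, Finset.mem_univ, if_true, pd]
  have h2 : ∀ i j, ∑ l, a l * pd i (fun y => g y j l) x = (x 2 ^ 3)⁻¹ *
      (∑ l, frameDer g x i j l * a l
          - 2 * (if i = 2 then 1 else 0) * ∑ l, frameDev g x j l * a l)
      - 2 * (x 2 ^ 3)⁻¹ * (if i = 2 then 1 else 0) * a j := by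
    intro i j
    have e : ∀ l, a l * pd i (fun y => g y j l) x = (x 2 ^ 3)⁻¹ * (frameDer g x i j l * a l
        - 2 * (if i = 2 then 1 else 0) * (frameDev g x j l * a l))
        - 2 * (x 2 ^ 3)⁻¹ * (if i = 2 then 1 else 0) * (if j = l then a l else 0) := by
      intro l
      rw [pd_eq_frameDer hx, frameDev]
      split_ifs <;> field_simp <;> ring
    simp only [e, Finset.sum_sub_distrib, ← Finset.mul_sum, Finset.sum_ite_eq, Finset.mem_univ,
      if_true]
  -- The constant part of the metric contributes nothing, as `a` is normal to the plane.
  have h3 : ∀ i, ∑ j, ((if i = j then 1 else 0) - a i * a j) *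
      (2 * (x 2 ^ 3)⁻¹ * (if i = 2 then 1 else 0) * a j) = 0 := by
    intro i
    have e : ∀ j, ((if i = j then 1 else 0) - a i * a j) *
      (2 * (x 2 ^ 3)⁻¹ * (if i = 2 then 1 else 0) * a j)
      = (2 * (x 2 ^ 3)⁻¹ * (if i = 2 then 1 else 0)) * ((if i = j then a j else 0)
        - a i * (a j * a j)) := by
      intro j
      split_ifs <;> ring
    simp only [e, ← Finset.mul_sum, Finset.sum_sub_distrib, Finset.sum_ite_eq, Finset.mem_univ,
      if_true, sum_coord_sq ha]
    ring
  rw [h1]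
  simp only [h2, mul_sub _ (_ * (_ - _)) _, Finset.sum_sub_distrib, h3, sub_zero,
    Finset.mul_sum (s := Finset.univ) (a := x 2 ^ 2),
    Finset.mul_sum (s := Finset.univ) (a := (x 2)⁻¹)]
  refine Finset.sum_congr rfl fun i _ => Finset.sum_congr rfl fun j _ => ?_
  field_simp

end

/-- The algebraic identity behind the expansion of the mass integrand: up to products of two small
quantities, the sum of the mass integrand, of the mean curvature difference and of the divergence
vanishes. Here `h`, `ν` are the tangential inverse metric and the normal, `E` is the deviation and
`D` its derivative. -/
lemma face_identity (h : Fin 3 → Fin 3 → ℝ) (ν a : Fin 3 → ℝ) (E : Fin 3 → Fin 3 → ℝ)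
    (D : Fin 3 → Fin 3 → Fin 3 → ℝ) (hD : ∀ k i j, D k i j = D k j i) :
    2 * (∑ i, ∑ j, h i j * ∑ l, ν l * (1 / 2 * D l i j - D i j l) - 2 * ν 2 - (-2 * a 2))
      + (∑ i, ∑ j, a i * D j j i - ∑ l, ∑ i, a l * D l i i - 2 * ∑ i, E 2 i * a i)
      + ∑ i, ∑ j, ((if i = j then 1 else 0) - a i * a j) * (∑ l, D i j l * a l
          - 2 * (if i = 2 then 1 else 0) * ∑ l, E j l * a l)
    = ∑ i, ∑ j, ∑ l, (h i j * ν l - ((if i = j then 1 else 0) - a i * a j) * a l)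
        * (D l i j - 2 * D i j l)
      - 4 * (ν 2 - a 2 + ∑ l, E 2 l * a l - 1 / 2 * (∑ k, ∑ l, E k l * a k * a l) * a 2) := by
  have h10 : ∀ k, D k 1 0 = D k 0 1 := fun k => hD k 1 0
  have h20 : ∀ k, D k 2 0 = D k 0 2 := fun k => hD k 2 0
  have h21 : ∀ k, D k 2 1 = D k 1 2 := fun k => hD k 2 1
  simp [Fin.sum_univ_three, h10, h20, h21]
  ring

/-! ### Expansion of the unit normal and of the face terms -/

section

variable {g : MetricField} {x : E3}

/-- Cauchy-Schwarz for the metric. -/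
lemma IsMetric.gInner_sq_le (hg : IsMetric g) (hx : x ∈ upperHalfSpace) (u v : Fin 3 → ℝ) :
    gInner g x u v ^ 2 ≤ gInner g x u u * gInner g x v v := by
  have hnn : ∀ w : Fin 3 → ℝ, 0 ≤ gInner g x w w := by
    intro w
    have h := (hg.posDef x hx).posSemidef.dotProduct_mulVec_nonneg w
    refine h.trans_eq ?_
    simp only [gInner, dotProduct, Matrix.mulVec, Finset.mul_sum, star_trivial]
    exact Finset.sum_congr rfl fun i _ => Finset.sum_congr rfl fun j _ => by ring
  have hexp : ∀ t : ℝ, gInner g x (fun i => u i + t * v i) (fun i => u i + t * v i)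
      = gInner g x v v * (t * t) + (2 * gInner g x u v) * t + gInner g x u u := by
    intro t
    have h10 : g x 1 0 = g x 0 1 := hg.symm hx 1 0
    have h20 : g x 2 0 = g x 0 2 := hg.symm hx 2 0
    have h21 : g x 2 1 = g x 1 2 := hg.symm hx 2 1
    simp only [gInner, Fin.sum_univ_three, h10, h20, h21]
    ring
  have h := discrim_le_zero fun t => (hnn _).trans_eq (hexp t)
  rw [discrim] at h
  linarith

lemma IsMetric.gInner_unitNormal_self (hg : IsMetric g) {a : E3} (hx : x ∈ upperHalfSpace)
    (ha : ‖a‖ = 1) : gInner g x (unitNormal g a x) (unitNormal g a x) = 1 := by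
  rw [← hg.sum_unitNormal_sq hx ha]
  simp only [gInner, Finset.mul_sum]
  exact Finset.sum_congr rfl fun i _ => Finset.sum_congr rfl fun j _ => by ring

lemma IsMetric.gInner_unitNormal (hg : IsMetric g) (hx : x ∈ upperHalfSpace) (a : E3)
    (v : Fin 3 → ℝ) :
    gInner g x v (unitNormal g a x) = (∑ i, v i * a i) * (√(conormSq g a x))⁻¹ := by
  have h : ∀ i, ∑ j, g x i j * v i * unitNormal g a x j
      = v i * a i * (√(conormSq g a x))⁻¹ := fun i => by
    rw [mul_assoc, ← hg.sum_mul_unitNormal hx, Finset.mul_sum]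
    exact Finset.sum_congr rfl fun j _ => by ring
  simp only [gInner, h, Finset.sum_mul]

/-- The length factor `1 / √(G⁻¹(a, a))` in the unit normal is at most `√G(a, a)`. -/
lemma IsMetric.inv_frameConormSq_le (hg : IsMetric g) {a : E3} (hx : x ∈ upperHalfSpace)
    (ha : ‖a‖ = 1) :
    (√(frameConormSq g a x))⁻¹ ^ 2 ≤ 1 + ∑ i, ∑ j, frameDev g x i j * a i * a j := by
  have hz : (0 : ℝ) < x 2 := hx
  have h := hg.gInner_sq_le hx a (unitNormal g a x)
  have hone : ∑ i, a i * a i = 1 := by simpa using sum_coord_sq ha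
  rw [hg.gInner_unitNormal hx, hg.gInner_unitNormal_self hx ha, hone, one_mul, mul_one,
    conormSq_eq_frame hx, Real.sqrt_mul (by positivity), Real.sqrt_sq hz.le, mul_inv, mul_pow] at h
  have h2 : 1 + ∑ i, ∑ j, frameDev g x i j * a i * a j = x 2 ^ 2 * gInner g x a a := by
    rw [← hone]
    simp only [gInner, frameDev, Finset.mul_sum, sub_mul, Finset.sum_sub_distrib, ite_mul, one_mul,
      zero_mul, Finset.sum_ite_eq, Finset.mem_univ, if_true, add_sub_cancel]
    exact Finset.sum_congr rfl fun i _ => Finset.sum_congr rfl fun j _ => by ring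
  rw [h2]
  calc (√(frameConormSq g a x))⁻¹ ^ 2
      = x 2 ^ 2 * ((x 2)⁻¹ ^ 2 * (√(frameConormSq g a x))⁻¹ ^ 2) := by field_simp
    _ ≤ _ := by gcongr

/-- The second order Taylor estimate of `N ↦ 1 / √N` at `1`. -/
lemma abs_inv_sqrt_sub_le {N : ℝ} (hN : 0 < N) :
    |(√N)⁻¹ - 1 - (1 - N) / 2| ≤ (√N)⁻¹ * (1 - N) ^ 2 := by
  obtain ⟨r, hr, rfl⟩ : ∃ r : ℝ, 0 < r ∧ N = r ^ 2 :=
    ⟨√N, Real.sqrt_pos.2 hN, (Real.sq_sqrt hN.le).symm⟩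
  rw [Real.sqrt_sq hr.le]
  have h : r⁻¹ - 1 - (1 - r ^ 2) / 2 = r⁻¹ * ((1 - r) ^ 2 * (r + 2) / 2) := by
    field_simp
    ring
  rw [h, abs_of_nonneg (by positivity)]
  gcongr
  have h2 : (1 - r ^ 2) ^ 2 - (1 - r) ^ 2 * (r + 2) / 2
      = (1 - r) ^ 2 * (r ^ 2 + 3 / 2 * r) := by ring
  have h3 : 0 ≤ (1 - r) ^ 2 * (r ^ 2 + 3 / 2 * r) := by positivity
  linarith

end

section

variable {τ : ℝ} {g : MetricField} {α : Type*} {l : Filter α} {X a : α → E3}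

/-- The value `E(a, a)` of the deviation in the frame. -/
def frameDevSq (g : MetricField) (a x : E3) : ℝ := ∑ i, ∑ j, frameDev g x i j * a i * a j

lemma isBigO_coord (ha : ∀ᶠ y in l, ‖a y‖ = 1) (i : Fin 3) :
    (fun y => a y i) =O[l] fun _ => (1 : ℝ) := by
  refine IsBigO.of_bound 1 (ha.mono fun y hy => ?_)
  rw [norm_one, mul_one, ← hy]
  exact PiLp.norm_apply_le _ _

lemma isBigO_mul_one {f u v : α → ℝ} (hf : f =O[l] u) (hv : v =O[l] fun _ => (1 : ℝ)) :
    (fun y => f y * v y) =O[l] u := by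
  simpa using hf.mul hv

lemma isBigO_weight_comp (hτ : 0 < τ) :
    (fun y => weight τ (X y)) =O[l] fun _ => (1 : ℝ) :=
  (isBigO_weight_one hτ ⊤).comp_tendsto tendsto_top

lemma isBigO_weight_mul (hτ : 0 < τ) :
    (fun y => weight τ (X y) * weight τ (X y)) =O[l] fun y => weight τ (X y) := by
  simpa using (isBigO_refl (fun y => weight τ (X y)) l).mul (isBigO_weight_comp (X := X) hτ)

lemma isBigO_frameDevSq (hτ : 0 < τ) (hg : IsAsymptoticallyHyperbolic τ g)
    (hX : Tendsto X l (𝓟 upperHalfSpace)) (ha : ∀ᶠ y in l, ‖a y‖ = 1) :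
    (fun y => frameDevSq g (a y) (X y)) =O[l] fun y => weight τ (X y) := by
  refine isBigO_sum fun i => isBigO_sum fun j => ?_
  simpa using ((((isBigO_frameDev hτ hg i j).comp_tendsto hX).mul (isBigO_coord ha i)).mul
    (isBigO_coord ha j))

lemma isBigO_frameConormSq_sub_add (hτ : 0 < τ) (hg : IsAsymptoticallyHyperbolic τ g)
    (hX : Tendsto X l (𝓟 upperHalfSpace)) (ha : ∀ᶠ y in l, ‖a y‖ = 1) :
    (fun y => frameConormSq g (a y) (X y) - 1 + frameDevSq g (a y) (X y))
      =O[l] fun y => weight τ (X y) * weight τ (X y) := by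
  have h : (fun y => ∑ i, ∑ j, (frameInv g (X y) i j - (if i = j then 1 else 0)
      + frameDev g (X y) i j) * a y i * a y j)
      =O[l] fun y => weight τ (X y) * weight τ (X y) := by
    refine isBigO_sum fun i => isBigO_sum fun j => ?_
    simpa using ((((isBigO_frameInv_sub_add hτ hg i j).comp_tendsto hX).mul
      (isBigO_coord ha i)).mul (isBigO_coord ha j))
  refine h.congr' (ha.mono fun y hy => ?_) .rfl
  simp only [frameConormSq, frameDevSq, add_mul, sub_mul, Finset.sum_add_distrib,
    Finset.sum_sub_distrib]
  simp [sum_coord_sq hy]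

lemma isBigO_frameConormSq_sub (hτ : 0 < τ) (hg : IsAsymptoticallyHyperbolic τ g)
    (hX : Tendsto X l (𝓟 upperHalfSpace)) (ha : ∀ᶠ y in l, ‖a y‖ = 1) :
    (fun y => 1 - frameConormSq g (a y) (X y)) =O[l] fun y => weight τ (X y) := by
  refine ((isBigO_frameDevSq hτ hg hX ha).sub ((isBigO_frameConormSq_sub_add hτ hg hX ha).trans
    (isBigO_weight_mul hτ))).congr_left fun y => ?_
  ring

lemma isBigO_inv_sqrt_one (hτ : 0 < τ) (hg : IsAsymptoticallyHyperbolic τ g)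
    (hX : Tendsto X l (𝓟 upperHalfSpace)) (ha : ∀ᶠ y in l, ‖a y‖ = 1) :
    (fun y => (√(frameConormSq g (a y) (X y)))⁻¹) =O[l] fun _ => (1 : ℝ) := by
  have h1 : (fun y => 1 + frameDevSq g (a y) (X y)) =O[l] fun _ => (1 : ℝ) :=
    (isBigO_refl _ l).add ((isBigO_frameDevSq hτ hg hX ha).trans (isBigO_weight_comp hτ))
  have h2 : (fun y => (√(frameConormSq g (a y) (X y)))⁻¹ ^ 2) =O[l] fun _ => (1 : ℝ) ^ 2 := by
    rw [one_pow]
    refine IsBigO.trans (IsBigO.of_bound 1 ?_) h1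
    filter_upwards [ha, tendsto_principal.1 hX] with y hy hx
    have := hg.isMetric.inv_frameConormSq_le hx hy
    rw [one_mul, Real.norm_eq_abs, Real.norm_eq_abs, abs_of_nonneg (by positivity)]
    exact this.trans (le_abs_self _)
  exact h2.of_pow two_ne_zero

/-- `1 / √(G⁻¹(a, a)) = 1 + E(a, a) / 2 + O(|E|²)`. -/
lemma isBigO_inv_sqrt_sub (hτ : 0 < τ) (hg : IsAsymptoticallyHyperbolic τ g)
    (hX : Tendsto X l (𝓟 upperHalfSpace)) (ha : ∀ᶠ y in l, ‖a y‖ = 1) :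
    (fun y => (√(frameConormSq g (a y) (X y)))⁻¹ - 1 - 1 / 2 * frameDevSq g (a y) (X y))
      =O[l] fun y => weight τ (X y) * weight τ (X y) := by
  have h1 := isBigO_frameConormSq_sub hτ hg hX ha
  have h2 : (fun y => (√(frameConormSq g (a y) (X y)))⁻¹ - 1
      - (1 - frameConormSq g (a y) (X y)) / 2)
      =O[l] fun y => weight τ (X y) * weight τ (X y) := by
    have h3 : (fun y => (√(frameConormSq g (a y) (X y)))⁻¹ * (1 - frameConormSq g (a y) (X y)) ^ 2)
        =O[l] fun y => weight τ (X y) * weight τ (X y) := by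
      simpa [sq] using (isBigO_inv_sqrt_one hτ hg hX ha).mul (h1.mul h1)
    refine IsBigO.trans (IsBigO.of_bound 1 ?_) h3
    filter_upwards [ha, tendsto_principal.1 hX] with y hy hx
    rw [one_mul]
    exact (abs_inv_sqrt_sub_le (hg.isMetric.frameConormSq_pos hx hy)).trans (le_abs_self _)
  refine (h2.sub ((isBigO_frameConormSq_sub_add hτ hg hX ha).const_mul_left (1 / 2))).congr_left
    fun y => ?_
  ring

lemma isBigO_inv_sqrt_sub_one (hτ : 0 < τ) (hg : IsAsymptoticallyHyperbolic τ g)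
    (hX : Tendsto X l (𝓟 upperHalfSpace)) (ha : ∀ᶠ y in l, ‖a y‖ = 1) :
    (fun y => (√(frameConormSq g (a y) (X y)))⁻¹ - 1) =O[l] fun y => weight τ (X y) := by
  refine (((isBigO_inv_sqrt_sub hτ hg hX ha).trans (isBigO_weight_mul hτ)).add
    ((isBigO_frameDevSq hτ hg hX ha).const_mul_left (1 / 2))).congr_left fun y => ?_
  ring

lemma isBigO_frameNormal_one (hτ : 0 < τ) (hg : IsAsymptoticallyHyperbolic τ g)
    (hX : Tendsto X l (𝓟 upperHalfSpace)) (ha : ∀ᶠ y in l, ‖a y‖ = 1) (i : Fin 3) :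
    (fun y => frameNormal g (a y) (X y) i) =O[l] fun _ => (1 : ℝ) := by
  have h : (fun y => ∑ j, frameInv g (X y) i j * a y j) =O[l] fun _ => (1 : ℝ) := by
    refine isBigO_sum fun j => ?_
    simpa using ((isBigO_frameInv_one hτ hg i j).comp_tendsto hX).mul (isBigO_coord ha j)
  exact isBigO_mul_one h (isBigO_inv_sqrt_one hτ hg hX ha)

/-- `ν = a - E a + E(a, a) a / 2 + O(|E|²)`. -/
lemma isBigO_frameNormal_sub_add (hτ : 0 < τ) (hg : IsAsymptoticallyHyperbolic τ g)
    (hX : Tendsto X l (𝓟 upperHalfSpace)) (ha : ∀ᶠ y in l, ‖a y‖ = 1) (i : Fin 3) :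
    (fun y => frameNormal g (a y) (X y) i - a y i + ∑ j, frameDev g (X y) i j * a y j
      - 1 / 2 * frameDevSq g (a y) (X y) * a y i)
      =O[l] fun y => weight τ (X y) * weight τ (X y) := by
  have h1 : (fun y => ∑ j, (frameInv g (X y) i j - (if i = j then 1 else 0)
      + frameDev g (X y) i j) * a y j) =O[l] fun y => weight τ (X y) * weight τ (X y) := by
    refine isBigO_sum fun j => ?_
    simpa using ((isBigO_frameInv_sub_add hτ hg i j).comp_tendsto hX).mul (isBigO_coord ha j)
  have h2 : (fun y => ∑ j, frameDev g (X y) i j * a y j) =O[l] fun y => weight τ (X y) := by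
    refine isBigO_sum fun j => ?_
    simpa using ((isBigO_frameDev hτ hg i j).comp_tendsto hX).mul (isBigO_coord ha j)
  have h3 : (fun y => (∑ j, (frameInv g (X y) i j - (if i = j then 1 else 0)
      + frameDev g (X y) i j) * a y j) * (√(frameConormSq g (a y) (X y)))⁻¹)
      =O[l] fun y => weight τ (X y) * weight τ (X y) := by
    simpa using h1.mul (isBigO_inv_sqrt_one hτ hg hX ha)
  have h4 : (fun y => ((√(frameConormSq g (a y) (X y)))⁻¹ - 1 - 1 / 2 * frameDevSq g (a y) (X y))
      * a y i) =O[l] fun y => weight τ (X y) * weight τ (X y) := by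
    simpa using (isBigO_inv_sqrt_sub hτ hg hX ha).mul (isBigO_coord ha i)
  refine ((h3.sub ((isBigO_inv_sqrt_sub_one hτ hg hX ha).mul h2)).add h4).congr_left fun y => ?_
  simp only [add_mul, sub_mul, Finset.sum_add_distrib, Finset.sum_sub_distrib, frameNormal,
    ite_mul, one_mul, zero_mul, Finset.sum_ite_eq, Finset.mem_univ, if_true]
  ring

lemma isBigO_frameNormal_sub (hτ : 0 < τ) (hg : IsAsymptoticallyHyperbolic τ g)
    (hX : Tendsto X l (𝓟 upperHalfSpace)) (ha : ∀ᶠ y in l, ‖a y‖ = 1) (i : Fin 3) :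
    (fun y => frameNormal g (a y) (X y) i - a y i) =O[l] fun y => weight τ (X y) := by
  have h2 : (fun y => ∑ j, frameDev g (X y) i j * a y j) =O[l] fun y => weight τ (X y) := by
    refine isBigO_sum fun j => ?_
    simpa using ((isBigO_frameDev hτ hg i j).comp_tendsto hX).mul (isBigO_coord ha j)
  have h3 : (fun y => 1 / 2 * frameDevSq g (a y) (X y) * a y i) =O[l] fun y => weight τ (X y) := by
    simpa using ((isBigO_frameDevSq hτ hg hX ha).const_mul_left (1 / 2)).mul (isBigO_coord ha i)
  refine ((((isBigO_frameNormal_sub_add hτ hg hX ha i).trans (isBigO_weight_mul hτ)).sub h2).add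
    h3).congr_left fun y => ?_
  ring

lemma isBigO_frameTangentInv_sub (hτ : 0 < τ) (hg : IsAsymptoticallyHyperbolic τ g)
    (hX : Tendsto X l (𝓟 upperHalfSpace)) (ha : ∀ᶠ y in l, ‖a y‖ = 1) (i j : Fin 3) :
    (fun y => frameTangentInv g (a y) (X y) i j - ((if i = j then 1 else 0) - a y i * a y j))
      =O[l] fun y => weight τ (X y) := by
  have h1 := (isBigO_frameInv_sub hτ hg i j).comp_tendsto hX
  have h2 : (fun y => (frameNormal g (a y) (X y) i - a y i) * frameNormal g (a y) (X y) j)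
      =O[l] fun y => weight τ (X y) := by
    simpa using (isBigO_frameNormal_sub hτ hg hX ha i).mul (isBigO_frameNormal_one hτ hg hX ha j)
  have h3 : (fun y => a y i * (frameNormal g (a y) (X y) j - a y j))
      =O[l] fun y => weight τ (X y) := by
    simpa using (isBigO_coord ha i).mul (isBigO_frameNormal_sub hτ hg hX ha j)
  refine ((h1.sub h2).sub h3).congr_left fun y => ?_
  simp only [Function.comp, frameTangentInv]
  ring

/-- The first order part of the product of the tangential inverse metric and the normal. -/
lemma isBigO_tangentInv_mul_normal_sub (hτ : 0 < τ) (hg : IsAsymptoticallyHyperbolic τ g)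
    (hX : Tendsto X l (𝓟 upperHalfSpace)) (ha : ∀ᶠ y in l, ‖a y‖ = 1) (i j k : Fin 3) :
    (fun y => frameTangentInv g (a y) (X y) i j * frameNormal g (a y) (X y) k
      - ((if i = j then 1 else 0) - a y i * a y j) * a y k) =O[l] fun y => weight τ (X y) := by
  have h1 : (fun y => (if i = j then 1 else 0) - a y i * a y j) =O[l] fun _ => (1 : ℝ) := by
    refine (isBigO_const_const _ one_ne_zero l).sub ?_
    simpa using (isBigO_coord ha i).mul (isBigO_coord ha j)
  have h2 : (fun y => (frameTangentInv g (a y) (X y) i j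
      - ((if i = j then 1 else 0) - a y i * a y j)) * frameNormal g (a y) (X y) k)
      =O[l] fun y => weight τ (X y) := by
    simpa using (isBigO_frameTangentInv_sub hτ hg hX ha i j).mul
      (isBigO_frameNormal_one hτ hg hX ha k)
  have h3 : (fun y => ((if i = j then 1 else 0) - a y i * a y j)
      * (frameNormal g (a y) (X y) k - a y k)) =O[l] fun y => weight τ (X y) := by
    simpa using h1.mul (isBigO_frameNormal_sub hτ hg hX ha k)
  refine (h2.add h3).congr_left fun y => ?_
  ring

/-- The density, with respect to the hyperbolic area, of the flux of the mass integrand through a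
plane with normal `a`. -/
def massDensity (g : MetricField) (a x : E3) : ℝ :=
  ∑ i, massIntegrand g x i * unitNormal hypMetric a x i

/-- The sum of the flux of the mass integrand, of `2 V (H - H̄)` and of the divergence of
`normalField`. -/
def faceError (g : MetricField) (a x : E3) : ℝ :=
  massDensity g a x + 2 * potential x * (meanCurvature g a x - meanCurvature hypMetric a x)
    + x 2 ^ 2 * tangentialDiv a (normalField g a) x

/-- The face error is quadratic in the deviation. -/
lemma isBigO_faceError (hτ : 0 < τ) (hg : IsAsymptoticallyHyperbolic τ g)
    (hX : Tendsto X l (𝓟 upperHalfSpace)) (ha : ∀ᶠ y in l, ‖a y‖ = 1) :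
    (fun y => X y 2 * faceError g (a y) (X y))
      =O[l] fun y => weight τ (X y) * weight τ (X y) := by
  have hD := fun k i j => (isBigO_frameDer hτ hg k i j).comp_tendsto hX
  have h1 : (fun y => ∑ i, ∑ j, ∑ k, (frameTangentInv g (a y) (X y) i j
      * frameNormal g (a y) (X y) k - ((if i = j then 1 else 0) - a y i * a y j) * a y k)
      * (frameDer g (X y) k i j - 2 * frameDer g (X y) i j k))
      =O[l] fun y => weight τ (X y) * weight τ (X y) := by
    refine isBigO_sum fun i => isBigO_sum fun j => isBigO_sum fun k => ?_
    exact (isBigO_tangentInv_mul_normal_sub hτ hg hX ha i j k).mul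
      ((hD k i j).sub ((hD i j k).const_mul_left 2))
  have h2 := (isBigO_frameNormal_sub_add hτ hg hX ha 2).const_mul_left 4
  refine (h1.sub h2).congr' ?_ .rfl
  filter_upwards [ha, tendsto_principal.1 hX] with y hy hx
  have hz : (0 : ℝ) < X y 2 := hx
  rw [faceError, massDensity, hg.isMetric.massIntegrand_normal hx hy,
    hg.isMetric.tangentialDiv_normalField hx hy, meanCurvature_hypMetric hx hy,
    hg.isMetric.meanCurvature_eq_frame hx hy, potential]
  have h := face_identity (frameTangentInv g (a y) (X y)) (frameNormal g (a y) (X y)) (a y)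
    (frameDev g (X y)) (frameDer g (X y)) (frameDer_symm hg.isMetric hx)
  rw [show ∀ A B C : ℝ, X y 2 * ((X y 2)⁻¹ * A + 2 * (1 / X y 2) * B + (X y 2)⁻¹ * C)
    = 2 * B + A + C from fun A B C => by field_simp; ring, h]
  rfl

/-- The mean curvature of planes is bounded. -/
lemma isBigO_meanCurvature (hτ : 0 < τ) (hg : IsAsymptoticallyHyperbolic τ g)
    (hX : Tendsto X l (𝓟 upperHalfSpace)) (ha : ∀ᶠ y in l, ‖a y‖ = 1) :
    (fun y => meanCurvature g (a y) (X y)) =O[l] fun _ => (1 : ℝ) := by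
  have hw := isBigO_weight_comp (X := X) (l := l) hτ
  have hD := fun k i j => ((isBigO_frameDer hτ hg k i j).comp_tendsto hX).trans hw
  have hn := isBigO_frameNormal_one hτ hg hX ha
  have hG := fun i j => (isBigO_frameInv_one hτ hg i j).comp_tendsto hX
  have h1 : (fun y => ∑ i, ∑ j, frameTangentInv g (a y) (X y) i j *
      ∑ k, frameNormal g (a y) (X y) k * (1 / 2 * frameDer g (X y) k i j - frameDer g (X y) i j k))
      =O[l] fun _ => (1 : ℝ) := by
    refine isBigO_sum fun i => isBigO_sum fun j => ?_
    have h2 : (fun y => frameTangentInv g (a y) (X y) i j) =O[l] fun _ => (1 : ℝ) := by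
      exact (hG i j).sub (isBigO_mul_one (hn i) (hn j))
    have h3 : (fun y => ∑ k, frameNormal g (a y) (X y) k * (1 / 2 * frameDer g (X y) k i j
        - frameDer g (X y) i j k)) =O[l] fun _ => (1 : ℝ) := by
      refine isBigO_sum fun k => ?_
      exact isBigO_mul_one (hn k) (((hD k i j).const_mul_left (1 / 2)).sub (hD i j k))
    exact isBigO_mul_one h2 h3
  refine (h1.sub ((hn 2).const_mul_left 2)).congr' ?_ .rfl
  filter_upwards [ha, tendsto_principal.1 hX] with y hy hx
  exact (hg.isMetric.meanCurvature_eq_frame hx hy).symm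

/-- The divergence of `normalField` on planes is bounded by a multiple of `z⁻³`. -/
lemma isBigO_tangentialDiv_normalField (hτ : 0 < τ) (hg : IsAsymptoticallyHyperbolic τ g)
    (hX : Tendsto X l (𝓟 upperHalfSpace)) (ha : ∀ᶠ y in l, ‖a y‖ = 1) :
    (fun y => X y 2 ^ 3 * tangentialDiv (a y) (normalField g (a y)) (X y))
      =O[l] fun _ => (1 : ℝ) := by
  have hw := isBigO_weight_comp (X := X) (l := l) hτ
  have hD := fun k i j => ((isBigO_frameDer hτ hg k i j).comp_tendsto hX).trans hw
  have hE := fun i j => ((isBigO_frameDev hτ hg i j).comp_tendsto hX).trans hw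
  have h1 : (fun y => ∑ i, ∑ j, ((if i = j then 1 else 0) - a y i * a y j) *
        (∑ k, frameDer g (X y) i j k * a y k
          - 2 * (if i = 2 then 1 else 0) * ∑ k, frameDev g (X y) j k * a y k))
      =O[l] fun _ => (1 : ℝ) := by
    refine isBigO_sum fun i => isBigO_sum fun j => ?_
    have h2 : (fun y => (if i = j then 1 else 0) - a y i * a y j) =O[l] fun _ => (1 : ℝ) := by
      refine (isBigO_const_const _ one_ne_zero l).sub ?_
      exact isBigO_mul_one (isBigO_coord ha i) (isBigO_coord ha j)
    have h3 : (fun y => ∑ k, frameDer g (X y) i j k * a y k) =O[l] fun _ => (1 : ℝ) :=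
      isBigO_sum fun k => isBigO_mul_one (hD i j k) (isBigO_coord ha k)
    have h4 : (fun y => ∑ k, frameDev g (X y) j k * a y k) =O[l] fun _ => (1 : ℝ) :=
      isBigO_sum fun k => isBigO_mul_one (hE j k) (isBigO_coord ha k)
    exact isBigO_mul_one h2 (h3.sub (h4.const_mul_left _))
  refine h1.congr' ?_ .rfl
  filter_upwards [ha, tendsto_principal.1 hX] with y hy hx
  have hz : (0 : ℝ) < X y 2 := hx
  have h := hg.isMetric.tangentialDiv_normalField hx hy
  rw [show X y 2 ^ 3 * tangentialDiv (a y) (normalField g (a y)) (X y)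
    = X y 2 * (X y 2 ^ 2 * tangentialDiv (a y) (normalField g (a y)) (X y)) by ring, h,
    mul_inv_cancel_left₀ hz.ne']

/-- The flux density of the mass integrand is bounded by a multiple of `V`. -/
lemma isBigO_massDensity (hτ : 0 < τ) (hg : IsAsymptoticallyHyperbolic τ g)
    (hX : Tendsto X l (𝓟 upperHalfSpace)) (ha : ∀ᶠ y in l, ‖a y‖ = 1) :
    (fun y => X y 2 * massDensity g (a y) (X y)) =O[l] fun _ => (1 : ℝ) := by
  have hw := isBigO_weight_comp (X := X) (l := l) hτ
  have hD := fun k i j => ((isBigO_frameDer hτ hg k i j).comp_tendsto hX).trans hw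
  have hE := fun i j => ((isBigO_frameDev hτ hg i j).comp_tendsto hX).trans hw
  have h1 : (fun y => ∑ i, ∑ j, a y i * frameDer g (X y) j j i) =O[l] fun _ => (1 : ℝ) :=
    isBigO_sum fun i => isBigO_sum fun j => isBigO_mul_one (isBigO_coord ha i) (hD j j i)
  have h2 : (fun y => ∑ k, ∑ i, a y k * frameDer g (X y) k i i) =O[l] fun _ => (1 : ℝ) :=
    isBigO_sum fun k => isBigO_sum fun i => isBigO_mul_one (isBigO_coord ha k) (hD k i i)
  have h3 : (fun y => ∑ i, frameDev g (X y) 2 i * a y i) =O[l] fun _ => (1 : ℝ) :=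
    isBigO_sum fun i => isBigO_mul_one (hE 2 i) (isBigO_coord ha i)
  refine ((h1.sub h2).sub (h3.const_mul_left 2)).congr' ?_ .rfl
  filter_upwards [ha, tendsto_principal.1 hX] with y hy hx
  have hz : (0 : ℝ) < X y 2 := hx
  rw [massDensity, hg.isMetric.massIntegrand_normal hx hy, mul_inv_cancel_left₀ hz.ne']

end

/-! ### Expansion of the angle between two planes -/

section Angles

/-- Away from `0` and `π`, the cosine is bi-Lipschitz. -/
lemma mul_abs_sub_le_abs_cos_sub {c θ φ : ℝ} (hθ : θ ∈ Set.Icc 0 Real.pi)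
    (hφ : φ ∈ Set.Icc 0 Real.pi) (hc : c ≤ Real.sin φ) :
    c / Real.pi * |θ - φ| ≤ |Real.cos θ - Real.cos φ| := by
  have hpi := Real.pi_pos
  have h1 : c / 2 ≤ Real.sin ((θ + φ) / 2) := by
    have h := strictConcaveOn_sin_Icc.concaveOn.2 hθ hφ
      (show (0 : ℝ) ≤ 1 / 2 by norm_num) (show (0 : ℝ) ≤ 1 / 2 by norm_num) (by norm_num)
    simp only [smul_eq_mul] at h
    have h0 := Real.sin_nonneg_of_nonneg_of_le_pi hθ.1 hθ.2
    rw [show (θ + φ) / 2 = 1 / 2 * θ + 1 / 2 * φ by ring]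
    linarith
  have h2 : |θ - φ| / Real.pi ≤ |Real.sin ((θ - φ) / 2)| := by
    have hle : |(θ - φ) / 2| ≤ Real.pi / 2 := by
      rw [abs_le]
      constructor <;> linarith [hθ.1, hθ.2, hφ.1, hφ.2]
    have h := Real.mul_le_sin (abs_nonneg ((θ - φ) / 2)) hle
    have h3 : Real.sin |(θ - φ) / 2| ≤ |Real.sin ((θ - φ) / 2)| := by
      rcases abs_choice ((θ - φ) / 2) with h | h <;> rw [h]
      · exact le_abs_self _
      · rw [Real.sin_neg]
        exact neg_le_abs _
    refine le_trans (le_of_eq ?_) (h.trans h3)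
    rw [abs_div, abs_of_pos (two_pos : (0 : ℝ) < 2)]
    field_simp
  rw [Real.cos_sub_cos, abs_mul, abs_mul, abs_neg, abs_of_pos (two_pos : (0 : ℝ) < 2)]
  calc c / Real.pi * |θ - φ| = 2 * (c / 2) * (|θ - φ| / Real.pi) := by ring
    _ ≤ _ := by
      gcongr
      exact h1.trans (le_abs_self _)

lemma abs_sub_sin_le (δ : ℝ) : |δ - Real.sin δ| ≤ 2 * δ ^ 2 := by
  rcases le_total |δ| 1 with h | h
  · have h1 := Real.sin_bound h
    have h2 : |δ| ^ 5 ≤ |δ| ^ 2 := pow_le_pow_of_le_one (abs_nonneg _) h (by norm_num)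
    have h3 : |δ ^ 3| ≤ |δ| ^ 2 := by
      rw [abs_pow]
      exact pow_le_pow_of_le_one (abs_nonneg _) h (by norm_num)
    rw [sq_abs] at h2 h3
    have h4 := abs_le.1 h1
    have h5 := abs_le.1 h3
    have h6 := sq_nonneg δ
    rw [abs_le]
    constructor <;> linarith
  · have h1 : |Real.sin δ| ≤ |δ| := by simpa using Real.abs_sin_le_abs
    have h2 : |δ| ≤ δ ^ 2 := by
      rw [← sq_abs]
      nlinarith
    linarith [abs_sub δ (Real.sin δ)]

/-- The second order Taylor estimate of the inverse cosine. -/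
lemma abs_arccos_sub_add_le {c s t : ℝ} (hc0 : 0 < c) (hs : s ∈ Set.Icc (-1) 1)
    (ht : t ∈ Set.Icc (-1) 1) (hc : c ≤ √(1 - t ^ 2)) :
    |Real.arccos s - Real.arccos t + (s - t) / √(1 - t ^ 2)|
      ≤ 3 * Real.pi ^ 2 / c ^ 3 * (s - t) ^ 2 := by
  have hpi := Real.pi_pos
  set θ := Real.arccos s
  set φ := Real.arccos t
  have hsθ : s = Real.cos θ := (Real.cos_arccos hs.1 hs.2).symm
  have htφ : t = Real.cos φ := (Real.cos_arccos ht.1 ht.2).symm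
  have hsin : √(1 - t ^ 2) = Real.sin φ := (Real.sin_arccos t).symm
  rw [hsin] at hc ⊢
  have hsp : 0 < Real.sin φ := hc0.trans_le hc
  have h1 := mul_abs_sub_le_abs_cos_sub ⟨Real.arccos_nonneg s, Real.arccos_le_pi s⟩
    ⟨Real.arccos_nonneg t, Real.arccos_le_pi t⟩ hc
  change c / Real.pi * |θ - φ| ≤ |Real.cos θ - Real.cos φ| at h1
  have hsq : (θ - φ) ^ 2 ≤ Real.pi ^ 2 / c ^ 2 * (s - t) ^ 2 := by
    rw [← sq_abs (θ - φ), ← sq_abs (s - t), hsθ, htφ]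
    have h2 := pow_le_pow_left₀ (by positivity) h1 2
    calc |θ - φ| ^ 2 = Real.pi ^ 2 / c ^ 2 * (c / Real.pi * |θ - φ|) ^ 2 := by field_simp
      _ ≤ _ := by gcongr
  have hnum : |Real.sin φ * (θ - φ) + (s - t)| ≤ 3 * (θ - φ) ^ 2 := by
    set δ := θ - φ
    have e : Real.sin φ * δ + (s - t)
        = Real.cos φ * (Real.cos δ - 1) + Real.sin φ * (δ - Real.sin δ) := by
      rw [hsθ, htφ, show θ = φ + δ by simp [δ], Real.cos_add]
      ring
    have h3 : |Real.cos φ * (Real.cos δ - 1)| ≤ δ ^ 2 := by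
      rw [abs_mul]
      have h4 : |Real.cos δ - 1| ≤ δ ^ 2 := by
        rw [abs_sub_comm, abs_of_nonneg (by linarith [Real.cos_le_one δ])]
        linarith [Real.one_sub_sq_div_two_le_cos (x := δ), sq_nonneg δ]
      calc _ ≤ 1 * |Real.cos δ - 1| := by gcongr; exact Real.abs_cos_le_one φ
        _ ≤ _ := by rwa [one_mul]
    have h5 : |Real.sin φ * (δ - Real.sin δ)| ≤ 2 * δ ^ 2 := by
      rw [abs_mul]
      calc _ ≤ 1 * |δ - Real.sin δ| := by gcongr; exact Real.abs_sin_le_one φ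
        _ ≤ _ := by rw [one_mul]; exact abs_sub_sin_le δ
    rw [e]
    linarith [abs_add_le (Real.cos φ * (Real.cos δ - 1)) (Real.sin φ * (δ - Real.sin δ))]
  have e : θ - φ + (s - t) / Real.sin φ = (Real.sin φ * (θ - φ) + (s - t)) / Real.sin φ := by
    field_simp
  rw [e, abs_div, abs_of_pos hsp]
  calc |Real.sin φ * (θ - φ) + (s - t)| / Real.sin φ ≤ 3 * (θ - φ) ^ 2 / c := by gcongr
    _ ≤ 3 * (Real.pi ^ 2 / c ^ 2 * (s - t) ^ 2) / c := by gcongr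
    _ = _ := by field_simp

end Angles

section

variable {g : MetricField} {x a b : E3}

lemma inner_eq_sum (a b : E3) : ⟪a, b⟫ = ∑ i, a i * b i := by
  rw [PiLp.inner_apply]
  exact Finset.sum_congr rfl fun i _ => by rw [RCLike.inner_apply, conj_trivial, mul_comm]

lemma IsMetric.gInner_unitNormal_eq_frame (hg : IsMetric g) (hx : x ∈ upperHalfSpace) (a b : E3) :
    gInner g x (unitNormal g a x) (unitNormal g b x)
      = (∑ i, frameNormal g a x i * b i) * (√(frameConormSq g b x))⁻¹ := by
  have hz : (0 : ℝ) < x 2 := hx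
  rw [hg.gInner_unitNormal hx, conormSq_eq_frame hx, Real.sqrt_mul (by positivity),
    Real.sqrt_sq hz.le]
  simp only [unitNormal_eq_frame hx, mul_assoc, ← Finset.mul_sum]
  field_simp

lemma IsMetric.gInner_comm (hg : IsMetric g) (hx : x ∈ upperHalfSpace) (u v : Fin 3 → ℝ) :
    gInner g x u v = gInner g x v u := by
  simp only [gInner]
  rw [Finset.sum_comm]
  refine Finset.sum_congr rfl fun i _ => Finset.sum_congr rfl fun j _ => ?_
  rw [hg.symm hx j i]
  ring

lemma IsMetric.normalAngle_comm (hg : IsMetric g) (hx : x ∈ upperHalfSpace) (a b : E3) :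
    normalAngle g a b x = normalAngle g b a x := by
  rw [normalAngle, normalAngle, hg.gInner_comm hx]

lemma IsMetric.gInner_unitNormal_mem (hg : IsMetric g) (hx : x ∈ upperHalfSpace) (ha : ‖a‖ = 1)
    (hb : ‖b‖ = 1) :
    gInner g x (unitNormal g a x) (unitNormal g b x) ∈ Set.Icc (-1 : ℝ) 1 := by
  have h := hg.gInner_sq_le hx (unitNormal g a x) (unitNormal g b x)
  rw [hg.gInner_unitNormal_self hx ha, hg.gInner_unitNormal_self hx hb, one_mul] at h
  exact abs_le.1 ((sq_le_one_iff_abs_le_one _).1 h)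

/-- The hyperbolic metric is conformal to the Euclidean one, so its angles are Euclidean. -/
lemma normalAngle_hypMetric (hx : x ∈ upperHalfSpace) (ha : ‖a‖ = 1) (hb : ‖b‖ = 1) :
    normalAngle hypMetric a b x = Real.arccos ⟪a, b⟫ := by
  have h1 : frameConormSq hypMetric b x = 1 := by
    rw [← sum_coord_sq hb]
    simp [frameConormSq, frameInv_hypMetric hx]
  rw [normalAngle, isMetric_hypMetric.gInner_unitNormal_eq_frame hx, h1, inner_eq_sum]
  simp [frameNormal_hypMetric hx ha]

/-- The value `E(a, b)` of the deviation in the frame. -/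
def frameDevBil (g : MetricField) (a b x : E3) : ℝ := ∑ i, ∑ j, frameDev g x i j * a i * b j

lemma IsMetric.frameDevBil_comm (hg : IsMetric g) (hx : x ∈ upperHalfSpace) (a b : E3) :
    frameDevBil g a b x = frameDevBil g b a x := by
  simp only [frameDevBil]
  rw [Finset.sum_comm]
  refine Finset.sum_congr rfl fun i _ => Finset.sum_congr rfl fun j _ => ?_
  rw [frameDev_symm hg hx j i]
  ring

lemma inner_normalField (hx : x ∈ upperHalfSpace) (a v : E3) :
    ⟪normalField g a x, v⟫ = (x 2 ^ 2)⁻¹ * (⟪a, v⟫ + frameDevBil g v a x) := by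
  have hz : (0 : ℝ) < x 2 := hx
  have h1 : ⟪normalField g a x, v⟫ = ∑ i, ∑ j, g x i j * v i * a j := by
    rw [inner_eq_sum]
    refine Finset.sum_congr rfl fun i _ => ?_
    change (∑ j, g x i j * a j) * v i = _
    rw [Finset.sum_mul]
    exact Finset.sum_congr rfl fun j _ => by ring
  have h2 : ⟪a, v⟫ = ∑ i, ∑ j, (if i = j then 1 else 0) * v i * a j := by
    rw [inner_eq_sum]
    simp [mul_comm]
  rw [h1, h2, frameDevBil, ← Finset.sum_add_distrib, Finset.mul_sum]
  refine Finset.sum_congr rfl fun i _ => ?_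
  rw [← Finset.sum_add_distrib, Finset.mul_sum]
  refine Finset.sum_congr rfl fun j _ => ?_
  rw [frameDev]
  field_simp
  ring

/-- The flux of the fields `normalField` through an edge. -/
lemma IsMetric.edgeFlux_normalField (hg : IsMetric g) (hx : x ∈ upperHalfSpace) (ha : ‖a‖ = 1)
    (hb : ‖b‖ = 1) :
    x 2 ^ 2 * edgeFlux (normalField g) a b x = (√(1 - ⟪a, b⟫ ^ 2))⁻¹ *
      (2 * frameDevBil g a b x - ⟪a, b⟫ * (frameDevSq g a x + frameDevSq g b x)) := by
  have hz : (0 : ℝ) < x 2 := hx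
  have h : ∀ a b : E3, ‖a‖ = 1 → ⟪normalField g a x, conormal a b⟫
      = (x 2 ^ 2)⁻¹ * ((√(1 - ⟪a, b⟫ ^ 2))⁻¹ *
        (frameDevBil g b a x - ⟪a, b⟫ * frameDevSq g a x)) := by
    intro a b ha
    rw [real_inner_comm, inner_conormal, real_inner_comm (normalField g a x) b,
      real_inner_comm (normalField g a x) a, inner_normalField hx, inner_normalField hx,
      real_inner_self_eq_norm_sq, ha, frameDevSq, frameDevBil, frameDevBil]
    ring
  rw [edgeFlux, h a b ha, h b a hb, real_inner_comm a b, hg.frameDevBil_comm hx b a]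
  field_simp
  ring

end

section

variable {τ : ℝ} {g : MetricField} {α : Type*} {l : Filter α} {X a b : α → E3}

lemma isBigO_frameDevBil (hτ : 0 < τ) (hg : IsAsymptoticallyHyperbolic τ g)
    (hX : Tendsto X l (𝓟 upperHalfSpace)) (ha : ∀ᶠ y in l, ‖a y‖ = 1)
    (hb : ∀ᶠ y in l, ‖b y‖ = 1) :
    (fun y => frameDevBil g (a y) (b y) (X y)) =O[l] fun y => weight τ (X y) :=
  isBigO_sum fun i => isBigO_sum fun j => isBigO_mul_one (isBigO_mul_one
    ((isBigO_frameDev hτ hg i j).comp_tendsto hX) (isBigO_coord ha i)) (isBigO_coord hb j)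

lemma isBigO_inner (ha : ∀ᶠ y in l, ‖a y‖ = 1) (hb : ∀ᶠ y in l, ‖b y‖ = 1) :
    (fun y => ⟪a y, b y⟫) =O[l] fun _ => (1 : ℝ) := by
  simp only [inner_eq_sum]
  exact isBigO_sum fun i => isBigO_mul_one (isBigO_coord ha i) (isBigO_coord hb i)

/-- The second order expansion of the cosine of the angle between two planes. -/
lemma isBigO_gInner_sub_add (hτ : 0 < τ) (hg : IsAsymptoticallyHyperbolic τ g)
    (hX : Tendsto X l (𝓟 upperHalfSpace)) (ha : ∀ᶠ y in l, ‖a y‖ = 1)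
    (hb : ∀ᶠ y in l, ‖b y‖ = 1) :
    (fun y => gInner g (X y) (unitNormal g (a y) (X y)) (unitNormal g (b y) (X y)) - ⟪a y, b y⟫
      + frameDevBil g (a y) (b y) (X y)
      - 1 / 2 * ⟪a y, b y⟫ * (frameDevSq g (a y) (X y) + frameDevSq g (b y) (X y)))
      =O[l] fun y => weight τ (X y) * weight τ (X y) := by
  have hone : (fun _ : α => (1 : ℝ)) =O[l] fun _ => (1 : ℝ) := isBigO_refl _ _
  have hs := isBigO_inv_sqrt_sub_one hτ hg hX hb
  -- With `p = ⟪ν_a, b⟫` and `s` the length factor of `ν_b`, the cosine is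
  -- `p s = p + (p - ⟪a, b⟫) (s - 1) + ⟪a, b⟫ (s - 1)`.
  have h1 : (fun y => ∑ i, (frameNormal g (a y) (X y) i - a y i + ∑ j, frameDev g (X y) i j * a y j
      - 1 / 2 * frameDevSq g (a y) (X y) * a y i) * b y i)
      =O[l] fun y => weight τ (X y) * weight τ (X y) :=
    isBigO_sum fun i => isBigO_mul_one (isBigO_frameNormal_sub_add hτ hg hX ha i)
      (isBigO_coord hb i)
  have h2 : (fun y => (∑ i, (frameNormal g (a y) (X y) i - a y i) * b y i)
      * ((√(frameConormSq g (b y) (X y)))⁻¹ - 1))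
      =O[l] fun y => weight τ (X y) * weight τ (X y) :=
    (isBigO_sum fun i => isBigO_mul_one (isBigO_frameNormal_sub hτ hg hX ha i)
      (isBigO_coord hb i)).mul hs
  have h3 := isBigO_mul_one (isBigO_inv_sqrt_sub hτ hg hX hb) (isBigO_inner ha hb)
  refine ((h1.add h2).add h3).congr' ?_ .rfl
  filter_upwards [tendsto_principal.1 hX] with y hx
  have e1 : ∑ i, (∑ j, frameDev g (X y) i j * a y j) * b y i
      = frameDevBil g (a y) (b y) (X y) := by
    rw [hg.isMetric.frameDevBil_comm hx, frameDevBil]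
    refine Finset.sum_congr rfl fun i _ => ?_
    rw [Finset.sum_mul]
    exact Finset.sum_congr rfl fun j _ => by ring
  have e2 : ∑ i, 1 / 2 * frameDevSq g (a y) (X y) * a y i * b y i
      = 1 / 2 * frameDevSq g (a y) (X y) * ⟪a y, b y⟫ := by
    simp only [inner_eq_sum, mul_assoc, Finset.mul_sum]
  rw [hg.isMetric.gInner_unitNormal_eq_frame hx]
  simp only [add_mul, sub_mul, Finset.sum_add_distrib, Finset.sum_sub_distrib, e1, e2,
    ← inner_eq_sum]
  ring

lemma isBigO_gInner_sub (hτ : 0 < τ) (hg : IsAsymptoticallyHyperbolic τ g)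
    (hX : Tendsto X l (𝓟 upperHalfSpace)) (ha : ∀ᶠ y in l, ‖a y‖ = 1)
    (hb : ∀ᶠ y in l, ‖b y‖ = 1) :
    (fun y => gInner g (X y) (unitNormal g (a y) (X y)) (unitNormal g (b y) (X y)) - ⟪a y, b y⟫)
      =O[l] fun y => weight τ (X y) := by
  have h1 := (isBigO_gInner_sub_add hτ hg hX ha hb).trans (isBigO_weight_mul hτ)
  have h2 := isBigO_frameDevBil hτ hg hX ha hb
  have h3 := isBigO_mul_one ((isBigO_frameDevSq hτ hg hX ha).add (isBigO_frameDevSq hτ hg hX hb))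
    (isBigO_inner ha hb)
  refine ((h1.sub h2).add (h3.const_mul_left (1 / 2))).congr_left fun y => ?_
  ring

/-- The sum of the flux through an edge and of the angle difference, as densities with respect to
the hyperbolic length. -/
def edgeError (g : MetricField) (a b x : E3) : ℝ :=
  -(x 2 * edgeFlux (normalField g) a b x)
    + 2 * (potential x * (normalAngle g a b x - normalAngle hypMetric a b x))

/-- The edge error is quadratic in the deviation, uniformly as long as the angles stay away from
`0` and `π`. -/
lemma isBigO_edgeError (hτ : 0 < τ) (hg : IsAsymptoticallyHyperbolic τ g)
    (hX : Tendsto X l (𝓟 upperHalfSpace)) (ha : ∀ᶠ y in l, ‖a y‖ = 1)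
    (hb : ∀ᶠ y in l, ‖b y‖ = 1) {c : ℝ} (hc0 : 0 < c)
    (hc : ∀ᶠ y in l, c ≤ √(1 - ⟪a y, b y⟫ ^ 2)) :
    (fun y => X y 2 * edgeError g (a y) (b y) (X y))
      =O[l] fun y => weight τ (X y) * weight τ (X y) := by
  have h1 : (fun y => normalAngle g (a y) (b y) (X y) - normalAngle hypMetric (a y) (b y) (X y)
      + (gInner g (X y) (unitNormal g (a y) (X y)) (unitNormal g (b y) (X y)) - ⟪a y, b y⟫)
        / √(1 - ⟪a y, b y⟫ ^ 2)) =O[l] fun y => weight τ (X y) * weight τ (X y) := by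
    have h2 := isBigO_gInner_sub hτ hg hX ha hb
    refine IsBigO.trans (IsBigO.of_bound (3 * Real.pi ^ 2 / c ^ 3) ?_) (h2.mul h2)
    filter_upwards [ha, hb, hc, tendsto_principal.1 hX] with y hya hyb hyc hx
    have ht : ⟪a y, b y⟫ ∈ Set.Icc (-1 : ℝ) 1 := by
      have := abs_real_inner_le_norm (a y) (b y)
      rw [hya, hyb, one_mul] at this
      exact abs_le.1 this
    have h := abs_arccos_sub_add_le hc0 (hg.isMetric.gInner_unitNormal_mem hx hya hyb) ht hyc
    rw [normalAngle_hypMetric hx hya hyb, normalAngle, Real.norm_eq_abs, Real.norm_eq_abs, ← sq,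
      abs_sq]
    exact h
  have h2 : (fun y => (√(1 - ⟪a y, b y⟫ ^ 2))⁻¹) =O[l] fun _ => (1 : ℝ) := by
    refine IsBigO.of_bound c⁻¹ (hc.mono fun y hy => ?_)
    rw [norm_one, mul_one, Real.norm_eq_abs, abs_of_nonneg (by positivity)]
    exact inv_anti₀ hc0 hy
  have h3 := isBigO_mul_one (isBigO_gInner_sub_add hτ hg hX ha hb) h2
  refine ((h1.const_mul_left 2).sub (h3.const_mul_left 2)).congr' ?_ .rfl
  filter_upwards [ha, hb, hc, tendsto_principal.1 hX] with y hya hyb hyc hx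
  have hz : (0 : ℝ) < X y 2 := hx
  have h := hg.isMetric.edgeFlux_normalField hx hya hyb
  have e : ∀ A B : ℝ, X y 2 * (-(X y 2 * A) + 2 * (potential (X y) * B))
      = -(X y 2 ^ 2 * A) + 2 * B := fun A B => by
    rw [potential]
    field_simp
  rw [edgeError, e, h]
  ring

end

section

variable {g : MetricField} {a b : E3}

lemma IsMetric.continuousOn_frameConormSq (hg : IsMetric g) (a : E3) :
    ContinuousOn (frameConormSq g a) upperHalfSpace := by
  refine continuousOn_finsetSum _ fun i _ => continuousOn_finsetSum _ fun j _ => ?_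
  exact ((hg.continuousOn_frameInv i j).mul continuousOn_const).mul continuousOn_const

lemma IsMetric.continuousOn_inv_sqrt (hg : IsMetric g) (ha : ‖a‖ = 1) :
    ContinuousOn (fun x => (√(frameConormSq g a x))⁻¹) upperHalfSpace :=
  (hg.continuousOn_frameConormSq a).sqrt.inv₀ fun _ hx =>
    (Real.sqrt_pos.2 (hg.frameConormSq_pos hx ha)).ne'

lemma IsMetric.continuousOn_frameNormal (hg : IsMetric g) (ha : ‖a‖ = 1) (i : Fin 3) :
    ContinuousOn (fun x => frameNormal g a x i) upperHalfSpace :=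
  (continuousOn_finsetSum _ fun j _ => (hg.continuousOn_frameInv i j).mul
    continuousOn_const).mul (hg.continuousOn_inv_sqrt ha)

lemma IsMetric.continuousOn_normalAngle (hg : IsMetric g) (ha : ‖a‖ = 1) (hb : ‖b‖ = 1) :
    ContinuousOn (normalAngle g a b) upperHalfSpace := by
  have h : ContinuousOn (fun x => (∑ i, frameNormal g a x i * b i)
      * (√(frameConormSq g b x))⁻¹) upperHalfSpace :=
    (continuousOn_finsetSum _ fun i _ => (hg.continuousOn_frameNormal ha i).mul
      continuousOn_const).mul (hg.continuousOn_inv_sqrt hb)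
  exact Real.continuous_arccos.comp_continuousOn
    (h.congr fun x hx => hg.gInner_unitNormal_eq_frame hx a b)

lemma IsMetric.continuousOn_meanCurvature (hg : IsMetric g) (ha : ‖a‖ = 1) :
    ContinuousOn (meanCurvature g a) upperHalfSpace := by
  have hn := hg.continuousOn_frameNormal ha
  refine ContinuousOn.congr ?_ fun x hx => hg.meanCurvature_eq_frame hx ha
  refine (continuousOn_finsetSum _ fun i _ => continuousOn_finsetSum _ fun j _ => ?_).sub
    (continuousOn_const.mul (hn 2))
  refine ((hg.continuousOn_frameInv i j).sub ((hn i).mul (hn j))).mul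
    (continuousOn_finsetSum _ fun k _ => (hn k).mul ?_)
  exact (continuousOn_const.mul (hg.continuousOn_frameDer k i j)).sub
    (hg.continuousOn_frameDer i j k)

lemma IsMetric.continuousOn_massDensity (hg : IsMetric g) (ha : ‖a‖ = 1) :
    ContinuousOn (massDensity g a) upperHalfSpace := by
  refine ContinuousOn.congr ?_ fun x hx => hg.massIntegrand_normal hx ha
  refine continuousOn_coord_inv.mul (ContinuousOn.sub (ContinuousOn.sub ?_ ?_) ?_)
  · exact continuousOn_finsetSum _ fun i _ => continuousOn_finsetSum _ fun j _ =>
      continuousOn_const.mul (hg.continuousOn_frameDer j j i)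
  · exact continuousOn_finsetSum _ fun i _ => continuousOn_finsetSum _ fun j _ =>
      continuousOn_const.mul (hg.continuousOn_frameDer i j j)
  · exact continuousOn_const.mul (continuousOn_finsetSum _ fun i _ =>
      (hg.continuousOn_frameDev 2 i).mul continuousOn_const)

end

/-! ### Integration over the boundary of a polyhedron -/

section

variable {s : Set E3} {f : E3 → ℝ}

lemma measurable_areaDensity : Measurable fun x : E3 => ENNReal.ofReal (1 / x 2 ^ 2) := by
  fun_prop

lemma measurable_lengthDensity : Measurable fun x : E3 => ENNReal.ofReal (1 / x 2) := by
  fun_prop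

lemma toReal_areaDensity (x : E3) : (ENNReal.ofReal (1 / x 2 ^ 2)).toReal = (x 2 ^ 2)⁻¹ := by
  rw [ENNReal.toReal_ofReal (by positivity), one_div]

lemma toReal_lengthDensity {x : E3} (hx : x ∈ upperHalfSpace) :
    (ENNReal.ofReal (1 / x 2)).toReal = (x 2)⁻¹ := by
  have hz : (0 : ℝ) < x 2 := hx
  rw [ENNReal.toReal_ofReal (by positivity), one_div]

lemma integral_hypArea (hs : MeasurableSet s) :
    ∫ x in s, f x ∂hypArea = ∫ x in s, (x 2 ^ 2)⁻¹ * f x ∂μHE[2] := by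
  rw [hypArea, setIntegral_withDensity_eq_setIntegral_toReal_smul measurable_areaDensity
    (Eventually.of_forall fun _ => ENNReal.ofReal_lt_top) f hs]
  simp only [toReal_areaDensity, smul_eq_mul]

lemma integral_hypLength (hs : MeasurableSet s) (hsU : s ⊆ upperHalfSpace) :
    ∫ x in s, f x ∂hypLength = ∫ x in s, (x 2)⁻¹ * f x ∂μHE[1] := by
  rw [hypLength, setIntegral_withDensity_eq_setIntegral_toReal_smul measurable_lengthDensity
    (Eventually.of_forall fun _ => ENNReal.ofReal_lt_top) f hs]
  refine setIntegral_congr_fun hs fun x hx => ?_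
  simp only [toReal_lengthDensity (hsU hx), smul_eq_mul]

lemma integrableOn_hypArea_iff (hs : MeasurableSet s) :
    IntegrableOn f s hypArea ↔ IntegrableOn (fun x => (x 2 ^ 2)⁻¹ * f x) s μHE[2] := by
  rw [IntegrableOn, hypArea, restrict_withDensity hs,
    integrable_withDensity_iff_integrable_smul' measurable_areaDensity
      (Eventually.of_forall fun _ => ENNReal.ofReal_lt_top)]
  simp only [toReal_areaDensity, smul_eq_mul, IntegrableOn]

lemma integrableOn_hypLength_iff (hs : MeasurableSet s) (hsU : s ⊆ upperHalfSpace) :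
    IntegrableOn f s hypLength ↔ IntegrableOn (fun x => (x 2)⁻¹ * f x) s μHE[1] := by
  rw [IntegrableOn, hypLength, restrict_withDensity hs,
    integrable_withDensity_iff_integrable_smul' measurable_lengthDensity
      (Eventually.of_forall fun _ => ENNReal.ofReal_lt_top)]
  change IntegrableOn (fun x => (ENNReal.ofReal (1 / x 2)).toReal • f x) s μHE[1] ↔ _
  refine integrableOn_congr_fun (fun x hx => ?_) hs
  simp only [toReal_lengthDensity (hsU hx), smul_eq_mul]

end

section

variable {Δ : Set E3} {g : MetricField} {τ : ℝ}

lemma IsPolyhedron.frontier_subset (hΔ : IsPolyhedron Δ) : frontier Δ ⊆ Δ :=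
  hΔ.isCompact.isClosed.frontier_subset

lemma IsPolyhedron.exists_inv_le (hΔ : IsPolyhedron Δ) :
    ∃ κ : ℝ, 0 ≤ κ ∧ ∀ x ∈ Δ, (x 2)⁻¹ ≤ κ := by
  obtain ⟨κ, hκ⟩ := hΔ.isCompact.exists_bound_of_continuousOn
    (continuousOn_coord_inv.mono hΔ.subset)
  exact ⟨|κ|, abs_nonneg _, fun x hx => (le_abs_self _).trans ((hκ x hx).trans (le_abs_self _))⟩

/-- Functions of the position and of the normal that are `O(V)` are integrable over the boundary. -/
lemma integrableOn_frontier_hypArea (hΔ : IsPolyhedron Δ) (hE : ConvexEdges Δ)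
    {F : E3 → E3 → ℝ} (hF : ∀ a, ‖a‖ = 1 → ContinuousOn (F a) upperHalfSpace) {C : ℝ}
    (hC : ∀ a x, ‖a‖ = 1 → x ∈ upperHalfSpace → |x 2 * F a x| ≤ C) :
    IntegrableOn (fun x => F (outwardNormal Δ x) x) (frontier Δ) hypArea := by
  obtain ⟨κ, hκ0, hκ⟩ := hΔ.exists_inv_le
  rw [integrableOn_hypArea_iff isClosed_frontier.measurableSet]
  refine integrableOn_frontier (F := fun a x => (x 2 ^ 2)⁻¹ * F a x) (C := κ ^ 3 * C) hΔ hE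
    (fun a ha => ?_) fun a ha x hx => ?_
  · refine ((continuousOn_coord_inv.pow 2).mul (hF a ha)).congr fun x _ => ?_
    simp only [Pi.mul_apply, Pi.pow_apply, inv_pow]
  · have hz : (0 : ℝ) < x 2 := hΔ.subset hx
    have h := hC a x ha (hΔ.subset hx)
    have e : (x 2 ^ 2)⁻¹ * F a x = (x 2)⁻¹ ^ 3 * (x 2 * F a x) := by field_simp
    rw [e, abs_mul, abs_of_pos (by positivity)]
    have := hκ x hx
    gcongr

/-- Symmetric functions of the position and of the two normals that are `O(V)` are integrable over
the edges. -/
lemma integrableOn_edgeSet_hypLength (hΔ : IsPolyhedron Δ) (hE : ConvexEdges Δ)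
    {F : E3 → E3 → E3 → ℝ} (hs : ∀ a b x, x ∈ upperHalfSpace → F a b x = F b a x)
    (hF : ∀ a b, ‖a‖ = 1 → ‖b‖ = 1 → ContinuousOn (F a b) upperHalfSpace) {C : ℝ}
    (hC : ∀ a b x, IsConvexEdgePoint Δ x a b → |x 2 * F a b x| ≤ C) :
    IntegrableOn (fun x => F (edgeNormals Δ x).1 (edgeNormals Δ x).2 x) (edgeSet Δ) hypLength := by
  obtain ⟨κ, hκ0, hκ⟩ := hΔ.exists_inv_le
  rw [integrableOn_hypLength_iff (measurableSet_edgeSet hE hΔ)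
    ((edgeSet_subset_frontier hE).trans (hΔ.frontier_subset.trans hΔ.subset))]
  refine integrableOn_edgeSet (F := fun a b x => (x 2)⁻¹ * F a b x) (C := κ ^ 2 * C) hΔ hE
    (fun a b x hx => by rw [hs a b x hx])
    (fun a b ha hb => continuousOn_coord_inv.mul (hF a b ha hb)) fun a b x h => ?_
  have hz : (0 : ℝ) < x 2 := hΔ.subset h.mem
  have h1 := hC a b x h
  have e : (x 2)⁻¹ * F a b x = (x 2)⁻¹ ^ 2 * (x 2 * F a b x) := by field_simp
  rw [e, abs_mul, abs_of_pos (by positivity)]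
  have := hκ x h.mem
  gcongr

/-- Uniform bounds for functions of the position and of a unit normal. -/
lemma exists_bound_of_isBigO {f : E3 → E3 → ℝ} {u : E3 → ℝ}
    (h : ∀ {l : Filter (E3 × E3)}, Tendsto Prod.snd l (𝓟 upperHalfSpace) →
      (∀ᶠ y in l, ‖y.1‖ = 1) → (fun y => f y.1 y.2) =O[l] fun y => u y.2) :
    ∃ C, 0 ≤ C ∧ ∀ a x, ‖a‖ = 1 → x ∈ upperHalfSpace → |f a x| ≤ C * |u x| := by
  obtain ⟨C, hC0, hC⟩ := (h (l := 𝓟 {y | ‖y.1‖ = 1 ∧ y.2 ∈ upperHalfSpace})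
    (tendsto_principal_principal.2 fun y hy => hy.2)
    (eventually_principal.2 fun y hy => hy.1)).exists_nonneg
  exact ⟨C, hC0, fun a x ha hx => eventually_principal.1 hC.bound (a, x) ⟨ha, hx⟩⟩

/-- Quadratic decay, together with the growth of `V`. -/
lemma abs_le_of_mul_le {x : E3} (hx : x ∈ upperHalfSpace) {C F : ℝ}
    (h : |x 2 * F| ≤ C * |weight τ x * weight τ x|) :
    |F| ≤ 2 * C * Real.cosh (rad x) ^ (-2 * τ + 1) := by
  have hz : (0 : ℝ) < x 2 := hx
  have hw := weight_pos τ x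
  have hch := Real.cosh_pos (rad x)
  rw [abs_mul, abs_of_pos hz, abs_of_pos (mul_pos hw hw)] at h
  have e : Real.cosh (rad x) ^ (-2 * τ + 1) = weight τ x * weight τ x * Real.cosh (rad x) := by
    rw [weight, Real.rpow_add hch, Real.rpow_one, ← Real.rpow_add hch]
    ring_nf
  have hV := potential_le hx
  calc |F| = potential x * (x 2 * |F|) := by rw [potential]; field_simp
    _ ≤ 2 * Real.cosh (rad x) * (C * (weight τ x * weight τ x)) := by gcongr
    _ = _ := by rw [e]; ring

lemma exists_bound_faceError (hτ : 0 < τ) (hg : IsAsymptoticallyHyperbolic τ g) :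
    ∃ C, 0 ≤ C ∧ ∀ a x, ‖a‖ = 1 → x ∈ upperHalfSpace →
      |x 2 * faceError g a x| ≤ C * |weight τ x * weight τ x| :=
  exists_bound_of_isBigO (f := fun a x => x 2 * faceError g a x)
    (u := fun x => weight τ x * weight τ x) fun hX ha => isBigO_faceError hτ hg hX ha

lemma exists_bound_edgeError (hτ : 0 < τ) (hg : IsAsymptoticallyHyperbolic τ g) {c : ℝ}
    (hc : 0 < c) : ∃ C, 0 ≤ C ∧ ∀ a b x, ‖a‖ = 1 → ‖b‖ = 1 → c ≤ √(1 - ⟪a, b⟫ ^ 2) →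
      x ∈ upperHalfSpace → |x 2 * edgeError g a b x| ≤ C * |weight τ x * weight τ x| := by
  obtain ⟨C, hC0, hC⟩ := (isBigO_edgeError (X := fun y : E3 × E3 × E3 => y.2.2)
    (a := fun y => y.1) (b := fun y => y.2.1) (l := 𝓟 {y | (‖y.1‖ = 1 ∧ ‖y.2.1‖ = 1) ∧
      c ≤ √(1 - ⟪y.1, y.2.1⟫ ^ 2) ∧ y.2.2 ∈ upperHalfSpace}) hτ hg
    (tendsto_principal_principal.2 fun y hy => hy.2.2)
    (eventually_principal.2 fun y hy => hy.1.1) (eventually_principal.2 fun y hy => hy.1.2)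
    hc (eventually_principal.2 fun y hy => hy.2.1)).exists_nonneg
  exact ⟨C, hC0, fun a b x ha hb hab hx =>
    eventually_principal.1 hC.bound (a, b, x) ⟨⟨ha, hb⟩, hab, hx⟩⟩

lemma abs_coord_le_one {a : E3} (ha : ‖a‖ = 1) (i : Fin 3) : |a i| ≤ 1 := by
  rw [← ha]
  exact PiLp.norm_apply_le a i

/-- The densities of the face terms are `O(V)`. -/
lemma exists_bound_face (hτ : 0 < τ) (hg : IsAsymptoticallyHyperbolic τ g) :
    ∃ C, ∀ a x, ‖a‖ = 1 → x ∈ upperHalfSpace → |x 2 * massDensity g a x| ≤ C ∧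
      |x 2 * (2 * potential x * (meanCurvature g a x - meanCurvature hypMetric a x))| ≤ C ∧
      |x 2 * (x 2 ^ 2 * tangentialDiv a (normalField g a) x)| ≤ C := by
  obtain ⟨C1, -, h1⟩ := exists_bound_of_isBigO (f := fun a x => x 2 * massDensity g a x)
    (u := fun _ => 1) fun hX ha => isBigO_massDensity hτ hg hX ha
  obtain ⟨C2, -, h2⟩ := exists_bound_of_isBigO (f := fun a x => meanCurvature g a x)
    (u := fun _ => 1) fun hX ha => isBigO_meanCurvature hτ hg hX ha
  obtain ⟨C3, -, h3⟩ := exists_bound_of_isBigO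
    (f := fun a x => x 2 ^ 3 * tangentialDiv a (normalField g a) x)
    (u := fun _ => 1) fun hX ha => isBigO_tangentialDiv_normalField hτ hg hX ha
  refine ⟨max C1 (max (2 * (C2 + 2)) C3), fun a x ha hx => ⟨?_, ?_, ?_⟩⟩
  · refine le_trans ?_ (le_max_left _ _)
    simpa using h1 a x ha hx
  · refine le_trans ?_ ((le_max_left _ _).trans (le_max_right _ _))
    have hz : (0 : ℝ) < x 2 := hx
    have h4 : |meanCurvature g a x| ≤ C2 := by simpa using h2 a x ha hx
    have h5 : |meanCurvature hypMetric a x| ≤ 2 := by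
      rw [meanCurvature_hypMetric hx ha, abs_mul, abs_neg, abs_two]
      linarith [abs_coord_le_one ha 2]
    have e : x 2 * (2 * potential x * (meanCurvature g a x - meanCurvature hypMetric a x))
        = 2 * (meanCurvature g a x - meanCurvature hypMetric a x) := by
      rw [potential]
      field_simp
    rw [e, abs_mul, abs_two]
    linarith [abs_sub (meanCurvature g a x) (meanCurvature hypMetric a x)]
  · refine le_trans ?_ ((le_max_right _ _).trans (le_max_right _ _))
    rw [show x 2 * (x 2 ^ 2 * tangentialDiv a (normalField g a) x)
      = x 2 ^ 3 * tangentialDiv a (normalField g a) x by ring]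
    simpa using h3 a x ha hx

/-- The fields `normalField` satisfy the hypotheses of the divergence theorem. -/
lemma exists_isAdmissible_normalField (hτ : 0 < τ) (hg : IsAsymptoticallyHyperbolic τ g)
    (hΔ : IsPolyhedron Δ) : ∃ C, IsAdmissible Δ (normalField g) C := by
  obtain ⟨C1, hC1⟩ := exists_bound_face hτ hg
  obtain ⟨κ, hκ0, hκ⟩ := hΔ.exists_inv_le
  have hcont : ContinuousOn (fun y : E3 × E3 => normalField g y.1 y.2)
      (Metric.sphere 0 1 ×ˢ Δ) := by
    refine (PiLp.continuous_toLp 2 _).comp_continuousOn (continuousOn_pi.2 fun i => ?_)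
    refine continuousOn_finsetSum _ fun j _ => ContinuousOn.mul ?_ ?_
    · exact (hg.isMetric.continuousOn i j).comp continuousOn_snd fun y hy => hΔ.subset hy.2
    · fun_prop
  obtain ⟨C2, hC2⟩ := ((isCompact_sphere (0 : E3) 1).prod
    hΔ.isCompact).exists_bound_of_continuousOn hcont
  refine ⟨max C2 (κ ^ 3 * C1), fun a _ => hg.isMetric.contDiffOn_normalField a,
    fun a ha x hx => ?_, fun a ha x hx => ?_⟩
  · exact (hC2 (a, x) ⟨by simpa using ha, hx⟩).trans (le_max_left _ _)
  · refine le_trans ?_ (le_max_right _ _)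
    have hz : (0 : ℝ) < x 2 := hΔ.subset hx
    have h := (hC1 a x ha (hΔ.subset hx)).2.2
    have e : tangentialDiv a (normalField g a) x
        = (x 2)⁻¹ ^ 3 * (x 2 * (x 2 ^ 2 * tangentialDiv a (normalField g a) x)) := by field_simp
    rw [e, abs_mul, abs_of_pos (by positivity)]
    have := hκ x hx
    gcongr

/-- A dihedral angle `π + θ` with `θ ∈ [0, π]` has a non-positive sine, so that there are no reflex
edges. -/
lemma convexEdges_of_le_sin {c : ℝ} (hc : 0 < c)
    (h : ∀ p ∈ edgeSet Δ, c ≤ Real.sin (dihedralAngle hypMetric Δ p)) : ConvexEdges Δ := by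
  intro p hp
  by_contra hno
  have h1 : ¬ ∃ ab : E3 × E3, IsConvexEdgePoint Δ p ab.1 ab.2 := fun ⟨ab, hab⟩ =>
    hno ⟨ab.1, ab.2, hab⟩
  have h2 : ∃ ab : E3 × E3, IsReflexEdgePoint Δ p ab.1 ab.2 := by
    obtain ⟨a, b, hab | hab⟩ := hp
    · exact absurd ⟨(a, b), hab⟩ h1
    · exact ⟨(a, b), hab⟩
  have h3 := h p hp
  rw [dihedralAngle, dif_neg h1, dif_pos h2, add_comm, Real.sin_add_pi] at h3
  have h4 : 0 ≤ Real.sin (normalAngle hypMetric h2.choose.1 h2.choose.2 p) :=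
    Real.sin_nonneg_of_nonneg_of_le_pi (Real.arccos_nonneg _) (Real.arccos_le_pi _)
  linarith

/-- The sine of the hyperbolic dihedral angle. -/
lemma IsConvexEdgePoint.sin_dihedralAngle {p a b : E3} (h : IsConvexEdgePoint Δ p a b)
    (hp : p ∈ upperHalfSpace) :
    Real.sin (dihedralAngle hypMetric Δ p) = √(1 - ⟪a, b⟫ ^ 2) := by
  have h' := h.edgeNormals_spec
  rw [h.dihedralAngle_eq, Real.sin_pi_sub, normalAngle_hypMetric hp h'.1 h'.2.1, Real.sin_arccos]
  rcases h.edgeNormals_eq with e | e <;> rw [e]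
  rw [real_inner_comm]

lemma IsConvexEdgePoint.edgeTerm_eq {p a b : E3} (h : IsConvexEdgePoint Δ p a b) :
    edgeTerm g Δ p = -(potential p * (normalAngle g (edgeNormals Δ p).1 (edgeNormals Δ p).2 p
      - normalAngle hypMetric (edgeNormals Δ p).1 (edgeNormals Δ p).2 p)) := by
  rw [edgeTerm, h.dihedralAngle_eq, h.dihedralAngle_eq]
  ring

/-- On the complement of the open faces, where the outward normal is `0` by convention, the face
error vanishes. -/
lemma faceError_zero (g : MetricField) (x : E3) : faceError g 0 x = 0 := by
  have h1 : ∀ g : MetricField, unitNormal g 0 = fun _ _ => 0 := fun g => by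
    funext y i
    simp [unitNormal]
  have h2 : ∀ g : MetricField, meanCurvature g 0 x = 0 := fun g => by
    simp [meanCurvature, secondFF, covDerivVec, h1, pd]
  have h3 : normalField g 0 = fun _ => 0 := by
    funext y
    ext i
    simp [normalField]
  simp [faceError, massDensity, h1, h2, h3, tangentialDiv]

/-- The comparison of the flux with the mean curvatures and the dihedral angles on one polyhedron:
the errors on faces and edges are explicit densities. -/
theorem massFlux_eq (hτ : 0 < τ) (hg : IsAsymptoticallyHyperbolic τ g) {c : ℝ} (hc : 0 < c)
    (hΔ : IsPolyhedron Δ) (h : ∀ p ∈ edgeSet Δ, c ≤ Real.sin (dihedralAngle hypMetric Δ p)) :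
    IntegrableOn (faceTerm g Δ) (frontier Δ) hypArea ∧
    IntegrableOn (edgeTerm g Δ) (edgeSet Δ) hypLength ∧
    IntegrableOn (fun x => faceError g (outwardNormal Δ x) x) (frontier Δ) hypArea ∧
    IntegrableOn (fun x => edgeError g (edgeNormals Δ x).1 (edgeNormals Δ x).2 x) (edgeSet Δ)
      hypLength ∧
    massFlux g Δ = -(∫ x in frontier Δ, faceTerm g Δ x ∂hypArea)
      + 2 * (∫ x in edgeSet Δ, edgeTerm g Δ x ∂hypLength)
      + (∫ x in frontier Δ, faceError g (outwardNormal Δ x) x ∂hypArea)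
      + ∫ x in edgeSet Δ, edgeError g (edgeNormals Δ x).1 (edgeNormals Δ x).2 x ∂hypLength := by
  have hm := hg.isMetric
  have hE := convexEdges_of_le_sin hc h
  have hEm := measurableSet_edgeSet hE hΔ
  have hfU : frontier Δ ⊆ upperHalfSpace := hΔ.frontier_subset.trans hΔ.subset
  have hEU : edgeSet Δ ⊆ upperHalfSpace := (edgeSet_subset_frontier hE).trans hfU
  obtain ⟨C, hC⟩ := exists_bound_face hτ hg
  obtain ⟨Ce, hCe0, hCe⟩ := exists_bound_edgeError hτ hg hc
  obtain ⟨Cd, hY⟩ := exists_isAdmissible_normalField hτ hg hΔ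
  have hVc : ContinuousOn potential upperHalfSpace :=
    continuousOn_coord_inv.congr fun x _ => one_div (x 2)
  -- The three densities on the faces.
  have i1 : IntegrableOn (fun x => massDensity g (outwardNormal Δ x) x) (frontier Δ) hypArea :=
    integrableOn_frontier_hypArea (F := massDensity g) hΔ hE
      (fun a ha => hm.continuousOn_massDensity ha) fun a x ha hx => (hC a x ha hx).1
  have i2 : IntegrableOn (faceTerm g Δ) (frontier Δ) hypArea :=
    integrableOn_frontier_hypArea (F := fun a x => 2 * potential x *
      (meanCurvature g a x - meanCurvature hypMetric a x)) hΔ hE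
      (fun a ha => (continuousOn_const.mul hVc).mul ((hm.continuousOn_meanCurvature ha).sub
        (isMetric_hypMetric.continuousOn_meanCurvature ha))) fun a x ha hx => (hC a x ha hx).2.1
  have i3 : IntegrableOn (fun x => x 2 ^ 2 * tangentialDiv (outwardNormal Δ x)
      (normalField g (outwardNormal Δ x)) x) (frontier Δ) hypArea :=
    integrableOn_frontier_hypArea (F := fun a x => x 2 ^ 2 * tangentialDiv a (normalField g a) x)
      hΔ hE (fun a ha => (continuousOn_coord.pow 2).mul
        (continuousOn_tangentialDiv (hm.contDiffOn_normalField a)))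
      fun a x ha hx => (hC a x ha hx).2.2
  have hface : ∫ x in frontier Δ, faceError g (outwardNormal Δ x) x ∂hypArea
      = massFlux g Δ + (∫ x in frontier Δ, faceTerm g Δ x ∂hypArea)
        + ∫ x in frontier Δ, x 2 ^ 2 * tangentialDiv (outwardNormal Δ x)
          (normalField g (outwardNormal Δ x)) x ∂hypArea := by
    change ∫ x in frontier Δ, (massDensity g (outwardNormal Δ x) x + faceTerm g Δ x
      + x 2 ^ 2 * tangentialDiv (outwardNormal Δ x) (normalField g (outwardNormal Δ x)) x) ∂hypArea
      = _
    have h12 : IntegrableOn (fun x => massDensity g (outwardNormal Δ x) x + faceTerm g Δ x)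
        (frontier Δ) hypArea := i1.add i2
    rw [integral_add h12 i3, integral_add i1 i2]
    rfl
  -- The two densities on the edges.
  have hsym : ∀ (a b x : E3), x ∈ upperHalfSpace →
      potential x * (normalAngle g a b x - normalAngle hypMetric a b x)
        = potential x * (normalAngle g b a x - normalAngle hypMetric b a x) := fun a b x hx => by
    rw [hm.normalAngle_comm hx, isMetric_hypMetric.normalAngle_comm hx]
  have hcontA : ∀ a b : E3, ‖a‖ = 1 → ‖b‖ = 1 → ContinuousOn (fun x =>
      potential x * (normalAngle g a b x - normalAngle hypMetric a b x)) upperHalfSpace :=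
    fun a b ha hb => hVc.mul ((hm.continuousOn_normalAngle ha hb).sub
      (isMetric_hypMetric.continuousOn_normalAngle ha hb))
  have j0 := integrableOn_edgeSet_hypLength (C := Real.pi) hΔ hE hsym hcontA
    fun a b x hx => by
      have hz : (0 : ℝ) < x 2 := hΔ.subset hx.mem
      rw [potential, one_div, mul_inv_cancel_left₀ hz.ne', abs_le]
      have h1 := Real.arccos_nonneg (gInner g x (unitNormal g a x) (unitNormal g b x))
      have h2 := Real.arccos_le_pi (gInner g x (unitNormal g a x) (unitNormal g b x))
      have h3 := Real.arccos_nonneg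
        (gInner hypMetric x (unitNormal hypMetric a x) (unitNormal hypMetric b x))
      have h4 := Real.arccos_le_pi
        (gInner hypMetric x (unitNormal hypMetric a x) (unitNormal hypMetric b x))
      constructor <;> rw [normalAngle, normalAngle] <;> linarith
  have hterm : Set.EqOn (fun x => -(potential x * (normalAngle g (edgeNormals Δ x).1
      (edgeNormals Δ x).2 x - normalAngle hypMetric (edgeNormals Δ x).1 (edgeNormals Δ x).2 x)))
      (edgeTerm g Δ) (edgeSet Δ) := fun x hx => by
    obtain ⟨a, b, hab⟩ := hE x hx
    exact hab.edgeTerm_eq.symm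
  have j1 : IntegrableOn (edgeTerm g Δ) (edgeSet Δ) hypLength := j0.neg.congr_fun hterm hEm
  have j2 : IntegrableOn (fun x => edgeError g (edgeNormals Δ x).1 (edgeNormals Δ x).2 x)
      (edgeSet Δ) hypLength := by
    refine integrableOn_edgeSet_hypLength (F := edgeError g) (C := Ce) hΔ hE
      (fun a b x hx => ?_) (fun a b ha hb => ?_) fun a b x hx => ?_
    · rw [edgeError, edgeError, hsym a b x hx, edgeFlux_symm]
    · have hc : ∀ a b : E3, ContinuousOn (fun x => ⟪normalField g a x, conormal a b⟫)
          upperHalfSpace := fun a b =>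
        (hm.contDiffOn_normalField a).continuousOn.inner continuousOn_const
      exact (continuousOn_coord.mul ((hc a b).add (hc b a))).neg.add
        (continuousOn_const.mul (hcontA a b ha hb))
    · have hxU := hΔ.subset hx.mem
      refine (hCe a b x hx.1 hx.2.1 ?_ hxU).trans ?_
      · rw [← hx.sin_dihedralAngle hxU]
        exact h x hx.mem_edgeSet
      · have hw := weight_pos τ x
        have hw1 := weight_le_one hτ x
        rw [abs_of_pos (mul_pos hw hw)]
        calc Ce * (weight τ x * weight τ x) ≤ Ce * (1 * 1) := by gcongr
          _ = Ce := by ring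
  have j3 : IntegrableOn (fun x => x 2 * edgeFlux (normalField g) (edgeNormals Δ x).1
      (edgeNormals Δ x).2 x) (edgeSet Δ) hypLength := by
    refine IntegrableOn.congr_fun (Integrable.sub (j0.const_mul 2) j2) (fun x _ => ?_) hEm
    simp only [edgeError, Pi.sub_apply]
    ring
  have hedge : ∫ x in edgeSet Δ, edgeError g (edgeNormals Δ x).1 (edgeNormals Δ x).2 x ∂hypLength
      = -(∫ x in edgeSet Δ, x 2 * edgeFlux (normalField g) (edgeNormals Δ x).1
        (edgeNormals Δ x).2 x ∂hypLength) - 2 * ∫ x in edgeSet Δ, edgeTerm g Δ x ∂hypLength := by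
    have j3' : IntegrableOn (fun x => -(x 2 * edgeFlux (normalField g) (edgeNormals Δ x).1
        (edgeNormals Δ x).2 x)) (edgeSet Δ) hypLength := j3.neg
    rw [← integral_neg, ← integral_const_mul, ← integral_sub j3' (j1.const_mul 2)]
    refine setIntegral_congr_fun hEm fun x hx => ?_
    simp only [← hterm hx, edgeError]
    ring
  -- The divergence theorem moves the divergence from the faces to the edges.
  have hdiv : ∫ x in frontier Δ, x 2 ^ 2 * tangentialDiv (outwardNormal Δ x)
        (normalField g (outwardNormal Δ x)) x ∂hypArea
      = ∫ x in edgeSet Δ, x 2 * edgeFlux (normalField g) (edgeNormals Δ x).1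
        (edgeNormals Δ x).2 x ∂hypLength := by
    rw [integral_hypArea isClosed_frontier.measurableSet, integral_hypLength hEm hEU]
    refine Eq.trans ?_ ((integral_tangentialDiv_frontier hY hΔ hE).trans ?_)
    · refine setIntegral_congr_fun isClosed_frontier.measurableSet fun x hx => ?_
      have hz : (0 : ℝ) < x 2 := hfU hx
      simp only
      rw [inv_mul_cancel_left₀ (by positivity)]
    · refine setIntegral_congr_fun hEm fun x hx => ?_
      have hz : (0 : ℝ) < x 2 := hEU hx
      simp only
      rw [inv_mul_cancel_left₀ hz.ne']
  have i4 : IntegrableOn (fun x => faceError g (outwardNormal Δ x) x) (frontier Δ) hypArea :=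
    (i1.add i2).add i3
  refine ⟨i2, j1, i4, j2, ?_⟩
  rw [hface, hedge, hdiv]
  ring

end

end AHMass

end

theorem theorem1p1 (τ : ℝ) (hτ : 3 / 2 < τ) (g : AHMass.MetricField)
    (hg : AHMass.IsAsymptoticallyHyperbolic τ g) (c : ℝ) (hc : 0 < c) :
    ∃ C : ℝ, ∀ (ι : Type*) (l : Filter ι) [l.NeBot] (Δ : ι → Set AHMass.E3) (M : ℝ),
      (∀ q, AHMass.IsPolyhedron (Δ q)) →
      Tendsto (fun q => AHMass.massFlux g (Δ q)) l (𝓝 M) →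
      (∀ q, ∀ p ∈ AHMass.edgeSet (Δ q),
        c ≤ Real.sin (AHMass.dihedralAngle AHMass.hypMetric (Δ q) p)) →
      (∀ q, IntegrableOn (AHMass.faceTerm g (Δ q)) (frontier (Δ q)) AHMass.hypArea ∧
        IntegrableOn (AHMass.edgeTerm g (Δ q)) (AHMass.edgeSet (Δ q)) AHMass.hypLength) ∧
      ∃ (φ ψ : ι → AHMass.E3 → ℝ) (ε : ι → ℝ),
        (∀ q, IntegrableOn (φ q) (frontier (Δ q)) AHMass.hypArea ∧
          ∀ x ∈ frontier (Δ q),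
            |φ q x| ≤ C * Real.cosh (AHMass.rad x) ^ (-2 * τ + 1)) ∧
        (∀ q, IntegrableOn (ψ q) (AHMass.edgeSet (Δ q)) AHMass.hypLength ∧
          ∀ x ∈ AHMass.edgeSet (Δ q),
            |ψ q x| ≤ C * Real.cosh (AHMass.rad x) ^ (-2 * τ + 1)) ∧
        Tendsto ε l (𝓝 0) ∧
        ∀ q, M = -(∫ x in frontier (Δ q), AHMass.faceTerm g (Δ q) x ∂AHMass.hypArea)
          + 2 * (∫ x in AHMass.edgeSet (Δ q), AHMass.edgeTerm g (Δ q) x ∂AHMass.hypLength)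
          + (∫ x in frontier (Δ q), φ q x ∂AHMass.hypArea)
          + (∫ x in AHMass.edgeSet (Δ q), ψ q x ∂AHMass.hypLength)
          + ε q := by
  have hτ0 : 0 < τ := by linarith
  obtain ⟨Cf, hCf0, hCf⟩ := AHMass.exists_bound_faceError hτ0 hg
  obtain ⟨Ce, -, hCe⟩ := AHMass.exists_bound_edgeError hτ0 hg hc
  refine ⟨2 * max Cf Ce, fun ι l _ Δ M hΔ hM hsin => ?_⟩
  have hmain := fun q => AHMass.massFlux_eq hτ0 hg hc (hΔ q) (hsin q)
  refine ⟨fun q => ⟨(hmain q).1, (hmain q).2.1⟩,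
    fun q x => AHMass.faceError g (AHMass.outwardNormal (Δ q) x) x,
    fun q x => AHMass.edgeError g (AHMass.edgeNormals (Δ q) x).1
      (AHMass.edgeNormals (Δ q) x).2 x,
    fun q => M - AHMass.massFlux g (Δ q), fun q => ⟨(hmain q).2.2.1, fun x hx => ?_⟩,
    fun q => ⟨(hmain q).2.2.2.1, fun x hx => ?_⟩, ?_, fun q => ?_⟩
  · have hxU := (hΔ q).subset ((hΔ q).frontier_subset hx)
    beta_reduce
    by_cases hf : x ∈ AHMass.faceSet (Δ q)
    · obtain ⟨a, ha⟩ := hf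
      rw [ha.outwardNormal_eq]
      refine (AHMass.abs_le_of_mul_le hxU (hCf a x ha.1 hxU)).trans ?_
      gcongr
      exact le_max_left _ _
    · -- The vertices and the edge points carry the normal `0`, where the face error vanishes.
      rw [AHMass.outwardNormal_of_notMem hf, AHMass.faceError_zero, abs_zero]
      have := Real.cosh_pos (AHMass.rad x)
      have := hCf0.trans (le_max_left Cf Ce)
      positivity
  · obtain ⟨a, b, hab⟩ := AHMass.convexEdges_of_le_sin hc (hsin q) x hx
    have hxU := (hΔ q).subset hab.mem
    have h := hab.edgeNormals_spec
    beta_reduce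
    refine (AHMass.abs_le_of_mul_le hxU (hCe _ _ x h.1 h.2.1 ?_ hxU)).trans ?_
    · rw [← h.sin_dihedralAngle hxU]
      exact hsin q x hx
    · gcongr
      exact le_max_right _ _
  · simpa using hM.const_sub M
  · beta_reduce
    rw [(hmain q).2.2.2.2]
    ring
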